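/- Let $0<q<1$, $a\in\mathbb{R}$, $t=q^a-q^{-a}$, and for $x\in\mathbb{R}$ put $[x]=\frac{q^x-q^{-x}}{q-q^{-1}}$ and $\langle x\rangle=q^x+q^{-x}$. **The algebras.** $\mathcal{O}_q(SU(2))$ is the universal unital $*$-algebra generated by the entries of a unitary matrix $U=\begin{pmatrix}\alpha&\beta\\ \gamma&\delta\end{pmatrix}$ with $U^*=\begin{pmatrix}\delta&-q^{-1}\beta\\-q\gamma&\alpha\end{pmatrix}$, with coproduct $\Delta(U_{ij})=\sum_k U_{ik}\otimes U_{kj}$. The Podleś sphere $\mathcal{O}_q(S_t^2)\subseteq\mathcal{O}_q(SU(2))$ is the unital $*$-subalgebra generated by the entries of $$E_t=U^*\begin{pmatrix}0&i\\-i&-t\end{pmatrix}U=\begin{pmatrix}q^{-1}Z_t&Y_t\\X_t&-t-qZ_t\end{pmatrix}.$$ In $U_q(\mathfrak{su}(2))$, with $\Delta(K)=K\otimes K$, $\Delta(E)=E\otimes1+K\otimes E$, $\Delta(F)=F\otimes K^{-1}+1\otimes F$, paired with $\mathcal{O}_q(SU(2))$ by $$\tau(U,K)=\begin{pmatrix}q&0\\0&q^{-1}\end{pmatrix},\quad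 \tau(U,E)=\begin{pmatrix}0&q^{1/2}\\0&0\end{pmatrix},\quad \tau(U,F)=\begin{pmatrix}0&0\\q^{-1/2}&0\end{pmatrix},$$ let $B_t=q^{-1/2}(E-FK)-i(q-q^{-1})^{-1}tK$, so that $\Delta(iB_t)=iB_t\otimes1+K\otimes(iB_t-[a])$. Then $U_q(\mathfrak{sl}(2,\mathbb{R})_t)$ is the universal unital $*$-algebra generated by $\mathcal{O}_q(S_t^2)$ and $U_q(\mathfrak{so}(2)_t)=\mathbb{C}[B_t]$ (with $iB_t$ self-adjoint) subject to $xf=\tau(f_{(2)},x_{(1)})f_{(1)}x_{(2)}$ for $f\in\mathcal{O}_q(S_t^2)$, $x\in U_q(\mathfrak{so}(2)_t)$. **The representations.** An admissible unitary representation is a $*$-representation of $U_q(\mathfrak{sl}(2,\mathbb{R})_t)$ on a pre-Hilbert space $V$ for which $iB_t$ is diagonalizable with eigenvalues in $\{[a+n]\mid n\in\mathbb{Z}\}$; it is irreducible if $V\neq0$ and $V$ has no closed invariant subspaces other than $0$ and $V$. Such representations correspond to the unitary representations of the convolution algebra $\mathcal{U}_q(SL(2,\mathbb{R})_t)$ of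 quantum $SL(2,\mathbb{R})$. An irreducible one is labelled by the value $\lambda\in\mathbb{R}$ of the Casimir element $\Omega_t=iq^{-1}X_t+(q-q^{-1})iZ_tB_t-iqY_t$ and the set $S$ of eigenvalues of $iB_t$, as follows (here $n\in\mathbb{Z}_{>0}$): * $\mathcal{L}_\lambda^+$: $-\langle1-2s\rangle<\lambda<\langle1\rangle$ with $s=\lceil a\rceil-a$, and $S=\{[a+2k]\mid k\in\mathbb{Z}\}$; * $\mathcal{L}_\lambda^-$: $-\langle1-2s\rangle<\lambda<\langle0\rangle$ with $s=\lceil a-\frac12\rceil-(a-\frac12)$, and $S=\{[a+2k+1]\mid k\in\mathbb{Z}\}$; * $\mathcal{D}_n^+$: $\lambda=\langle n-1\rangle$, $S=\{[a+n+2k]\mid k\in\mathbb{Z}_{\ge0}\}$; * $\mathcal{D}_n^-$: $\lambda=\langle n-1\rangle$, $S=\{[a-n-2k]\mid k\in\mathbb{Z}_{\ge0}\}$; * $\mathcal{E}_n^+$: $\lambda=-\langle2a+\lfloor-2a\rfloor+n-1\rangle$, $S=\{[a+\lfloor-2a\rfloor+n+2k]\mid k\in\mathbb{Z}_{\ge0}\}$;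 * $\mathcal{E}_n^-$: $\lambda=-\langle-2a+\lfloor2a\rfloor+n-1\rangle$, $S=\{[a-\lfloor2a\rfloor-n-2k]\mid k\in\mathbb{Z}_{\ge0}\}$; * $\mathcal{T}^+$: $\lambda=\langle1\rangle$, $S=\{[a]\}$; * $\mathcal{T}^-$ (only if $a\in\frac12\mathbb{Z}$): $\lambda=-\langle1\rangle$, $S=\{[-a]\}$. **Representations of the Podleś sphere.** $\pi_\pm$ is the unitary representation of $\mathcal{O}_q(S_t^2)$ on $\ell^2(\mathbb{N})$ with standard basis $e_0,e_1,\dots$ given by $$\pi_\pm(Z_t)e_p=\pm q^{2p\mp a+1}e_p,\quad \pi_\pm(X_t)e_p=\sqrt{(1-q^{2p})(q^{\mp2a+2p}+1)}\,e_{p-1},\quad \pi_\pm(Y_t)e_p=\sqrt{(1-q^{2p+2})(q^{\mp2a+2p+2}+1)}\,e_{p+1},$$ and, for $|z|=1$, $\chi_z$ is the $*$-character with $\chi_z(Z_t)=0$, $\chi_z(X_t)=z$, $\chi_z(Y_t)=\overline z$. **Theorem.** Let $V$ be an irreducible admissible unitary representation of $U_q(\mathfrak{sl}(2,\mathbb{R})_t)$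 with Hilbert space completion $\mathcal{H}$. The action of $\mathcal{O}_q(S_t^2)$ on $V$ extends to a unitary representation $\pi'$ of $\mathcal{O}_q(S_t^2)$ by bounded operators on $\mathcal{H}$, and up to unitary equivalence: 1. $\pi'\cong\pi_+\oplus\pi_-$ in the cases $\mathcal{L}_\lambda^{+}$ and $\mathcal{L}_\lambda^{-}$; 2. $\pi'\cong\pi_+$ in the cases $\mathcal{D}_n^-$ and $\mathcal{E}_n^+$; 3. $\pi'\cong\pi_-$ in the cases $\mathcal{D}_n^+$ and $\mathcal{E}_n^-$; 4. $\pi'\cong\chi_{-i}$ in the case $\mathcal{T}^+$ and $\pi'\cong\chi_{i}$ in the case $\mathcal{T}^-$. -/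

import Mathlib

open scoped TensorProduct Matrix InnerProductSpace

noncomputable section

namespace QuantumSL2

/-! ### q-numbers -/

/-- The deformation parameter `0 < q < 1`. -/
abbrev Param : Type := Set.Ioo (0 : ℝ) 1

/-- `[x] = (q^x - q^{-x}) / (q - q^{-1})`. -/
def qnum (q : Param) (x : ℝ) : ℝ :=
  ((q : ℝ) ^ x - (q : ℝ) ^ (-x)) / ((q : ℝ) - (q : ℝ)⁻¹)

/-- `q^x - q^{-x}`. -/
def qdiff (q : Param) (x : ℝ) : ℝ := (q : ℝ) ^ x - (q : ℝ) ^ (-x)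

/-- `q^x + q^{-x}`. -/
def qsum (q : Param) (x : ℝ) : ℝ := (q : ℝ) ^ x + (q : ℝ) ^ (-x)

/-- The parameter `q`, as a complex number. -/
def qc (q : Param) : ℂ := ((q : ℝ) : ℂ)

theorem qc_ne_zero (q : Param) : qc q ≠ 0 := by
  have h := q.2.1
  unfold qc
  exact_mod_cast h.ne'

theorem star_qc (q : Param) : (starRingEnd ℂ) (qc q) = qc q := by
  simp [qc]

/-! ### The algebra `O_q(SU(2))` -/

section Adj
variable {T : Type*} [Ring T] [Algebra ℂ T]

/-- For `M = (α β; γ δ)` the matrix `(δ  -q⁻¹β; -qγ  α)`. -/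
def adj (q : Param) (M : Matrix (Fin 2) (Fin 2) T) : Matrix (Fin 2) (Fin 2) T :=
  !![M 1 1, -((qc q)⁻¹ • M 0 1); -(qc q • M 1 0), M 0 0]

theorem adj_map {S : Type*} [Ring S] [Algebra ℂ S] (q : Param) (f : T →ₐ[ℂ] S)
    (M : Matrix (Fin 2) (Fin 2) T) : (adj q M).map f = adj q (M.map f) := by
  ext i j; fin_cases i <;> fin_cases j <;> simp [adj]

end Adj

/-- The 2-by-2 matrix of generators of the free algebra. -/
def freeU : Matrix (Fin 2) (Fin 2) (FreeAlgebra ℂ (Fin 2 × Fin 2)) :=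
  Matrix.of fun i j => FreeAlgebra.ι ℂ (i, j)

/-- The relations `U (δ -q⁻¹β; -qγ α) = 1 = (δ -q⁻¹β; -qγ α) U` for `U = (α β; γ δ)`. -/
inductive SURel (q : Param) :
    FreeAlgebra ℂ (Fin 2 × Fin 2) → FreeAlgebra ℂ (Fin 2 × Fin 2) → Prop
  | left (i j : Fin 2) : SURel q ((freeU * adj q freeU) i j)
      ((1 : Matrix (Fin 2) (Fin 2) (FreeAlgebra ℂ (Fin 2 × Fin 2))) i j)
  | right (i j : Fin 2) : SURel q ((adj q freeU * freeU) i j)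
      ((1 : Matrix (Fin 2) (Fin 2) (FreeAlgebra ℂ (Fin 2 × Fin 2))) i j)

/-- `O_q(SU(2))`: the universal algebra generated by the entries of a 2-by-2 unitary matrix
`U = (α β; γ δ)` with `U* = (δ -q⁻¹β; -qγ α)` (for the star operation defined below). -/
def OqSU2 (q : Param) : Type := RingQuot (SURel q)

instance (q : Param) : Ring (OqSU2 q) := inferInstanceAs (Ring (RingQuot (SURel q)))

instance (q : Param) : Algebra ℂ (OqSU2 q) :=
  inferInstanceAs (Algebra ℂ (RingQuot (SURel q)))

namespace OqSU2

/-- The quotient map from the free algebra. -/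
def mk (q : Param) : FreeAlgebra ℂ (Fin 2 × Fin 2) →ₐ[ℂ] OqSU2 q :=
  RingQuot.mkAlgHom ℂ (SURel q)

/-- The fundamental matrix `U = (α β; γ δ)`. -/
def U (q : Param) : Matrix (Fin 2) (Fin 2) (OqSU2 q) := freeU.map (mk q)

theorem U_mul_adj (q : Param) : U q * adj q (U q) = 1 := by
  have h : (freeU * adj q freeU).map (mk q) =
      (1 : Matrix (Fin 2) (Fin 2) (FreeAlgebra ℂ (Fin 2 × Fin 2))).map (mk q) := by
    ext i j
    exact RingQuot.mkAlgHom_rel ℂ (SURel.left i j)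
  rw [Matrix.map_mul, adj_map, Matrix.map_one _ (map_zero _) (map_one _)] at h
  exact h

theorem adj_mul_U (q : Param) : adj q (U q) * U q = 1 := by
  have h : (adj q freeU * freeU).map (mk q) =
      (1 : Matrix (Fin 2) (Fin 2) (FreeAlgebra ℂ (Fin 2 × Fin 2))).map (mk q) := by
    ext i j
    exact RingQuot.mkAlgHom_rel ℂ (SURel.right i j)
  rw [Matrix.map_mul, adj_map, Matrix.map_one _ (map_zero _) (map_one _)] at h
  exact h

/-- The universal property of `O_q(SU(2))`. -/
def lift (q : Param) {T : Type*} [Ring T] [Algebra ℂ T] (M : Matrix (Fin 2) (Fin 2) T)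
    (h₁ : M * adj q M = 1) (h₂ : adj q M * M = 1) : OqSU2 q →ₐ[ℂ] T :=
  RingQuot.liftAlgHom ℂ ⟨FreeAlgebra.lift ℂ (fun p => M p.1 p.2), by
    have hM : freeU.map (FreeAlgebra.lift ℂ (fun p : Fin 2 × Fin 2 => M p.1 p.2)) = M := by
      ext i j; simp [freeU]
    intro x y hxy
    cases hxy with
    | left i j =>
      have h : (freeU * adj q freeU).map
          (FreeAlgebra.lift ℂ (fun p : Fin 2 × Fin 2 => M p.1 p.2)) =
          (1 : Matrix (Fin 2) (Fin 2) (FreeAlgebra ℂ (Fin 2 × Fin 2))).map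
          (FreeAlgebra.lift ℂ (fun p : Fin 2 × Fin 2 => M p.1 p.2)) := by
        rw [Matrix.map_mul, adj_map, hM, h₁, Matrix.map_one _ (map_zero _) (map_one _)]
      exact congrFun (congrFun h i) j
    | right i j =>
      have h : (adj q freeU * freeU).map
          (FreeAlgebra.lift ℂ (fun p : Fin 2 × Fin 2 => M p.1 p.2)) =
          (1 : Matrix (Fin 2) (Fin 2) (FreeAlgebra ℂ (Fin 2 × Fin 2))).map
          (FreeAlgebra.lift ℂ (fun p : Fin 2 × Fin 2 => M p.1 p.2)) := by
        rw [Matrix.map_mul, adj_map, hM, h₂, Matrix.map_one _ (map_zero _) (map_one _)]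
      exact congrFun (congrFun h i) j⟩

@[simp] theorem lift_U (q : Param) {T : Type*} [Ring T] [Algebra ℂ T]
    (M : Matrix (Fin 2) (Fin 2) T) (h₁ : M * adj q M = 1) (h₂ : adj q M * M = 1)
    (i j : Fin 2) : lift q M h₁ h₂ (U q i j) = M i j := by
  change RingQuot.liftAlgHom ℂ _ (RingQuot.mkAlgHom ℂ (SURel q) (freeU i j)) = M i j
  rw [RingQuot.liftAlgHom_mkAlgHom_apply]
  simp [freeU]

theorem algHom_ext {q : Param} {T : Type*} [Ring T] [Algebra ℂ T] {f g : OqSU2 q →ₐ[ℂ] T}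
    (h : ∀ i j, f (U q i j) = g (U q i j)) : f = g := by
  apply RingQuot.ringQuot_ext'
  apply FreeAlgebra.hom_ext
  funext p
  exact h p.1 p.2

/-! ### The star operation -/

/-- The opposite algebra with complex conjugated scalars: an algebra map into it is a
conjugate-linear anti-multiplicative map. -/
def Tw (q : Param) : Type := (OqSU2 q)ᵐᵒᵖ

instance (q : Param) : Ring (Tw q) := inferInstanceAs (Ring (OqSU2 q)ᵐᵒᵖ)

instance (q : Param) : Algebra ℂ (Tw q) :=
  RingHom.toAlgebra' (S := Tw q)
    (((algebraMap ℂ (OqSU2 q)ᵐᵒᵖ).comp (starRingEnd ℂ) : ℂ →+* (OqSU2 q)ᵐᵒᵖ))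
    (fun c x => Algebra.commutes (R := ℂ) (A := (OqSU2 q)ᵐᵒᵖ) ((starRingEnd ℂ) c) x)

/-- The identity map to the twisted opposite algebra. -/
def toTw {q : Param} (x : OqSU2 q) : Tw q := MulOpposite.op x

/-- The identity map from the twisted opposite algebra. -/
def ofTw {q : Param} (x : Tw q) : OqSU2 q := MulOpposite.unop (α := OqSU2 q) x

theorem toTw_mul {q : Param} (x y : OqSU2 q) : toTw x * toTw y = toTw (y * x) := rfl
theorem toTw_add {q : Param} (x y : OqSU2 q) : toTw x + toTw y = toTw (x + y) := rfl
theorem toTw_neg {q : Param} (x : OqSU2 q) : -toTw x = toTw (-x) := rfl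
theorem toTw_one {q : Param} : toTw (1 : OqSU2 q) = 1 := rfl
theorem toTw_zero {q : Param} : toTw (0 : OqSU2 q) = 0 := rfl
theorem ofTw_toTw {q : Param} (x : OqSU2 q) : ofTw (toTw x) = x := rfl
theorem ofTw_mul {q : Param} (x y : Tw q) : ofTw (x * y) = ofTw y * ofTw x := rfl
theorem ofTw_add {q : Param} (x y : Tw q) : ofTw (x + y) = ofTw x + ofTw y := rfl
theorem ofTw_algebraMap {q : Param} (c : ℂ) :
    ofTw (algebraMap ℂ (Tw q) c) = algebraMap ℂ (OqSU2 q) ((starRingEnd ℂ) c) := rfl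

theorem smul_toTw {q : Param} (c : ℂ) (x : OqSU2 q) :
    c • toTw x = toTw ((starRingEnd ℂ) c • x) := by
  rw [Algebra.smul_def, Algebra.smul_def, Algebra.commutes ((starRingEnd ℂ) c) x]
  rfl

/-- The entries prescribed for `star (U i j) = (adj U) j i`. -/
def starMat (q : Param) : Matrix (Fin 2) (Fin 2) (Tw q) :=
  Matrix.of fun i j => toTw (adj q (U q) j i)

theorem adj_starMat (q : Param) : adj q (starMat q) = Matrix.of fun i j => toTw (U q j i) := by
  have h := qc_ne_zero q
  ext i j
  fin_cases i <;> fin_cases j <;>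
    simp [adj, starMat, smul_toTw, toTw_neg, star_qc, smul_smul, h]

theorem starMat_mul_adj (q : Param) : starMat q * adj q (starMat q) = 1 := by
  rw [adj_starMat]
  ext i j
  have h := congrFun (congrFun (U_mul_adj q) j) i
  rw [Matrix.mul_apply] at h ⊢
  simp only [starMat, Matrix.of_apply, toTw_mul, Fin.sum_univ_two, toTw_add] at h ⊢
  rw [h]
  by_cases hij : i = j
  · subst hij; simp [toTw_one]
  · simp [hij, Ne.symm hij, toTw_zero]

theorem adj_mul_starMat (q : Param) : adj q (starMat q) * starMat q = 1 := by
  rw [adj_starMat]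
  ext i j
  have h := congrFun (congrFun (adj_mul_U q) j) i
  rw [Matrix.mul_apply] at h ⊢
  simp only [starMat, Matrix.of_apply, toTw_mul, Fin.sum_univ_two, toTw_add] at h ⊢
  rw [h]
  by_cases hij : i = j
  · subst hij; simp [toTw_one]
  · simp [hij, Ne.symm hij, toTw_zero]

/-- The star operation, as an algebra map to the twisted opposite algebra. -/
def starHom (q : Param) : OqSU2 q →ₐ[ℂ] Tw q :=
  lift q (starMat q) (starMat_mul_adj q) (adj_mul_starMat q)

/-- The square of the star operation. -/
def starStar (q : Param) : OqSU2 q →ₐ[ℂ] OqSU2 q where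
  toFun x := ofTw (starHom q (ofTw (starHom q x)))
  map_one' := by
    rw [map_one, ← toTw_one, ofTw_toTw, map_one, ← toTw_one, ofTw_toTw]
  map_zero' := by
    rw [map_zero, ← toTw_zero, ofTw_toTw, map_zero, ← toTw_zero, ofTw_toTw]
  map_mul' x y := by rw [map_mul, ofTw_mul, map_mul, ofTw_mul]
  map_add' x y := by rw [map_add, ofTw_add, map_add, ofTw_add]
  commutes' c := by
    rw [AlgHom.commutes, ofTw_algebraMap, AlgHom.commutes, ofTw_algebraMap, Complex.conj_conj]

theorem starHom_smul (q : Param) (c : ℂ) (x : OqSU2 q) :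
    ofTw (starHom q (c • x)) = (starRingEnd ℂ) c • ofTw (starHom q x) := by
  rw [map_smul]
  exact congrArg ofTw (smul_toTw c (ofTw (starHom q x)))

theorem starStar_eq (q : Param) : starStar q = AlgHom.id ℂ (OqSU2 q) := by
  apply algHom_ext
  intro i j
  have h := qc_ne_zero q
  have key : ∀ k l, ofTw (starHom q (U q k l)) = adj q (U q) l k := by
    intro k l
    rw [starHom, lift_U]; rfl
  have hneg : ∀ x, ofTw (starHom q (-x)) = -ofTw (starHom q x) := by
    intro x; rw [map_neg]; rfl
  change ofTw (starHom q (ofTw (starHom q (U q i j)))) = U q i j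
  rw [key]
  fin_cases i <;> fin_cases j <;>
    simp [adj, starHom_smul, hneg, key, star_qc, smul_smul, h, -map_smul, -map_neg]

instance (q : Param) : StarRing (OqSU2 q) where
  star x := ofTw (starHom q x)
  star_involutive x := DFunLike.congr_fun (starStar_eq q) x
  star_mul x y := by
    change ofTw (starHom q (x * y)) = ofTw (starHom q y) * ofTw (starHom q x)
    rw [map_mul, ofTw_mul]
  star_add x y := by
    change ofTw (starHom q (x + y)) = ofTw (starHom q x) + ofTw (starHom q y)
    rw [map_add, ofTw_add]

instance (q : Param) : StarModule ℂ (OqSU2 q) where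
  star_smul c x := starHom_smul q c x

/-- `U* = (δ -q⁻¹β; -qγ α)`. -/
theorem U_conjTranspose (q : Param) : (U q)ᴴ = adj q (U q) := by
  ext i j
  change ofTw (starHom q (U q j i)) = _
  rw [starHom, lift_U]; rfl

/-! ### The coproduct, the counit and the pairing -/

/-- The matrix with entries `∑ k, U i k ⊗ U k j`. -/
def comulMat (q : Param) : Matrix (Fin 2) (Fin 2) (OqSU2 q ⊗[ℂ] OqSU2 q) :=
  Matrix.of fun i j => ∑ k, U q i k ⊗ₜ[ℂ] U q k j

theorem comulMat_eq (q : Param) : comulMat q =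
    (U q).map (Algebra.TensorProduct.includeLeft (R := ℂ) (S := ℂ) (A := OqSU2 q) (B := OqSU2 q)) *
    (U q).map (Algebra.TensorProduct.includeRight (R := ℂ) (A := OqSU2 q) (B := OqSU2 q)) := by
  ext i j
  simp [comulMat, Matrix.mul_apply]

theorem adj_comulMat (q : Param) : adj q (comulMat q) =
    (adj q (U q)).map
      (Algebra.TensorProduct.includeRight (R := ℂ) (A := OqSU2 q) (B := OqSU2 q)) *
    (adj q (U q)).map
      (Algebra.TensorProduct.includeLeft (R := ℂ) (S := ℂ) (A := OqSU2 q) (B := OqSU2 q)) := by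
  have h := qc_ne_zero q
  ext i j
  fin_cases i <;> fin_cases j <;>
    simp [adj, comulMat, Matrix.mul_apply, TensorProduct.tmul_smul, TensorProduct.smul_tmul',
      TensorProduct.tmul_neg, TensorProduct.neg_tmul, smul_smul, h, smul_add, add_comm]

theorem comulMat_mul_adj (q : Param) : comulMat q * adj q (comulMat q) = 1 := by
  rw [adj_comulMat, comulMat_eq, Matrix.mul_assoc, ← Matrix.mul_assoc (Matrix.map _ _) (Matrix.map _ _)
    (Matrix.map _ _), ← Matrix.map_mul, U_mul_adj, Matrix.map_one _ (map_zero _) (map_one _),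
    Matrix.one_mul, ← Matrix.map_mul, U_mul_adj, Matrix.map_one _ (map_zero _) (map_one _)]

theorem adj_mul_comulMat (q : Param) : adj q (comulMat q) * comulMat q = 1 := by
  rw [adj_comulMat, comulMat_eq, Matrix.mul_assoc, ← Matrix.mul_assoc (Matrix.map _ _) (Matrix.map _ _)
    (Matrix.map _ _), ← Matrix.map_mul, adj_mul_U, Matrix.map_one _ (map_zero _) (map_one _),
    Matrix.one_mul, ← Matrix.map_mul, adj_mul_U, Matrix.map_one _ (map_zero _) (map_one _)]

/-- The coproduct `Δ(U i j) = ∑ k, U i k ⊗ U k j`. -/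
def comul (q : Param) : OqSU2 q →ₐ[ℂ] OqSU2 q ⊗[ℂ] OqSU2 q :=
  lift q (comulMat q) (comulMat_mul_adj q) (adj_mul_comulMat q)

/-- The diagonal matrix `τ(U, K) = diag(q, q⁻¹)`. -/
def matK (q : Param) : Matrix (Fin 2) (Fin 2) ℂ := !![qc q, 0; 0, (qc q)⁻¹]

/-- The matrix `τ(U, K⁻¹) = diag(q⁻¹, q)`. -/
def matKinv (q : Param) : Matrix (Fin 2) (Fin 2) ℂ := !![(qc q)⁻¹, 0; 0, qc q]

/-- The matrix `τ(U, E)`. -/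
def matE (q : Param) : Matrix (Fin 2) (Fin 2) ℂ := !![0, (((q : ℝ) ^ (1 / 2 : ℝ) : ℝ) : ℂ); 0, 0]

/-- The matrix `τ(U, F)`. -/
def matF (q : Param) : Matrix (Fin 2) (Fin 2) ℂ :=
  !![0, 0; (((q : ℝ) ^ (-(1 / 2) : ℝ) : ℝ) : ℂ), 0]

/-- The functional `τ(·, K)`: a character, since `K` is grouplike. -/
def pairK (q : Param) : OqSU2 q →ₐ[ℂ] ℂ :=
  lift q (matK q)
    (by have h := qc_ne_zero q; simp [adj, matK, Matrix.one_fin_two, h])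
    (by have h := qc_ne_zero q; simp [adj, matK, Matrix.one_fin_two, h])

/-- The 2-by-2 upper triangular representation `f ↦ (τ(f, K) τ(f, E); 0 ε(f))`; it is
multiplicative because `Δ(E) = E ⊗ 1 + K ⊗ E`. -/
def repE (q : Param) : OqSU2 q →ₐ[ℂ] Matrix (Fin 2) (Fin 2) ℂ :=
  lift q (Matrix.of fun i j => !![matK q i j, matE q i j; 0, (1 : Matrix (Fin 2) (Fin 2) ℂ) i j])
    (by
      have h := qc_ne_zero q
      ext i j k l
      fin_cases i <;> fin_cases j <;> fin_cases k <;> fin_cases l <;>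
        simp [adj, matK, matE, Matrix.mul_apply, h])
    (by
      have h := qc_ne_zero q
      ext i j k l
      fin_cases i <;> fin_cases j <;> fin_cases k <;> fin_cases l <;>
        simp [adj, matK, matE, Matrix.mul_apply, h])

/-- The 2-by-2 upper triangular representation `f ↦ (ε(f) τ(f, F); 0 τ(f, K⁻¹))`; it is
multiplicative because `Δ(F) = F ⊗ K⁻¹ + 1 ⊗ F`. -/
def repF (q : Param) : OqSU2 q →ₐ[ℂ] Matrix (Fin 2) (Fin 2) ℂ :=
  lift q (Matrix.of fun i j => !![(1 : Matrix (Fin 2) (Fin 2) ℂ) i j, matF q i j; 0, matKinv q i j])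
    (by
      have h := qc_ne_zero q
      ext i j k l
      fin_cases i <;> fin_cases j <;> fin_cases k <;> fin_cases l <;>
        simp [adj, matKinv, matF, Matrix.mul_apply, h, mul_comm])
    (by
      have h := qc_ne_zero q
      ext i j k l
      fin_cases i <;> fin_cases j <;> fin_cases k <;> fin_cases l <;>
        simp [adj, matKinv, matF, Matrix.mul_apply, h, mul_comm])

/-- The functional `τ(·, E)`. -/
def pairE (q : Param) : OqSU2 q →ₗ[ℂ] ℂ where
  toFun f := repE q f 0 1
  map_add' x y := by simp
  map_smul' c x := by simp

/-- The functional `τ(·, F)`. -/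
def pairF (q : Param) : OqSU2 q →ₗ[ℂ] ℂ where
  toFun f := repF q f 0 1
  map_add' x y := by simp
  map_smul' c x := by simp

/-- The product of the full dual: `(ω χ)(f) = ω(f₍₁₎) χ(f₍₂₎)`. -/
def conv (q : Param) (ω χ : OqSU2 q →ₗ[ℂ] ℂ) : OqSU2 q →ₗ[ℂ] ℂ :=
  LinearMap.mul' ℂ ℂ ∘ₗ TensorProduct.map ω χ ∘ₗ (comul q).toLinearMap

/-- The functional `τ(·, B_t)` for `B_t = q^{-1/2} (E - F K) - i (q - q⁻¹)⁻¹ t K` and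
`t = q^a - q^{-a}`. -/
def pairB (q : Param) (a : ℝ) : OqSU2 q →ₗ[ℂ] ℂ :=
  (((q : ℝ) ^ (-(1 / 2) : ℝ) : ℝ) : ℂ) • (pairE q - conv q (pairF q) (pairK q).toLinearMap) -
    (Complex.I * (qc q - (qc q)⁻¹)⁻¹ * (qdiff q a : ℂ)) • (pairK q).toLinearMap

/-- The map `f ↦ f₍₁₎ ω(f₍₂₎)`. -/
def slice (q : Param) (ω : OqSU2 q →ₗ[ℂ] ℂ) : OqSU2 q →ₗ[ℂ] OqSU2 q :=
  (TensorProduct.rid ℂ (OqSU2 q)).toLinearMap ∘ₗ LinearMap.lTensor (OqSU2 q) ω ∘ₗ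
    (comul q).toLinearMap

end OqSU2

open OqSU2

/-! ### The Podleś sphere -/

/-- `L_t = (0 i; -i -t)` with `t = q^a - q^{-a}`. -/
def Lmat (q : Param) (a : ℝ) : Matrix (Fin 2) (Fin 2) ℂ :=
  !![0, Complex.I; -Complex.I, -(qdiff q a : ℂ)]

/-- `E_t = U* L_t U`. -/
def Emat (q : Param) (a : ℝ) : Matrix (Fin 2) (Fin 2) (OqSU2 q) :=
  (U q)ᴴ * (Lmat q a).map (algebraMap ℂ (OqSU2 q)) * U q

/-- The Podleś sphere `O_q(S_t²)`: the unital `*`-subalgebra of `O_q(SU(2))` generated by the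
entries of `E_t`. -/
def Podles (q : Param) (a : ℝ) : StarSubalgebra ℂ (OqSU2 q) :=
  StarAlgebra.adjoin ℂ (Set.range fun p : Fin 2 × Fin 2 => Emat q a p.1 p.2)

theorem Emat_mem (q : Param) (a : ℝ) (i j : Fin 2) : Emat q a i j ∈ Podles q a :=
  StarAlgebra.subset_adjoin ℂ _ ⟨(i, j), rfl⟩

/-- The generators: `E_t = (q⁻¹Z_t  Y_t; X_t  -t-qZ_t)`. -/
def podX (q : Param) (a : ℝ) : Podles q a := ⟨Emat q a 1 0, Emat_mem q a 1 0⟩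

/-- See `podX`. -/
def podY (q : Param) (a : ℝ) : Podles q a := ⟨Emat q a 0 1, Emat_mem q a 0 1⟩

/-- See `podX`. -/
def podZ (q : Param) (a : ℝ) : Podles q a := qc q • ⟨Emat q a 0 0, Emat_mem q a 0 0⟩

theorem Emat_conjTranspose (q : Param) (a : ℝ) : (Emat q a)ᴴ = Emat q a := by
  have hL : ((Lmat q a).map (algebraMap ℂ (OqSU2 q)))ᴴ =
      (Lmat q a).map (algebraMap ℂ (OqSU2 q)) := by
    ext i j
    fin_cases i <;> fin_cases j <;> simp [Lmat, ← algebraMap_star_comm]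
  rw [Emat, Matrix.conjTranspose_mul, Matrix.conjTranspose_mul, Matrix.conjTranspose_conjTranspose,
    hL, Matrix.mul_assoc]

theorem comul_Emat (q : Param) (a : ℝ) (i j : Fin 2) :
    comul q (Emat q a i j) =
      ∑ k, ∑ l, Emat q a k l ⊗ₜ[ℂ] ((U q)ᴴ i k * U q l j) := by
  have hU : (U q).map (comul q) = comulMat q := by
    ext k l; simp [comul]
  have h : (Emat q a).map (comul q) =
      (((U q)ᴴ).map (Algebra.TensorProduct.includeRight (R := ℂ) (A := OqSU2 q) (B := OqSU2 q))) *
      ((Emat q a).map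
        (Algebra.TensorProduct.includeLeft (R := ℂ) (S := ℂ) (A := OqSU2 q) (B := OqSU2 q))) *
      ((U q).map
        (Algebra.TensorProduct.includeRight (R := ℂ) (A := OqSU2 q) (B := OqSU2 q))) := by
    have hL : ((Lmat q a).map (algebraMap ℂ (OqSU2 q))).map (comul q) =
        ((Lmat q a).map (algebraMap ℂ (OqSU2 q))).map
        (Algebra.TensorProduct.includeLeft (R := ℂ) (S := ℂ) (A := OqSU2 q) (B := OqSU2 q)) := by
      ext k l
      simp only [Matrix.map_apply, AlgHom.commutes]
    rw [Emat, U_conjTranspose]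
    simp only [Matrix.map_mul]
    rw [hL, adj_map, hU, adj_comulMat, comulMat_eq]
    simp only [Matrix.mul_assoc]
  have h' := congrFun (congrFun h i) j
  rw [Matrix.map_apply] at h'
  rw [h']
  simp only [Matrix.mul_apply, Fin.sum_univ_two, Matrix.map_apply,
    Algebra.TensorProduct.includeLeft_apply, Algebra.TensorProduct.includeRight_apply,
    add_mul, Algebra.TensorProduct.tmul_mul_tmul, one_mul, mul_one]
  abel

/-- The Podleś sphere is a right coideal: `f₍₁₎ ω(f₍₂₎)` stays in it for every functional `ω`. -/
theorem slice_mem (q : Param) (a : ℝ) (ω : OqSU2 q →ₗ[ℂ] ℂ) {f : OqSU2 q} (hf : f ∈ Podles q a) :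
    slice q ω f ∈ Podles q a := by
  set P := (Podles q a).toSubalgebra with hP
  set R : Subalgebra ℂ (OqSU2 q ⊗[ℂ] OqSU2 q) :=
    (Algebra.TensorProduct.map P.val (AlgHom.id ℂ (OqSU2 q))).range with hR
  have hgen : ∀ i j, Emat q a i j ∈ R.comap (comul q) := by
    intro i j
    rw [Subalgebra.mem_comap, comul_Emat]
    refine Subalgebra.sum_mem _ fun k _ => Subalgebra.sum_mem _ fun l _ => ?_
    exact ⟨(⟨Emat q a k l, Emat_mem q a k l⟩ : P) ⊗ₜ[ℂ] ((U q)ᴴ i k * U q l j), by simp⟩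
  have hle : P ≤ R.comap (comul q) := by
    rw [hP, Podles, StarAlgebra.adjoin_toSubalgebra]
    refine Algebra.adjoin_le ?_
    rintro x (⟨p, rfl⟩ | hx)
    · exact hgen p.1 p.2
    · obtain ⟨p, hp⟩ := hx
      have hx' : x = Emat q a p.2 p.1 := by
        have := congrFun (congrFun (Emat_conjTranspose q a) p.2) p.1
        rw [Matrix.conjTranspose_apply] at this
        rw [← this]
        simp only at hp
        rw [hp, star_star]
      rw [hx']
      exact hgen p.2 p.1
  obtain ⟨z, hz⟩ := hle hf
  have hz' : comul q f = Algebra.TensorProduct.map P.val (AlgHom.id ℂ (OqSU2 q)) z := hz.symm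
  change (TensorProduct.rid ℂ (OqSU2 q)) (LinearMap.lTensor (OqSU2 q) ω (comul q f)) ∈ P
  rw [hz']
  clear hz hz'
  induction z with
  | zero => simp
  | tmul x y =>
    simp only [Algebra.TensorProduct.map_tmul, LinearMap.lTensor_tmul, TensorProduct.rid_tmul]
    exact P.smul_mem x.2 _
  | add x y hx hy =>
    simp only [map_add]
    exact P.add_mem hx hy

/-- The map `f ↦ f₍₁₎ ω(f₍₂₎)` on the Podleś sphere. -/
def podSlice (q : Param) (a : ℝ) (ω : OqSU2 q →ₗ[ℂ] ℂ) (f : Podles q a) : Podles q a :=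
  ⟨slice q ω f, slice_mem q a ω f.2⟩

/-! ### Unitary representations of quantum `SL(2, ℝ)` -/

/-- A unitary representation on a pre-Hilbert space `V` of `U_q(sl(2,ℝ)_t)`, the universal unital
`*`-algebra generated by `O_q(S_t²)` and the polynomial `*`-algebra `U_q(so(2)_t) = ℂ[B_t]`, with
`iB_t` self-adjoint, subject to the relations `x f = τ(f₍₂₎, x₍₁₎) f₍₁₎ x₍₂₎`. These need only be
imposed for the generator `x = iB_t`, for which `Δ(iB_t) = iB_t ⊗ 1 + K ⊗ (iB_t - [a])`. -/
structure UnitaryRep (q : Param) (a : ℝ) (V : Type*) [NormedAddCommGroup V]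
    [InnerProductSpace ℂ V] where
  /-- the action of `O_q(S_t²)` -/
  sph : Podles q a →ₐ[ℂ] Module.End ℂ V
  /-- the action of `iB_t` -/
  iB : Module.End ℂ V
  inner_sph : ∀ (f : Podles q a) (v w : V), ⟪v, sph f w⟫_ℂ = ⟪sph (star f) v, w⟫_ℂ
  inner_iB : ∀ v w : V, ⟪v, iB w⟫_ℂ = ⟪iB v, w⟫_ℂ
  iB_mul_sph : ∀ f : Podles q a,
    iB * sph f = sph (podSlice q a (Complex.I • pairB q a) f) +
      sph (podSlice q a (pairK q).toLinearMap f) * (iB - (qnum q a : ℂ) • 1)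

/-- The label of an irreducible admissible unitary representation. -/
inductive IrrepType : Type
  | Lplus (lam : ℝ)
  | Lminus (lam : ℝ)
  | Dplus (n : ℕ)
  | Eplus (n : ℕ)
  | Dminus (n : ℕ)
  | Eminus (n : ℕ)
  | Tplus
  | Tminus

namespace IrrepType

/-- The range of the parameters of each family. -/
def IsValid (q : Param) (a : ℝ) : IrrepType → Prop
  | Lplus lam => -qsum q (1 - 2 * ((⌈a⌉ : ℝ) - a)) < lam ∧ lam < qsum q 1
  | Lminus lam =>
      -qsum q (1 - 2 * ((⌈a - 1 / 2⌉ : ℝ) - (a - 1 / 2))) < lam ∧ lam < qsum q 0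
  | Dplus n => 0 < n
  | Eplus n => 0 < n
  | Dminus n => 0 < n
  | Eminus n => 0 < n
  | Tplus => True
  | Tminus => ∃ m : ℤ, a = m / 2

/-- The value `λ` of the Casimir element. -/
def casimir (q : Param) (a : ℝ) : IrrepType → ℝ
  | Lplus lam => lam
  | Lminus lam => lam
  | Dplus n => qsum q ((n : ℝ) - 1)
  | Eplus n => -qsum q (2 * a + (⌊-2 * a⌋ : ℝ) + n - 1)
  | Dminus n => qsum q ((n : ℝ) - 1)
  | Eminus n => -qsum q (-2 * a + (⌊2 * a⌋ : ℝ) + n - 1)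
  | Tplus => qsum q 1
  | Tminus => -qsum q 1

/-- The set `S` of eigenvalues of `iB_t`. -/
def spec (q : Param) (a : ℝ) : IrrepType → Set ℝ
  | Lplus _ => Set.range fun k : ℤ => qnum q (a + 2 * k)
  | Lminus _ => Set.range fun k : ℤ => qnum q (a + 2 * k + 1)
  | Dplus n => Set.range fun k : ℕ => qnum q (a + n + 2 * k)
  | Eplus n => Set.range fun k : ℕ => qnum q (a + (⌊-2 * a⌋ : ℝ) + n + 2 * k)
  | Dminus n => Set.range fun k : ℕ => qnum q (a - n - 2 * k)
  | Eminus n => Set.range fun k : ℕ => qnum q (a - (⌊2 * a⌋ : ℝ) - n - 2 * k)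
  | Tplus => {qnum q a}
  | Tminus => {qnum q (-a)}

end IrrepType

namespace UnitaryRep
variable {q : Param} {a : ℝ} {V : Type*} [NormedAddCommGroup V] [InnerProductSpace ℂ V]

/-- `iB_t` is diagonalizable with eigenvalues in `{[a + n] | n ∈ ℤ}`. -/
def IsAdmissible (π : UnitaryRep q a V) : Prop :=
  ⨆ n : ℤ, Module.End.eigenspace π.iB (qnum q (a + n) : ℂ) = ⊤

/-- `V ≠ 0` has no proper non-zero closed invariant subspace. -/
def IsIrreducible (π : UnitaryRep q a V) : Prop :=
  Nontrivial V ∧ ∀ W : Submodule ℂ V, IsClosed (W : Set V) →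
    (∀ f, ∀ w ∈ W, π.sph f w ∈ W) → (∀ w ∈ W, π.iB w ∈ W) → W = ⊥ ∨ W = ⊤

/-- The action of the Casimir element `Ω_t = i q⁻¹ X_t + (q - q⁻¹) Z_t (iB_t) - i q Y_t`. -/
def Casimir (π : UnitaryRep q a V) : Module.End ℂ V :=
  (Complex.I * (qc q)⁻¹) • π.sph (podX q a) + (qc q - (qc q)⁻¹) • (π.sph (podZ q a) * π.iB) -
    (Complex.I * qc q) • π.sph (podY q a)

/-- `π` is of the given type: its Casimir value and the set of eigenvalues of `iB_t` are the
prescribed ones. -/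
def IsOfType (π : UnitaryRep q a V) (ℓ : IrrepType) : Prop :=
  ℓ.IsValid q a ∧ π.Casimir = (ℓ.casimir q a : ℂ) • 1 ∧
    {μ : ℂ | π.iB.HasEigenvalue μ} = (fun x : ℝ => (x : ℂ)) '' ℓ.spec q a

end UnitaryRep

/-! ### Representations of the Podleś sphere on Hilbert spaces -/

/-- Unitary representations of `O_q(S_t²)` on a Hilbert space `H`. -/
abbrev PodlesRep (q : Param) (a : ℝ) (H : Type*) [NormedAddCommGroup H] [InnerProductSpace ℂ H]
    [CompleteSpace H] : Type _ :=
  Podles q a →⋆ₐ[ℂ] (H →L[ℂ] H)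

/-- The Hilbert space `ℓ²(ℕ)`. -/
abbrev L2N : Type := lp (fun _ : ℕ => ℂ) 2

/-- The standard basis vector `e_p` of `ℓ²(ℕ)`. -/
def basisVec (p : ℕ) : L2N := lp.single 2 p (1 : ℂ)

/-- `ρ` is the representation `π_+` (for `ε = 1`) or `π_-` (for `ε = -1`) on `ℓ²(ℕ)`. The
coefficient of `e_{p-1}` vanishes for `p = 0`. -/
def IsPi {q : Param} {a : ℝ} (ε : ℤˣ) (ρ : PodlesRep q a L2N) : Prop :=
  ∀ p : ℕ,
    ρ (podZ q a) (basisVec p) =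
      (((ε : ℤ) * (q : ℝ) ^ (2 * p - (ε : ℤ) * a + 1 : ℝ) : ℝ) : ℂ) • basisVec p ∧
    ρ (podX q a) (basisVec p) =
      (√((1 - (q : ℝ) ^ (2 * p : ℝ)) * ((q : ℝ) ^ (-2 * (ε : ℤ) * a + 2 * p : ℝ) + 1)) : ℂ) •
        basisVec (p - 1) ∧
    ρ (podY q a) (basisVec p) =
      (√((1 - (q : ℝ) ^ (2 * p + 2 : ℝ)) *
        ((q : ℝ) ^ (-2 * (ε : ℤ) * a + 2 * p + 2 : ℝ) + 1)) : ℂ) • basisVec (p + 1)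

/-- `ρ` is the character `χ_z`, viewed as a representation on the Hilbert space `ℂ`. -/
def IsChar {q : Param} {a : ℝ} (z : ℂ) (ρ : PodlesRep q a ℂ) : Prop :=
  ρ (podZ q a) = 0 ∧ ρ (podX q a) = z • 1 ∧ ρ (podY q a) = (starRingEnd ℂ) z • 1

section Equivalence
variable {q : Param} {a : ℝ} {H K K' : Type*}
  [NormedAddCommGroup H] [InnerProductSpace ℂ H] [CompleteSpace H]
  [NormedAddCommGroup K] [InnerProductSpace ℂ K] [CompleteSpace K]
  [NormedAddCommGroup K'] [InnerProductSpace ℂ K'] [CompleteSpace K']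

/-- Unitary equivalence `ρ ≅ σ`. -/
def UEquiv (ρ : PodlesRep q a H) (σ : PodlesRep q a K) : Prop :=
  ∃ T : H ≃ₗᵢ[ℂ] K, ∀ f v, T (ρ f v) = σ f (T v)

/-- Unitary equivalence `ρ ≅ σ ⊕ σ'` with the Hilbert space direct sum. -/
def UEquivSum (ρ : PodlesRep q a H) (σ : PodlesRep q a K) (σ' : PodlesRep q a K') : Prop :=
  ∃ T : H ≃ₗᵢ[ℂ] WithLp 2 (K × K'), ∀ f v,
    (T (ρ f v)).fst = σ f (T v).fst ∧ (T (ρ f v)).snd = σ' f (T v).snd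

end Equivalence

end QuantumSL2

end

open QuantumSL2

/-! Write `X`, `Y`, `Z` for the generators and `H` for the completion of `V`. The relations used are
`YX = 1 - tq⁻¹Z - q⁻²Z²`, `XY = 1 - tqZ - q²Z²` and `ZY = q²YZ`, with `X* = Y` and `Z* = Z`.
Positivity of `X*X` bounds `Z`, hence `X` and `Y`, so the sphere acts on `H`; `iB_t` is only used on
`V`.

Suppose `Z` is injective on `H`. On `ker X` it satisfies a quadratic equation whose roots are the `p
= 0` eigenvalues of `π_±(Z)`, so `ker X` is the sum of two vacuum spaces (`exists_vacuum_add`), and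
a unit vacuum vector generates a copy of `π_±` (`exists_isPiIsometry`). Nothing else occurs: on the
complement of an invariant subspace containing `ker X` the operator `Y` has dense range, and then
`ZY = q²YZ` forces `Z = 0` (`orthogonal_eq_bot`).

Irreducibility enters through `eq_bot_of_eigenvector_orthogonal`: a subspace of `H` stable under `X`
and `Z` and orthogonal to one eigenvector of `iB_t` is zero. It rests on the ladder lemma
`UnitaryRep.exists_ladder`: as the Casimir is scalar, `X`, `Y`, `Z` send an eigenvector `u` of
weight `c` to combinations of `u` and the same two vectors of weights `c ± 2`. Consequently each
vacuum space has dimension at most one.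

It remains to decide injectivity of `Z` and which vacua occur. At an extremal weight one ladder
vector vanishes, so `Yξ` is a combination of `ξ` and `Zξ`; pairing with `ξ` kills `ker Z` and one
vacuum (`exists_uequiv_of_extremal`). For a two-sided set of weights, `|λ| < ⟨1⟩` gives injectivity
(`podZ_injective_of_abs_lt`), and a missing vacuum would make `Z` semidefinite, which the diagonal
coefficients along the ladder exclude (`not_semidefinite`). When only one weight occurs, both ladder
vectors vanish and `V` is a line. -/

noncomputable section

namespace QuantumSL2
open OqSU2

/-! ### Quadratic relations for the matrix `E_t` -/

section Algebra
variable (q : Param) (a : ℝ)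

theorem Emat_eq : Emat q a =
    adj q (U q) * (Lmat q a).map (algebraMap ℂ (OqSU2 q)) * U q := by
  rw [Emat, U_conjTranspose]

theorem Lmat_sq : Lmat q a * Lmat q a = 1 - (qdiff q a : ℂ) • Lmat q a := by
  ext i j
  fin_cases i <;> fin_cases j <;> simp [Lmat, Matrix.mul_apply]
  exact mul_comm _ _

/-- Conjugation by the unitary `U` preserves the quadratic equation of `L_t`. Together with
`Emat_one_one` this yields every relation of the sphere used below. -/
theorem Emat_sq : Emat q a * Emat q a = 1 - (qdiff q a : ℂ) • Emat q a := by
  have hL : (Lmat q a).map (algebraMap ℂ (OqSU2 q)) * (Lmat q a).map (algebraMap ℂ (OqSU2 q)) =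
      1 - (qdiff q a : ℂ) • (Lmat q a).map (algebraMap ℂ (OqSU2 q)) := by
    rw [← Matrix.map_mul, Lmat_sq]
    ext i j
    by_cases h : i = j <;> simp [h, Algebra.algebraMap_eq_smul_one, mul_smul, sub_smul,
      -Complex.coe_smul]
  calc Emat q a * Emat q a
      = adj q (U q) * (Lmat q a).map (algebraMap ℂ (OqSU2 q)) * (U q * adj q (U q)) *
        (Lmat q a).map (algebraMap ℂ (OqSU2 q)) * U q := by
        rw [Emat_eq]; simp only [Matrix.mul_assoc]
    _ = adj q (U q) * ((Lmat q a).map (algebraMap ℂ (OqSU2 q)) *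
        (Lmat q a).map (algebraMap ℂ (OqSU2 q))) * U q := by
        rw [U_mul_adj]; simp only [Matrix.mul_assoc, Matrix.mul_one]
    _ = _ := by
        rw [hL, Emat_eq, Matrix.mul_sub, Matrix.sub_mul, Matrix.mul_one, adj_mul_U,
          Matrix.mul_smul, Matrix.smul_mul]

/-- The quantum trace `q²E₀₀ + E₁₁` is the scalar `-t`, by the relations `αβ = qβα`, `γδ = qδγ` and
`αδ = 1 + qβγ`. Hence three generators suffice. -/
theorem Emat_one_one :
    Emat q a 1 1 = -(algebraMap ℂ (OqSU2 q) (qdiff q a)) - (qc q) ^ 2 • Emat q a 0 0 := by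
  have hq := qc_ne_zero q
  have h1 := congrFun (congrFun (U_mul_adj q) 0) 0
  have h2 := congrFun (congrFun (U_mul_adj q) 0) 1
  have h3 := congrFun (congrFun (U_mul_adj q) 1) 0
  simp only [adj, Matrix.mul_apply, Fin.sum_univ_two, Matrix.of_apply, Matrix.cons_val',
    Matrix.cons_val_zero, Matrix.cons_val_one, Matrix.one_apply, mul_neg, mul_smul_comm,
    Matrix.empty_val', Matrix.cons_val_fin_one] at h1 h2 h3
  simp at h1 h2 h3
  rw [Emat_eq]
  simp only [adj, Lmat, Matrix.mul_apply, Fin.sum_univ_two, Matrix.map_apply, Matrix.of_apply,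
    Matrix.cons_val', Matrix.cons_val_zero, Matrix.cons_val_one, mul_neg, neg_mul, smul_mul_assoc,
    Matrix.empty_val', Matrix.cons_val_fin_one, map_zero, map_neg, mul_zero]
  simp only [← Algebra.commutes]
  simp only [← Algebra.smul_def]
  generalize U q 0 0 = α at *
  generalize U q 0 1 = β at *
  generalize U q 1 0 = γ at *
  generalize U q 1 1 = δ at *
  have e3 : γ * δ = qc q • (δ * γ) := by rw [← sub_eq_zero, ← h3]; abel
  have e2 : α * β = qc q • (β * α) := by
    have : qc q • (β * α - (qc q)⁻¹ • (α * β)) = 0 := by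
      rw [← smul_zero (qc q), ← h2]
      congr 1
      abel
    rw [smul_sub, smul_smul, mul_inv_cancel₀ hq, one_smul, sub_eq_zero] at this
    exact this.symm
  have e1 : α * δ = 1 + qc q • (β * γ) := by rw [← h1]; abel
  simp only [e1, e2, e3, smul_add, smul_neg, smul_smul, Algebra.algebraMap_eq_smul_one, zero_mul,
    smul_zero, add_mul, neg_mul, smul_mul_assoc]
  match_scalars <;> field_simp

end Algebra

/-! ### The pairing on products of two generators -/

section Products
variable (q : Param)

theorem pairK_U (i j : Fin 2) : pairK q (U q i j) = matK q i j := by simp [pairK]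

theorem pairE_U_mul_U (i j k l : Fin 2) :
    pairE q (U q i j * U q k l) = matK q i j * matE q k l +
      matE q i j * (1 : Matrix (Fin 2) (Fin 2) ℂ) k l := by
  simp [pairE, repE, Matrix.mul_apply]

theorem pairF_U_mul_U (i j k l : Fin 2) :
    pairF q (U q i j * U q k l) = (1 : Matrix (Fin 2) (Fin 2) ℂ) i j * matF q k l +
      matF q i j * matKinv q k l := by
  simp [pairF, repF, Matrix.mul_apply]

/-- `FK` has the same kind of coproduct as `E`, namely `FK ⊗ 1 + K ⊗ FK`; this is why the
combination `E - FK` appears in `B_t`. -/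
theorem conv_pairF_pairK_U_mul_U (i j k l : Fin 2) :
    conv q (pairF q) (pairK q).toLinearMap (U q i j * U q k l) =
      matK q i j * (matF q * matK q) k l +
      (matF q * matK q) i j * (1 : Matrix (Fin 2) (Fin 2) ℂ) k l := by
  have hq := qc_ne_zero q
  simp only [conv, LinearMap.comp_apply, AlgHom.toLinearMap_apply, map_mul, comul, lift_U, comulMat,
    Matrix.of_apply, Fin.sum_univ_two, add_mul, mul_add, Algebra.TensorProduct.tmul_mul_tmul,
    map_add, TensorProduct.map_tmul, LinearMap.mul'_apply, pairF_U_mul_U, pairK_U]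
  fin_cases i <;> fin_cases j <;> fin_cases k <;> fin_cases l <;>
    simp [matK, matF, matKinv, Matrix.mul_apply, Matrix.one_apply, hq] <;> field_simp

/-- `Δ` conjugates `E_t` by a second copy of `U`, so a functional enters only through its values on
products of two matrix entries. -/
theorem slice_Emat (a : ℝ) (ω : OqSU2 q →ₗ[ℂ] ℂ) (i j : Fin 2) :
    slice q ω (Emat q a i j) =
      ∑ k, ∑ l, ω (adj q (U q) i k * U q l j) • Emat q a k l := by
  simp only [slice, LinearMap.comp_apply, AlgHom.toLinearMap_apply, comul_Emat, map_sum,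
    LinearMap.lTensor_tmul, LinearEquiv.coe_coe, TensorProduct.rid_tmul, U_conjTranspose]

/-- The entries of `E_t`, as elements of the Podleś sphere. -/
def podE (a : ℝ) (i j : Fin 2) : Podles q a := ⟨Emat q a i j, Emat_mem q a i j⟩

theorem podSlice_podE (a : ℝ) (ω : OqSU2 q →ₗ[ℂ] ℂ) (i j : Fin 2) :
    podSlice q a ω (podE q a i j) =
      ∑ k, ∑ l, ω (adj q (U q) i k * U q l j) • podE q a k l := by
  apply Subtype.ext
  simp [podSlice, podE, slice_Emat]

theorem pairK_adj_mul (i j k l : Fin 2) :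
    pairK q (adj q (U q) i j * U q k l) = matKinv q i j * matK q k l := by
  fin_cases i <;> fin_cases j <;> simp [adj, pairK_U, matK, matKinv]

theorem rpow_half_mul : (((q : ℝ) ^ (-(1 / 2) : ℝ) : ℝ) : ℂ) * (((q : ℝ) ^ (1 / 2 : ℝ) : ℝ) : ℂ) = 1 := by
  rw [← Complex.ofReal_mul, ← Real.rpow_add q.2.1]; norm_num

theorem rpow_half_sq :
    (((q : ℝ) ^ (-(1 / 2) : ℝ) : ℝ) : ℂ) * (((q : ℝ) ^ (-(1 / 2) : ℝ) : ℝ) : ℂ) = (qc q)⁻¹ := by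
  rw [← Complex.ofReal_mul, ← Real.rpow_add q.2.1, qc, ← Complex.ofReal_inv]
  norm_num [Real.rpow_neg_one]

/-- The matrix `τ(U, iB_t)`. -/
def matB (a : ℝ) : Matrix (Fin 2) (Fin 2) ℂ :=
  !![qc q * (qnum q a : ℂ), Complex.I; -Complex.I, (qc q)⁻¹ * (qnum q a : ℂ)]

theorem qc_sub_inv_ne_zero : qc q - (qc q)⁻¹ ≠ 0 := by
  have h0 := q.2.1
  have h1 := q.2.2
  have : (1 : ℝ) < (q : ℝ)⁻¹ := (one_lt_inv₀ h0).2 h1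
  have h : (q : ℝ) - (q : ℝ)⁻¹ ≠ 0 := by linarith
  rw [qc]
  exact_mod_cast h

theorem qnum_eq (a : ℝ) : (qnum q a : ℂ) = (qc q - (qc q)⁻¹)⁻¹ * (qdiff q a : ℂ) := by
  simp [qnum, qdiff, qc, div_eq_inv_mul]

theorem matB_apply (a : ℝ) (i j : Fin 2) :
    matB q a i j = Complex.I * ((((q : ℝ) ^ (-(1 / 2) : ℝ) : ℝ) : ℂ) *
      (matE q i j - (matF q * matK q) i j)) +
      (qc q - (qc q)⁻¹)⁻¹ * (qdiff q a : ℂ) * matK q i j := by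
  have hq := qc_ne_zero q
  have h1 := rpow_half_mul q
  have h2 := rpow_half_sq q
  rw [matB, qnum_eq, matE, matF]
  generalize (((q : ℝ) ^ (-(1 / 2) : ℝ) : ℝ) : ℂ) = r at *
  generalize (((q : ℝ) ^ (1 / 2 : ℝ) : ℝ) : ℂ) = s at *
  fin_cases i <;> fin_cases j <;> simp [matK, Matrix.mul_apply]
  · ring
  · rw [h1]
  · rw [← mul_assoc r, h2, inv_mul_cancel₀ hq]
  · ring

theorem pairB_U_mul_U (a : ℝ) (i j k l : Fin 2) :
    (Complex.I • pairB q a) (U q i j * U q k l) =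
      matB q a i j * (1 : Matrix (Fin 2) (Fin 2) ℂ) k l +
      matK q i j * (matB q a k l - (qnum q a : ℂ) * (1 : Matrix (Fin 2) (Fin 2) ℂ) k l) := by
  simp only [LinearMap.smul_apply, pairB, LinearMap.sub_apply, pairE_U_mul_U,
    conv_pairF_pairK_U_mul_U, AlgHom.toLinearMap_apply, map_mul, pairK_U, smul_eq_mul,
    matB_apply, qnum_eq]
  linear_combination (-(qc q - (qc q)⁻¹)⁻¹ * (qdiff q a : ℂ) * matK q i j * matK q k l) * Complex.I_mul_I

/-- In the fundamental representation `iB_t` is `L_t + q[a]`, which is why the matrix defining the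
sphere reappears in the pairing. -/
theorem pairB_adj_mul (a : ℝ) (i j k l : Fin 2) :
    (Complex.I • pairB q a) (adj q (U q) i j * U q k l) =
      (qnum q a : ℂ) * (1 : Matrix (Fin 2) (Fin 2) ℂ) i j * (1 : Matrix (Fin 2) (Fin 2) ℂ) k l -
      (matKinv q * Lmat q a) i j * (1 : Matrix (Fin 2) (Fin 2) ℂ) k l +
      matKinv q i j * Lmat q a k l := by
  have hq := qc_ne_zero q
  have ht : (qdiff q a : ℂ) = (qnum q a : ℂ) * (qc q - (qc q)⁻¹) := by
    rw [qnum_eq, mul_comm, ← mul_assoc, mul_inv_cancel₀ (qc_sub_inv_ne_zero q), one_mul]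
  fin_cases i <;> fin_cases j <;>
    simp only [adj, Fin.zero_eta, Fin.mk_one, Fin.isValue, Matrix.of_apply, Matrix.cons_val',
      Matrix.cons_val_zero, Matrix.cons_val_one, Matrix.cons_val_fin_one, neg_mul, smul_mul_assoc,
      map_neg, map_smul, pairB_U_mul_U] <;>
    fin_cases k <;> fin_cases l <;> simp [matB, matK, matKinv, Lmat, Matrix.mul_apply,
      ht] <;> field_simp <;> try ring

end Products

/-! ### Relations between `X_t`, `Y_t`, `Z_t` -/

section Relations
variable {q : Param} {a : ℝ}

theorem podX_eq : podX q a = podE q a 1 0 := rfl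
theorem podY_eq : podY q a = podE q a 0 1 := rfl
theorem podZ_eq : podZ q a = qc q • podE q a 0 0 := rfl

theorem podE_zero_zero : podE q a 0 0 = (qc q)⁻¹ • podZ q a := by
  rw [podZ_eq, smul_smul, inv_mul_cancel₀ (qc_ne_zero q), one_smul]

theorem podE_one_one : podE q a 1 1 = -(qdiff q a : ℂ) • 1 - qc q • podZ q a := by
  rw [podZ_eq, smul_smul, ← sq]
  apply Subtype.ext
  simp [podE, Emat_one_one, Algebra.algebraMap_eq_smul_one]

theorem podE_mul_podE (i j : Fin 2) :
    podE q a i 0 * podE q a 0 j + podE q a i 1 * podE q a 1 j =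
      (if i = j then 1 else 0) - (qdiff q a : ℂ) • podE q a i j := by
  have h := congrFun (congrFun (Emat_sq q a) i) j
  rw [Matrix.mul_apply, Fin.sum_univ_two, Matrix.sub_apply, Matrix.one_apply,
    Matrix.smul_apply] at h
  apply Subtype.ext
  split_ifs at h ⊢ <;> simpa [podE] using h

theorem star_podE (i j : Fin 2) : star (podE q a i j) = podE q a j i := by
  apply Subtype.ext
  exact congrFun (congrFun (Emat_conjTranspose q a) j) i

theorem star_podX : star (podX q a) = podY q a := star_podE 1 0
theorem star_podY : star (podY q a) = podX q a := star_podE 0 1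
theorem star_podZ : star (podZ q a) = podZ q a := by
  rw [podZ_eq, star_smul, star_podE, ← starRingEnd_apply, star_qc]

theorem podY_mul_podX : podY q a * podX q a =
    1 - ((qdiff q a : ℂ) * (qc q)⁻¹) • podZ q a - ((qc q)⁻¹ ^ 2) • (podZ q a * podZ q a) := by
  have h := podE_mul_podE (q := q) (a := a) 0 0
  rw [podX_eq, podY_eq, eq_sub_of_add_eq' h, podE_zero_zero]
  simp only [mul_smul_comm, smul_mul_assoc, if_true, smul_smul, sq]

theorem podX_mul_podY : podX q a * podY q a =
    1 - ((qdiff q a : ℂ) * qc q) • podZ q a - (qc q ^ 2) • (podZ q a * podZ q a) := by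
  have h := podE_mul_podE (q := q) (a := a) 1 1
  rw [podX_eq, podY_eq, eq_sub_of_add_eq h, podE_one_one]
  simp only [mul_sub, sub_mul, smul_mul_assoc, mul_smul_comm, one_mul, mul_one, if_true, smul_sub,
    smul_smul]
  module

theorem podZ_mul_podY : podZ q a * podY q a = (qc q ^ 2) • (podY q a * podZ q a) := by
  have hq := qc_ne_zero q
  have h := podE_mul_podE (q := q) (a := a) 0 1
  rw [← podY_eq, podE_zero_zero, podE_one_one] at h
  simp only [mul_sub, smul_mul_assoc, mul_smul_comm, mul_one] at h
  have h2 : (qc q)⁻¹ • (podZ q a * podY q a) = qc q • (podY q a * podZ q a) := by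
    rw [eq_sub_of_add_eq h]
    simp only [zero_ne_one, if_false]
    module
  rw [sq, mul_smul, ← h2, smul_smul, mul_inv_cancel₀ hq, one_smul]

theorem podX_mul_podZ : podX q a * podZ q a = (qc q ^ 2) • (podZ q a * podX q a) := by
  have h := congrArg star (podZ_mul_podY (q := q) (a := a))
  rw [star_smul, star_mul, star_mul, star_podZ, star_podY, ← starRingEnd_apply, map_pow,
    star_qc] at h
  exact h

/-- The Podleś sphere is generated by `X_t`, `Y_t`, `Z_t`. -/
theorem podles_induction (S : Subalgebra ℂ (Podles q a)) (hX : podX q a ∈ S) (hY : podY q a ∈ S)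
    (hZ : podZ q a ∈ S) (f : Podles q a) : f ∈ S := by
  have hE : ∀ i j, podE q a i j ∈ S := by
    intro i j
    fin_cases i <;> fin_cases j
    · exact podE_zero_zero (q := q) (a := a) ▸ S.smul_mem hZ _
    · exact hY
    · exact hX
    · exact podE_one_one (q := q) (a := a) ▸ S.sub_mem (S.smul_mem S.one_mem _) (S.smul_mem hZ _)
  obtain ⟨f, hf⟩ := f
  have hf' := hf
  rw [Podles, ← StarSubalgebra.mem_toSubalgebra, StarAlgebra.adjoin_toSubalgebra] at hf'
  suffices h : f ∈ S.map (Podles q a).toSubalgebra.val by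
    obtain ⟨g, hg, rfl⟩ := h
    exact hg
  refine Algebra.adjoin_le ?_ hf'
  -- A star subalgebra is also generated by the adjoints of its generators; these are again entries
  -- of `E_t`, which is self-adjoint.
  rintro x (⟨p, rfl⟩ | hx)
  · exact ⟨podE q a p.1 p.2, hE _ _, rfl⟩
  · obtain ⟨p, hp⟩ := hx
    refine ⟨podE q a p.2 p.1, hE _ _, ?_⟩
    rw [← star_podE]
    change star (Emat q a p.1 p.2) = x
    exact star_eq_iff_star_eq.mpr hp.symm

end Relations

/-! ### Commutation of `iB_t` with the sphere -/

namespace UnitaryRep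
variable {q : Param} {a : ℝ} {V : Type*} [NormedAddCommGroup V] [InnerProductSpace ℂ V]
  (π : UnitaryRep q a V)

theorem iB_mul_podE (i j : Fin 2) :
    π.iB * π.sph (podE q a i j) =
      (∑ k, ∑ l, ((Complex.I • pairB q a) (adj q (U q) i k * U q l j)) • π.sph (podE q a k l)) +
      (∑ k, ∑ l, (pairK q (adj q (U q) i k * U q l j)) • π.sph (podE q a k l)) *
        (π.iB - (qnum q a : ℂ) • 1) := by
  rw [π.iB_mul_sph, podSlice_podE, podSlice_podE]
  simp only [map_sum, map_smul, AlgHom.toLinearMap_apply]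

theorem iB_mul_podZ :
    π.iB * π.sph (podZ q a) = π.sph (podZ q a) * π.iB -
      Complex.I • (π.sph (podX q a) + π.sph (podY q a)) := by
  have hq := qc_ne_zero q
  have h := π.iB_mul_podE 0 0
  simp only [pairB_adj_mul, pairK_adj_mul, Fin.sum_univ_two, ← podX_eq, ← podY_eq, podE_zero_zero,
    podE_one_one] at h
  simp [matK, matKinv, Lmat, Matrix.mul_apply, hq, mul_sub, -Complex.coe_smul] at h
  have h2 := congrArg (qc q • ·) h
  simp only [smul_smul, mul_inv_cancel₀ hq, one_smul] at h2
  rw [h2]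
  match_scalars <;> field_simp <;> ring

theorem iB_mul_podX :
    π.iB * π.sph (podX q a) = qc q ^ 2 • (π.sph (podX q a) * π.iB) +
      (Complex.I * (1 + qc q ^ 2)) • π.sph (podZ q a) +
      (Complex.I * qc q * (qdiff q a : ℂ)) • 1 := by
  have hq := qc_ne_zero q
  have h := π.iB_mul_podE 1 0
  simp only [pairB_adj_mul, pairK_adj_mul, Fin.sum_univ_two, ← podX_eq, ← podY_eq, podE_zero_zero,
    podE_one_one] at h
  simp [matK, matKinv, Lmat, Matrix.mul_apply, mul_sub, -Complex.coe_smul] at h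
  rw [h]
  have ht : (qdiff q a : ℂ) = (qnum q a : ℂ) * (qc q - (qc q)⁻¹) := by
    rw [qnum_eq, mul_comm, ← mul_assoc, mul_inv_cancel₀ (qc_sub_inv_ne_zero q), one_mul]
  rw [ht]
  match_scalars <;> field_simp <;> ring

end UnitaryRep

/-! ### Boundedness and extension to the completion -/

namespace UnitaryRep
variable {q : Param} {a : ℝ} {V : Type*} [NormedAddCommGroup V] [InnerProductSpace ℂ V]
  (π : UnitaryRep q a V)

theorem inner_podX (v w : V) : ⟪v, π.sph (podX q a) w⟫_ℂ = ⟪π.sph (podY q a) v, w⟫_ℂ := by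
  rw [π.inner_sph, star_podX]

theorem inner_podY (v w : V) : ⟪v, π.sph (podY q a) w⟫_ℂ = ⟪π.sph (podX q a) v, w⟫_ℂ := by
  rw [π.inner_sph, star_podY]

theorem inner_podZ (v w : V) : ⟪v, π.sph (podZ q a) w⟫_ℂ = ⟪π.sph (podZ q a) v, w⟫_ℂ := by
  rw [π.inner_sph, star_podZ]

/-- This is the relation for `YX = X*X`, paired with `v`. -/
theorem norm_podX_sq (v : V) : ‖π.sph (podX q a) v‖ ^ 2 =
    ‖v‖ ^ 2 - qdiff q a * (q : ℝ)⁻¹ * (⟪v, π.sph (podZ q a) v⟫_ℂ).re -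
      (q : ℝ)⁻¹ ^ 2 * ‖π.sph (podZ q a) v‖ ^ 2 := by
  have h := congrArg (fun f => (⟪v, π.sph f v⟫_ℂ).re) (podY_mul_podX (q := q) (a := a))
  simp only [map_mul, map_sub, map_smul, Module.End.mul_apply, LinearMap.sub_apply, map_one,
    Module.End.one_apply, LinearMap.smul_apply, inner_sub_right, inner_smul_right, π.inner_podY,
    π.inner_podZ v (π.sph (podZ q a) v), inner_self_eq_norm_sq_to_K] at h
  have e : (qdiff q a : ℂ) * (qc q)⁻¹ = ((qdiff q a * (q : ℝ)⁻¹ : ℝ) : ℂ) := by simp [qc]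
  have e' : (qc q)⁻¹ ^ 2 = (((q : ℝ)⁻¹ ^ 2 : ℝ) : ℂ) := by simp [qc]
  rw [e, e'] at h
  simpa [← Complex.ofReal_pow, -Complex.ofReal_mul] using h

theorem norm_podY_sq (v : V) : ‖π.sph (podY q a) v‖ ^ 2 =
    ‖v‖ ^ 2 - qdiff q a * (q : ℝ) * (⟪v, π.sph (podZ q a) v⟫_ℂ).re -
      (q : ℝ) ^ 2 * ‖π.sph (podZ q a) v‖ ^ 2 := by
  have h := congrArg (fun f => (⟪v, π.sph f v⟫_ℂ).re) (podX_mul_podY (q := q) (a := a))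
  simp only [map_mul, map_sub, map_smul, Module.End.mul_apply, LinearMap.sub_apply, map_one,
    Module.End.one_apply, LinearMap.smul_apply, inner_sub_right, inner_smul_right, π.inner_podX,
    π.inner_podZ v (π.sph (podZ q a) v), inner_self_eq_norm_sq_to_K] at h
  have e : (qdiff q a : ℂ) * (qc q) = ((qdiff q a * (q : ℝ) : ℝ) : ℂ) := by simp [qc]
  have e' : (qc q) ^ 2 = (((q : ℝ) ^ 2 : ℝ) : ℂ) := by simp [qc]
  rw [e, e'] at h
  simpa [← Complex.ofReal_pow, -Complex.ofReal_mul] using h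

theorem abs_re_inner_podZ_le (v : V) :
    |(⟪v, π.sph (podZ q a) v⟫_ℂ).re| ≤ ‖v‖ * ‖π.sph (podZ q a) v‖ :=
  (Complex.abs_re_le_norm _).trans (norm_inner_le_norm _ _)

/-- Since `‖Xv‖² ≥ 0`, the number `b = q⁻¹‖Zv‖` satisfies `b² ≤ ‖v‖² + |t|‖v‖b`, which forces `b ≤
(1 + |t|)‖v‖`. -/
theorem exists_bound_podZ : ∃ C, 0 ≤ C ∧ ∀ v, ‖π.sph (podZ q a) v‖ ≤ C * ‖v‖ := by
  have h0 := q.2.1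
  refine ⟨q * (1 + |qdiff q a|), by positivity, fun v => ?_⟩
  have h1 := π.norm_podX_sq v
  have h2 := π.abs_re_inner_podZ_le v
  have h3 := sq_nonneg ‖π.sph (podX q a) v‖
  set b := (q : ℝ)⁻¹ * ‖π.sph (podZ q a) v‖ with hb
  have hZ : ‖π.sph (podZ q a) v‖ = q * b := by rw [hb]; field_simp
  have h4 : |qdiff q a * (q : ℝ)⁻¹ * (⟪v, π.sph (podZ q a) v⟫_ℂ).re| ≤
      |qdiff q a| * (‖v‖ * b) := by
    rw [abs_mul, abs_mul, abs_of_pos (inv_pos.2 h0), hb, mul_assoc]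
    refine mul_le_mul_of_nonneg_left ?_ (abs_nonneg _)
    calc _ ≤ (q : ℝ)⁻¹ * (‖v‖ * ‖π.sph (podZ q a) v‖) := by gcongr
      _ = _ := by ring
  have h5 : b ^ 2 ≤ ‖v‖ ^ 2 + |qdiff q a| * (‖v‖ * b) := by
    have : (q : ℝ)⁻¹ ^ 2 * ‖π.sph (podZ q a) v‖ ^ 2 = b ^ 2 := by rw [hb]; ring
    rw [this] at h1
    linarith [neg_abs_le (qdiff q a * (q : ℝ)⁻¹ * (⟪v, π.sph (podZ q a) v⟫_ℂ).re)]
  rw [hZ, mul_assoc]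
  refine mul_le_mul_of_nonneg_left ?_ h0.le
  have hbn : 0 ≤ b := by positivity
  have ht := abs_nonneg (qdiff q a)
  have hv := norm_nonneg v
  by_contra! hlt
  have h6 : ‖v‖ ≤ b := by nlinarith
  have h7 : 0 < b := lt_of_le_of_lt (by positivity) hlt
  nlinarith

theorem exists_bound_of_norm_sq_eq {T Z : V → V} {r s C : ℝ} (hC : 0 ≤ C)
    (hZ : ∀ v, ‖Z v‖ ≤ C * ‖v‖) (hs : 0 ≤ s)
    (h : ∀ v, ‖T v‖ ^ 2 = ‖v‖ ^ 2 - r * (⟪v, Z v⟫_ℂ).re - s * ‖Z v‖ ^ 2) :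
    ∃ C', ∀ v, ‖T v‖ ≤ C' * ‖v‖ := by
  -- Dropping the `s` term leaves `‖Tv‖² ≤ (1 + |r|C)‖v‖²`, and `1 + |r|C` is at most its own
  -- square.
  refine ⟨1 + |r| * C, fun v => ?_⟩
  refine abs_le_of_sq_le_sq' ?_ (by positivity) |>.2
  have h2 : |r * (⟪v, Z v⟫_ℂ).re| ≤ |r| * (‖v‖ * (C * ‖v‖)) := by
    rw [abs_mul]
    refine mul_le_mul_of_nonneg_left ?_ (abs_nonneg _)
    exact ((Complex.abs_re_le_norm _).trans (norm_inner_le_norm _ _)).trans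
      (mul_le_mul_of_nonneg_left (hZ v) (norm_nonneg _))
  have h3 := neg_abs_le (r * (⟪v, Z v⟫_ℂ).re)
  have h4 : 0 ≤ s * ‖Z v‖ ^ 2 := by positivity
  have h5 : 0 ≤ |r| * C := by positivity
  rw [h v]
  nlinarith [sq_nonneg ‖v‖, mul_nonneg h5 (sq_nonneg ‖v‖),
    mul_nonneg (mul_nonneg h5 h5) (sq_nonneg ‖v‖)]

theorem exists_bound (f : Podles q a) : ∃ C, ∀ v, ‖π.sph f v‖ ≤ C * ‖v‖ := by
  let S : Subalgebra ℂ (Podles q a) :=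
    { carrier := {f | ∃ C, 0 ≤ C ∧ ∀ v, ‖π.sph f v‖ ≤ C * ‖v‖}
      mul_mem' := by
        rintro f g ⟨C, hC, hf⟩ ⟨D, hD, hg⟩
        refine ⟨C * D, by positivity, fun v => ?_⟩
        rw [map_mul, Module.End.mul_apply, mul_assoc]
        exact (hf _).trans (mul_le_mul_of_nonneg_left (hg v) hC)
      add_mem' := by
        rintro f g ⟨C, hC, hf⟩ ⟨D, hD, hg⟩
        refine ⟨C + D, by positivity, fun v => ?_⟩
        rw [map_add, LinearMap.add_apply, add_mul]
        exact (norm_add_le _ _).trans (add_le_add (hf v) (hg v))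
      algebraMap_mem' := by
        intro c
        refine ⟨‖c‖, norm_nonneg _, fun v => ?_⟩
        rw [AlgHom.commutes, Module.algebraMap_end_apply, norm_smul] }
  have key : ∀ f : Podles q a, (∃ C, ∀ v, ‖π.sph f v‖ ≤ C * ‖v‖) → f ∈ S := by
    rintro f ⟨C, hC⟩
    exact ⟨|C|, abs_nonneg _, fun v => (hC v).trans
      (mul_le_mul_of_nonneg_right (le_abs_self C) (norm_nonneg v))⟩
  obtain ⟨C, hC, hZ⟩ := π.exists_bound_podZ
  obtain ⟨C, -, h⟩ := podles_induction S
    (key _ (exists_bound_of_norm_sq_eq hC hZ (by positivity) π.norm_podX_sq))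
    (key _ (exists_bound_of_norm_sq_eq hC hZ (by positivity) π.norm_podY_sq))
    (key _ ⟨C, hZ⟩) f
  exact ⟨C, h⟩

open UniformSpace (Completion)

/-- The bounded extension of the action of an element of the Podleś sphere. -/
def complFun (f : Podles q a) : Completion V →L[ℂ] Completion V :=
  (Completion.toComplL.comp
    ((π.sph f).mkContinuous (π.exists_bound f).choose (π.exists_bound f).choose_spec)).extend
    Completion.toComplL

theorem complFun_coe (f : Podles q a) (v : V) :
    π.complFun f (v : Completion V) = (π.sph f v : Completion V) :=
  ContinuousLinearMap.extend_eq _ (e := Completion.toComplL (𝕜 := ℂ))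
    Completion.denseRange_coe (Completion.isUniformInducing_coe V) v

theorem clm_ext_coe {K : Type*} [NormedAddCommGroup K] [NormedSpace ℂ K]
    {S T : Completion V →L[ℂ] K} (h : ∀ v : V, S v = T v) : S = T := by
  ext x
  induction x using Completion.induction_on with
  | hp => exact isClosed_eq S.continuous T.continuous
  | ih v => exact h v

/-- The extension of the action of the Podleś sphere to the completion. -/
def compl : PodlesRep q a (Completion V) where
  toFun := π.complFun
  map_one' := clm_ext_coe fun v => by simp [complFun_coe]
  map_zero' := clm_ext_coe fun v => by simp [complFun_coe]
  map_mul' f g := clm_ext_coe fun v => by simp [complFun_coe]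
  map_add' f g := clm_ext_coe fun v => by simp [complFun_coe, Completion.coe_add]
  commutes' c := clm_ext_coe fun v => by
    rw [complFun_coe, AlgHom.commutes, Module.algebraMap_end_apply, Completion.coe_smul]
    rfl
  map_star' f := by
    rw [ContinuousLinearMap.star_eq_adjoint, ContinuousLinearMap.eq_adjoint_iff]
    intro x y
    induction x, y using Completion.induction_on₂ with
    | hp => exact isClosed_eq (by fun_prop) (by fun_prop)
    | ih v w => rw [complFun_coe, complFun_coe, Completion.inner_coe, Completion.inner_coe,
      π.inner_sph]

theorem compl_coe (f : Podles q a) (v : V) :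
    π.compl f (v : Completion V) = (π.sph f v : Completion V) := π.complFun_coe f v

end UnitaryRep

/-! ### Self-adjoint operators satisfying `ZY = cYZ` -/

section Wold
variable {H : Type*} [NormedAddCommGroup H] [InnerProductSpace ℂ H] [CompleteSpace H]

/-- `Y` may be replaced by `R = √(Y*Y)`: it has the same norms on vectors and commutes with `Z`
because `Y*Y` does. -/
theorem norm_mul_apply_le_of_commute {Y Z : H →L[ℂ] H} (h : Commute (star Y * Y) Z) (v : H) :
    ‖Y (Z v)‖ ≤ ‖Z‖ * ‖Y v‖ := by
  set S := star Y * Y with hS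
  have hS0 : 0 ≤ S := star_mul_self_nonneg Y
  set R := CFC.sqrt S with hR
  have hRR : R * R = S := CFC.sqrt_mul_sqrt_self S hS0
  have hRZ : Commute R Z := h.cfcₙ_nnreal _
  have hRs : star R = R := (CFC.sqrt_nonneg S).isSelfAdjoint
  have key : ∀ u, ‖Y u‖ = ‖R u‖ := by
    intro u
    have h1 : ⟪Y u, Y u⟫_ℂ = ⟪R u, R u⟫_ℂ := by
      rw [← ContinuousLinearMap.adjoint_inner_right, ← ContinuousLinearMap.adjoint_inner_right,
        ← ContinuousLinearMap.star_eq_adjoint, ← ContinuousLinearMap.star_eq_adjoint, hRs]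
      exact congrArg (fun T : H →L[ℂ] H => ⟪u, T u⟫_ℂ) hRR.symm
    rw [@norm_eq_sqrt_re_inner ℂ, h1, ← @norm_eq_sqrt_re_inner ℂ]
  rw [key, key]
  have : R (Z v) = Z (R v) := congrArg (fun T : H →L[ℂ] H => T v) hRZ.eq
  rw [this]
  exact Z.le_opNorm _

/-- A self-adjoint operator `Z` with `ZY = cYZ`, `0 < c < 1`, vanishes if `Y*` is injective. -/
theorem eq_zero_of_mul_eq_smul_mul {Y Z : H →L[ℂ] H} {c : ℝ} (hc0 : 0 < c) (hc1 : c < 1)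
    (hZ : IsSelfAdjoint Z) (hY : Z * Y = (c : ℂ) • (Y * Z))
    (hinj : ∀ v, star Y v = 0 → v = 0) : Z = 0 := by
  have hcc : (c : ℂ) ≠ 0 := by exact_mod_cast hc0.ne'
  have hY' : star Y * Z = (c : ℂ) • (Z * star Y) := by
    have := congrArg star hY
    simpa [hZ.star_eq] using this
  have hcomm : Commute (star Y * Y) Z := by
    have h1 : (c : ℂ) • (star Y * Y * Z) = (c : ℂ) • (Z * (star Y * Y)) := by
      rw [mul_assoc, ← mul_smul_comm, ← hY, ← mul_assoc, hY', smul_mul_assoc, mul_assoc]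
    exact smul_right_injective _ hcc h1
  -- On the dense range of `Y` the operator `Z` loses a factor `c < 1` against its own norm, so its
  -- norm is zero.
  have hbound : ∀ v, ‖Z (Y v)‖ ≤ c * ‖Z‖ * ‖Y v‖ := by
    intro v
    have h1 : Z (Y v) = (c : ℂ) • Y (Z v) := congrArg (fun T : H →L[ℂ] H => T v) hY
    rw [h1, norm_smul, Complex.norm_real, Real.norm_of_nonneg hc0.le, mul_assoc]
    exact mul_le_mul_of_nonneg_left (norm_mul_apply_le_of_commute hcomm v) hc0.le
  have hdense : DenseRange Y := by
    have h1 : (Y.range)ᗮ = ⊥ := by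
      rw [ContinuousLinearMap.orthogonal_range, Submodule.eq_bot_iff]
      intro v hv
      exact hinj v hv
    have h2 := Submodule.topologicalClosure_eq_top_iff.2 h1
    intro x
    have : x ∈ (Y.range).topologicalClosure := h2 ▸ Submodule.mem_top
    exact this
  have hle : ‖Z‖ ≤ c * ‖Z‖ := by
    refine Z.opNorm_le_bound (by positivity) fun x => ?_
    refine hdense.induction_on (p := fun x => ‖Z x‖ ≤ c * ‖Z‖ * ‖x‖) x ?_ hbound
    exact isClosed_le (by fun_prop) (by fun_prop)
  have : ‖Z‖ = 0 := by nlinarith [norm_nonneg Z]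
  exact norm_eq_zero.1 this

end Wold

/-! ### The ladder decomposition at an eigenvector -/

section Ladder
variable {V : Type*} [AddCommGroup V] [Module ℂ V]

/-- To be read with `Q = q`, `P = q^c`, `z = Zu`, `x = iXu`, `y = iYu`. The Casimir relation `hl`
eliminates `y`, so the span of `u`, `z`, `x` is stable under `A`; `u₁`, `d • u` and `u₂` are the
components of `z` for the eigenvalues `μ₁`, `μ`, `μ₂`. -/
theorem exists_ladder {A : Module.End ℂ V} {u z x y : V} {Q P t l μ μ₁ μ₂ d e : ℂ}
    (hQ : Q ≠ 0) (hQ1 : Q ^ 2 - 1 ≠ 0) (hQ2 : Q ^ 2 + 1 ≠ 0) (hP : P ≠ 0) (hP1 : P ^ 2 + 1 ≠ 0)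
    (hPQ : P ^ 2 * Q ^ 2 + 1 ≠ 0) (hPQ' : P ^ 2 + Q ^ 2 ≠ 0)
    (hμ : μ = (P - P⁻¹) / (Q - Q⁻¹)) (hμ₁ : μ₁ = (P * Q ^ 2 - P⁻¹ * Q⁻¹ ^ 2) / (Q - Q⁻¹))
    (hμ₂ : μ₂ = (P * Q⁻¹ ^ 2 - P⁻¹ * Q ^ 2) / (Q - Q⁻¹))
    (hd : d = ((P - P⁻¹) * l - (Q + Q⁻¹) * t) / ((P * Q + P⁻¹ * Q⁻¹) * (P * Q⁻¹ + P⁻¹ * Q)))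
    (he : e = (l - (P - P⁻¹) * d) / (Q + Q⁻¹))
    (hu : A u = μ • u) (hz : A z = μ • z - x - y)
    (hx : A x = (Q ^ 2 * μ) • x - (1 + Q ^ 2) • z - (Q * t) • u)
    (hl : Q⁻¹ • x + ((Q - Q⁻¹) * μ) • z - Q • y = l • u) :
    ∃ u₁ u₂ : V, A u₁ = μ₁ • u₁ ∧ A u₂ = μ₂ • u₂ ∧ z = u₁ + d • u + u₂ ∧
      y = -((P⁻¹ * Q⁻¹) • u₁ - (P * Q⁻¹) • u₂ + e • u) ∧
      x = -((P * Q) • u₁ - (P⁻¹ * Q) • u₂ - e • u) := by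
  have hQ3 : Q - Q⁻¹ ≠ 0 := by
    intro h; apply hQ1; field_simp at h; linear_combination h
  have hQ4 : Q + Q⁻¹ ≠ 0 := by
    intro h; apply hQ2; field_simp at h; linear_combination h
  have hD1 : P * Q + P⁻¹ * Q⁻¹ ≠ 0 := by
    intro h; apply hPQ; field_simp at h; linear_combination h
  have hD2 : P * Q⁻¹ + P⁻¹ * Q ≠ 0 := by
    intro h; apply hPQ'; field_simp at h; linear_combination h
  have hy : y = (Q⁻¹ ^ 2) • x + (Q⁻¹ * (Q - Q⁻¹) * μ) • z - (Q⁻¹ * l) • u := by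
    have : Q • y = Q⁻¹ • x + ((Q - Q⁻¹) * μ) • z - l • u := by rw [← hl]; abel
    have h2 := congrArg (Q⁻¹ • ·) this
    simp only [smul_smul, inv_mul_cancel₀ hQ, one_smul] at h2
    rw [h2]
    module
  subst hy
  have hs : (P + P⁻¹) * (Q + Q⁻¹) ≠ 0 := by
    refine mul_ne_zero ?_ hQ4
    intro h; apply hP1; field_simp at h; linear_combination h
  subst he hd hμ₁ hμ₂ hμ
  set D := ((P - P⁻¹) * l - (Q + Q⁻¹) * t) / ((P * Q + P⁻¹ * Q⁻¹) * (P * Q⁻¹ + P⁻¹ * Q)) with hD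
  have hD' : D * ((P * Q + P⁻¹ * Q⁻¹) * (P * Q⁻¹ + P⁻¹ * Q)) = (P - P⁻¹) * l - (Q + Q⁻¹) * t := by
    rw [hD, div_mul_cancel₀ _ (mul_ne_zero hD1 hD2)]
  -- Taking `D` as the free variable and solving for `t` keeps the denominators of `D` out of the
  -- final identities.
  have ht : t = ((P - P⁻¹) * l - D * ((P * Q + P⁻¹ * Q⁻¹) * (P * Q⁻¹ + P⁻¹ * Q))) / (Q + Q⁻¹) := by
    rw [hD', eq_div_iff hQ4]; ring
  clear_value D
  clear hD hD'
  subst ht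
  -- Lagrange interpolation: `u₁ = (A - μ₂)(z - Du) / (μ₁ - μ₂)`, where `μ₁ - μ₂ = (P + P⁻¹)(Q +
  -- Q⁻¹)` and `μ - μ₂ = PQ⁻¹ + P⁻¹Q`. For `u₂` exchange `μ₁` and `μ₂`.
  refine ⟨((P + P⁻¹) * (Q + Q⁻¹))⁻¹ • (A z - ((P * Q⁻¹ ^ 2 - P⁻¹ * Q ^ 2) / (Q - Q⁻¹)) • z -
      ((P * Q⁻¹ + P⁻¹ * Q) * D) • u),
    -((P + P⁻¹) * (Q + Q⁻¹))⁻¹ • (A z - ((P * Q ^ 2 - P⁻¹ * Q⁻¹ ^ 2) / (Q - Q⁻¹)) • z +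
      ((P * Q + P⁻¹ * Q⁻¹) * D) • u), ?_, ?_, ?_, ?_, ?_⟩ <;>
  · rw [hz]
    try simp only [map_sub, map_add, map_smul, hu, hx, hz]
    match_scalars <;> field_simp <;> ring

end Ladder

/-! ### q-numbers and diagonal coefficients -/

section QNumbers
variable (q : Param)

theorem qsum_pos (x : ℝ) : 0 < qsum q x :=
  add_pos (Real.rpow_pos_of_pos q.2.1 _) (Real.rpow_pos_of_pos q.2.1 _)

theorem qdiff_neg (x : ℝ) : qdiff q (-x) = -qdiff q x := by
  rw [qdiff, qdiff, neg_neg, neg_sub]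

theorem qdiff_strictAnti : StrictAnti (qdiff q) := by
  intro x y h
  have h1 := Real.rpow_lt_rpow_of_exponent_gt q.2.1 q.2.2 h
  have h2 := Real.rpow_lt_rpow_of_exponent_gt q.2.1 q.2.2 (neg_lt_neg h)
  simp only [qdiff]
  linarith

theorem q_sub_inv_neg : (q : ℝ) - (q : ℝ)⁻¹ < 0 := by
  have h0 := q.2.1
  have h1 := q.2.2
  have : (1 : ℝ) < (q : ℝ)⁻¹ := (one_lt_inv₀ h0).2 h1
  linarith

theorem qnum_injective : Function.Injective (qnum q) := by
  intro x y h
  exact (qdiff_strictAnti q).injective ((div_left_inj' (q_sub_inv_neg q).ne).1 h)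

/-- The diagonal matrix coefficient of `Z_t` at an eigenvector of `iB_t` of eigenvalue `[c]`. -/
def diagZ (a lam c : ℝ) : ℝ :=
  (qdiff q c * lam - qsum q 1 * qdiff q a) / (qsum q (c + 1) * qsum q (c - 1))

/-- The diagonal matrix coefficient of `-iY_t` at an eigenvector of `iB_t` of eigenvalue `[c]`. -/
def diagY (a lam c : ℝ) : ℝ := (lam - qdiff q c * diagZ q a lam c) / qsum q 1

end QNumbers

namespace UnitaryRep
variable {q : Param} {a : ℝ} {V : Type*} [NormedAddCommGroup V] [InnerProductSpace ℂ V]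
  (π : UnitaryRep q a V)

/-- What matters later is that `X`, `Y` and `Z` share the same `u₁` and `u₂`, so any two of them
determine the third on `u`. -/
theorem exists_ladder {lam c : ℝ} (hcas : π.Casimir = (lam : ℂ) • 1) {u : V}
    (hu : π.iB u = (qnum q c : ℂ) • u) :
    ∃ u₁ u₂ : V, π.iB u₁ = (qnum q (c + 2) : ℂ) • u₁ ∧ π.iB u₂ = (qnum q (c - 2) : ℂ) • u₂ ∧
      π.sph (podZ q a) u = u₁ + (diagZ q a lam c : ℂ) • u + u₂ ∧
      π.sph (podY q a) u = Complex.I • ((((q : ℝ) ^ (-c - 1) : ℝ) : ℂ) • u₁ -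
        (((q : ℝ) ^ (c - 1) : ℝ) : ℂ) • u₂ + (diagY q a lam c : ℂ) • u) ∧
      π.sph (podX q a) u = Complex.I • ((((q : ℝ) ^ (c + 1) : ℝ) : ℂ) • u₁ -
        (((q : ℝ) ^ (1 - c) : ℝ) : ℂ) • u₂ - (diagY q a lam c : ℂ) • u) := by
  have h0 := q.2.1
  have hP := Real.rpow_pos_of_pos h0 c
  have e0 : (q : ℝ) ^ (-c) = ((q : ℝ) ^ c)⁻¹ := Real.rpow_neg h0.le c
  have e1 : (q : ℝ) ^ (c + 1) = (q : ℝ) ^ c * q := by rw [Real.rpow_add h0, Real.rpow_one]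
  have e2 : (q : ℝ) ^ (c - 1) = (q : ℝ) ^ c * (q : ℝ)⁻¹ := by
    rw [Real.rpow_sub h0, Real.rpow_one]; rfl
  have e3 : (q : ℝ) ^ (-c - 1) = ((q : ℝ) ^ c)⁻¹ * (q : ℝ)⁻¹ := by
    rw [Real.rpow_sub h0, Real.rpow_one, e0]; rfl
  have e4 : (q : ℝ) ^ (1 - c) = ((q : ℝ) ^ c)⁻¹ * q := by
    rw [sub_eq_neg_add, Real.rpow_add h0, Real.rpow_one, e0]
  have e5 : (q : ℝ) ^ (c + 2) = (q : ℝ) ^ c * q ^ 2 := by rw [Real.rpow_add h0, Real.rpow_two]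
  have e6 : (q : ℝ) ^ (c - 2) = (q : ℝ) ^ c * (q : ℝ)⁻¹ ^ 2 := by
    rw [Real.rpow_sub h0, Real.rpow_two, inv_pow]; rfl
  have hI := Complex.I_mul_I
  have hq : qc q ≠ 0 := qc_ne_zero q
  have hz := LinearMap.congr_fun π.iB_mul_podZ u
  have hx := LinearMap.congr_fun π.iB_mul_podX u
  have hl := LinearMap.congr_fun hcas u
  simp only [Casimir, Module.End.mul_apply, LinearMap.sub_apply, LinearMap.smul_apply,
    LinearMap.add_apply, Module.End.one_apply, hu, map_smul] at hz hx hl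
  obtain ⟨u₁, u₂, h1, h2, h3, h4, h5⟩ := QuantumSL2.exists_ladder (A := π.iB) (u := u)
    (z := π.sph (podZ q a) u) (x := Complex.I • π.sph (podX q a) u)
    (y := Complex.I • π.sph (podY q a) u) (Q := qc q) (P := (((q : ℝ) ^ c : ℝ) : ℂ))
    (t := (qdiff q a : ℂ)) (l := (lam : ℂ)) (μ := (qnum q c : ℂ)) (μ₁ := (qnum q (c + 2) : ℂ))
    (μ₂ := (qnum q (c - 2) : ℂ)) (d := (diagZ q a lam c : ℂ)) (e := (diagY q a lam c : ℂ))
    hq (by rw [qc]; norm_cast; nlinarith [q.2.2]) (by rw [qc]; norm_cast; positivity)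
    (by norm_cast; positivity) (by norm_cast; positivity) (by rw [qc]; norm_cast; positivity)
    (by rw [qc]; norm_cast; positivity) (by rw [qnum, e0]; push_cast; rfl)
    (by rw [qnum, neg_add', Real.rpow_sub h0, Real.rpow_two, e0, e5, qc]; push_cast; ring)
    (by rw [qnum, neg_sub, sub_eq_neg_add 2 c, Real.rpow_add h0, Real.rpow_two, e0, e6,
      qc]; push_cast; ring)
    (by
      rw [diagZ, qsum, qsum, qsum, qdiff, neg_add', neg_sub, e0, e1, e2, e3, e4, Real.rpow_one,
        Real.rpow_neg_one, qc]
      push_cast; ring)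
    (by rw [diagY, qsum, qdiff, e0, Real.rpow_one, Real.rpow_neg_one, qc]; push_cast; ring)
    hu (by rw [hz]; module)
    (by
      rw [map_smul, hx]
      match_scalars
      · ring
      · linear_combination (1 + qc q ^ 2) * hI
      · linear_combination (qc q * (qdiff q a : ℂ)) * hI)
    (by
      rw [← hl]
      module)
  refine ⟨u₁, u₂, h1, h2, h3, ?_, ?_⟩
  · have : π.sph (podY q a) u = -(Complex.I • Complex.I • π.sph (podY q a) u) := by
      rw [smul_smul, hI]; simp
    rw [this, h4, e2, e3, qc]
    push_cast
    module
  · have : π.sph (podX q a) u = -(Complex.I • Complex.I • π.sph (podX q a) u) := by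
      rw [smul_smul, hI]; simp
    rw [this, h5, e1, e4, qc]
    push_cast
    module

end UnitaryRep

/-! ### Weight projections and the use of irreducibility -/

namespace UnitaryRep
open UniformSpace (Completion)
variable {q : Param} {a : ℝ} {V : Type*} [NormedAddCommGroup V] [InnerProductSpace ℂ V]
  {π : UnitaryRep q a V}

theorem inner_eq_zero_of_eigenvector {x y : ℝ} (hxy : x ≠ y) {u v : V}
    (hu : π.iB u = (qnum q x : ℂ) • u) (hv : π.iB v = (qnum q y : ℂ) • v) : ⟪u, v⟫_ℂ = 0 := by
  have h := π.inner_iB u v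
  rw [hu, hv, inner_smul_left, inner_smul_right, Complex.conj_ofReal, ← sub_eq_zero, ← sub_mul,
    mul_eq_zero, ← Complex.ofReal_sub, Complex.ofReal_eq_zero, sub_eq_zero] at h
  exact h.resolve_left fun h' => hxy (qnum_injective q h').symm

/-- Completeness is not available in `V`; the projection is read off from the algebraic sum of
mutually orthogonal eigenspaces. -/
theorem IsAdmissible.hasOrthogonalProjection (hadm : π.IsAdmissible) (x : ℝ) :
    (Module.End.eigenspace π.iB (qnum q x : ℂ)).HasOrthogonalProjection := by
  refine ⟨fun v => ?_⟩
  have hv : v ∈ ⨆ n : ℤ, Module.End.eigenspace π.iB (qnum q (a + n) : ℂ) := by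
    rw [hadm]; exact Submodule.mem_top
  induction hv using Submodule.iSup_induction' with
  | mem n v hv =>
    by_cases h : x = a + n
    · exact ⟨v, h ▸ hv, by simp⟩
    · refine ⟨0, Submodule.zero_mem _, ?_⟩
      rw [sub_zero, Submodule.mem_orthogonal]
      intro u hu
      exact inner_eq_zero_of_eigenvector h (Module.End.mem_eigenspace_iff.1 hu)
        (Module.End.mem_eigenspace_iff.1 hv)
  | zero => exact ⟨0, Submodule.zero_mem _, by simp⟩
  | add v w _ _ hv hw =>
    obtain ⟨v', hv', hv⟩ := hv
    obtain ⟨w', hw', hw⟩ := hw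
    refine ⟨v' + w', Submodule.add_mem _ hv' hw', ?_⟩
    rw [add_sub_add_comm]
    exact Submodule.add_mem _ hv hw

/-- The orthogonal projection onto the eigenspace of `iB_t` of eigenvalue `[x]`. -/
def eigenProj (hadm : π.IsAdmissible) (x : ℝ) : V →L[ℂ] V :=
  haveI := hadm.hasOrthogonalProjection x
  (Module.End.eigenspace π.iB (qnum q x : ℂ)).starProjection

theorem iB_eigenProj (hadm : π.IsAdmissible) (x : ℝ) (v : V) :
    π.iB (eigenProj hadm x v) = (qnum q x : ℂ) • eigenProj hadm x v := by
  have := hadm.hasOrthogonalProjection x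
  exact Module.End.mem_eigenspace_iff.1 (Submodule.starProjection_apply_mem _ v)

theorem eigenProj_self (hadm : π.IsAdmissible) {x : ℝ} {v : V}
    (hv : π.iB v = (qnum q x : ℂ) • v) : eigenProj hadm x v = v := by
  have := hadm.hasOrthogonalProjection x
  exact Submodule.starProjection_eq_self_iff.2 (Module.End.mem_eigenspace_iff.2 hv)

theorem eigenProj_of_ne (hadm : π.IsAdmissible) {x y : ℝ} (hxy : x ≠ y) {v : V}
    (hv : π.iB v = (qnum q y : ℂ) • v) : eigenProj hadm x v = 0 := by
  have := hadm.hasOrthogonalProjection x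
  refine (Submodule.starProjection_apply_eq_zero_iff _).2 ((Submodule.mem_orthogonal _ _).2 fun u hu => ?_)
  exact inner_eq_zero_of_eigenvector hxy (Module.End.mem_eigenspace_iff.1 hu) hv

theorem exists_sum_eigenProj (hadm : π.IsAdmissible) (v : V) :
    ∃ F : Finset ℤ, ∀ F', F ⊆ F' → ∑ n ∈ F', eigenProj hadm (a + n) v = v := by
  classical
  have hv : v ∈ ⨆ n : ℤ, Module.End.eigenspace π.iB (qnum q (a + n) : ℂ) := by
    rw [hadm]; exact Submodule.mem_top
  induction hv using Submodule.iSup_induction' with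
  | mem n v hv =>
    rw [Module.End.mem_eigenspace_iff] at hv
    refine ⟨{n}, fun F' hF' => ?_⟩
    rw [Finset.sum_eq_single n]
    · exact eigenProj_self hadm hv
    · intro m _ hmn
      exact eigenProj_of_ne hadm (by simpa using hmn) hv
    · intro h
      exact absurd (hF' (Finset.mem_singleton_self n)) h
  | zero => exact ⟨∅, by simp⟩
  | add v w _ _ hv hw =>
    obtain ⟨F, hF⟩ := hv
    obtain ⟨G, hG⟩ := hw
    refine ⟨F ∪ G, fun F' h => ?_⟩
    simp only [map_add, Finset.sum_add_distrib]
    rw [hF F' (Finset.union_subset_left h), hG F' (Finset.union_subset_right h)]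

theorem compl_inner_podX (x y : Completion V) :
    ⟪π.compl (podY q a) x, y⟫_ℂ = ⟪x, π.compl (podX q a) y⟫_ℂ := by
  rw [← star_podX, map_star, ContinuousLinearMap.star_eq_adjoint,
    ContinuousLinearMap.adjoint_inner_left]

theorem compl_inner_podZ (x y : Completion V) :
    ⟪π.compl (podZ q a) x, y⟫_ℂ = ⟪x, π.compl (podZ q a) y⟫_ℂ := by
  conv_lhs => rw [← star_podZ, map_star, ContinuousLinearMap.star_eq_adjoint,
    ContinuousLinearMap.adjoint_inner_left]

/-- Let `K` be the part of `V` orthogonal to `N`; it is stable under `Y = X*` and `Z`. The vectors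
all of whose weight components lie in `K` form a closed invariant subspace `W` of `V` containing
`ξ`, so `W = V` and `N` is orthogonal to a dense subspace. -/
theorem eq_bot_of_eigenvector_orthogonal (hadm : π.IsAdmissible) (hirr : π.IsIrreducible) {lam : ℝ}
    (hcas : π.Casimir = (lam : ℂ) • 1) {N : Submodule ℂ (Completion V)}
    (hX : ∀ x ∈ N, π.compl (podX q a) x ∈ N) (hZ : ∀ x ∈ N, π.compl (podZ q a) x ∈ N)
    {ξ : V} (hξ0 : ξ ≠ 0) {c : ℝ} (hξ : π.iB ξ = (qnum q c : ℂ) • ξ)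
    (hN : ∀ x ∈ N, ⟪(ξ : Completion V), x⟫_ℂ = 0) : N = ⊥ := by
  set K : Submodule ℂ V := Nᗮ.comap (Completion.toComplL (𝕜 := ℂ) : V →L[ℂ] Completion V).toLinearMap with hK
  have memK : ∀ u : V, u ∈ K ↔ ∀ x ∈ N, ⟪(u : Completion V), x⟫_ℂ = 0 := by
    intro u
    exact Submodule.mem_orthogonal' _ _
  have hKc : IsClosed (K : Set V) :=
    N.isClosed_orthogonal.preimage (Completion.toComplL (𝕜 := ℂ) : V →L[ℂ] Completion V).continuous
  -- `N` lives in the completion and carries no action of `iB_t`, so `K` need not be `iB_t`-stable.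
  -- Passing to weight components repairs this, and continuity of the projections keeps `W` closed.
  set W : Submodule ℂ V := ⨅ n : ℤ, K.comap (eigenProj hadm (a + n)).toLinearMap with hW
  have memW : ∀ u : V, u ∈ W ↔ ∀ n : ℤ, eigenProj hadm (a + n) u ∈ K := by
    intro u; simp [hW, Submodule.mem_iInf]
  have hWc : IsClosed (W : Set V) := by
    have : (W : Set V) = ⋂ n : ℤ, (eigenProj hadm (a + n)) ⁻¹' K := by
      ext u; simpa using memW u
    rw [this]
    exact isClosed_iInter fun n => hKc.preimage (eigenProj hadm (a + n)).continuous
  have eigW : ∀ {u : V} {x : ℝ}, π.iB u = (qnum q x : ℂ) • u → u ∈ K → u ∈ W := by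
    intro u x hu huK
    rw [memW]
    intro n
    by_cases h : a + n = x
    · subst h; rwa [eigenProj_self hadm hu]
    · rw [eigenProj_of_ne hadm h hu]; exact K.zero_mem
  have KY : ∀ u ∈ K, π.sph (podY q a) u ∈ K := by
    intro u hu
    rw [memK] at hu ⊢
    intro x hx
    rw [← compl_coe, compl_inner_podX]
    exact hu _ (hX x hx)
  have KZ : ∀ u ∈ K, π.sph (podZ q a) u ∈ K := by
    intro u hu
    rw [memK] at hu ⊢
    intro x hx
    rw [← compl_coe, compl_inner_podZ]
    exact hu _ (hZ x hx)
  have step : ∀ {u : V} {x : ℝ}, π.iB u = (qnum q x : ℂ) • u → u ∈ K →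
      π.sph (podX q a) u ∈ W ∧ π.sph (podY q a) u ∈ W ∧ π.sph (podZ q a) u ∈ W := by
    intro u x hu huK
    obtain ⟨u₁, u₂, h1, h2, h3, h4, h5⟩ := π.exists_ladder hcas hu
    have hs : (((q : ℝ) ^ (-x - 1) + (q : ℝ) ^ (x - 1) : ℝ) : ℂ) ≠ 0 := by
      have := Real.rpow_pos_of_pos q.2.1 (-x - 1)
      have := Real.rpow_pos_of_pos q.2.1 (x - 1)
      norm_cast
      positivity
    -- Eliminating `u₂` between `Zu` and `Yu` leaves `u₁` with coefficient `q^(-x-1) + q^(x-1)`,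
    -- which is positive.
    have hu₁ : u₁ ∈ K := by
      refine (K.smul_mem_iff hs).1 ?_
      have : (((q : ℝ) ^ (-x - 1) + (q : ℝ) ^ (x - 1) : ℝ) : ℂ) • u₁ =
          -Complex.I • π.sph (podY q a) u + (((q : ℝ) ^ (x - 1) : ℝ) : ℂ) • π.sph (podZ q a) u -
          ((((q : ℝ) ^ (x - 1) : ℝ) : ℂ) * (diagZ q a lam x : ℂ) + (diagY q a lam x : ℂ)) • u := by
        rw [h4, h3, smul_smul, neg_mul, Complex.I_mul_I]
        push_cast
        module
      rw [this]
      exact K.sub_mem (K.add_mem (K.smul_mem _ (KY u huK)) (K.smul_mem _ (KZ u huK)))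
        (K.smul_mem _ huK)
    have hu₂ : u₂ ∈ K := by
      have : u₂ = π.sph (podZ q a) u - (diagZ q a lam x : ℂ) • u - u₁ := by rw [h3]; abel
      rw [this]
      exact K.sub_mem (K.sub_mem (KZ u huK) (K.smul_mem _ huK)) hu₁
    have w := eigW hu huK
    have w₁ := eigW h1 hu₁
    have w₂ := eigW h2 hu₂
    -- Invariance under `X` comes from the ladder alone, as `N` is not assumed stable under `Y`.
    rw [h3, h4, h5]
    exact ⟨W.smul_mem _ (W.sub_mem (W.sub_mem (W.smul_mem _ w₁) (W.smul_mem _ w₂)) (W.smul_mem _ w)),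
      W.smul_mem _ (W.add_mem (W.sub_mem (W.smul_mem _ w₁) (W.smul_mem _ w₂)) (W.smul_mem _ w)),
      W.add_mem (W.add_mem w₁ (W.smul_mem _ w)) w₂⟩
  have lift : ∀ T : Module.End ℂ V,
      (∀ {u : V} {x : ℝ}, π.iB u = (qnum q x : ℂ) • u → u ∈ K → T u ∈ W) → ∀ u ∈ W, T u ∈ W := by
    intro T hT u hu
    obtain ⟨F, hF⟩ := exists_sum_eigenProj hadm u
    rw [← hF F subset_rfl, map_sum]
    exact W.sum_mem fun n _ => hT (iB_eigenProj hadm _ u) ((memW u).1 hu n)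
  have hWsph : ∀ f, ∀ w ∈ W, π.sph f w ∈ W := by
    intro f
    let S : Subalgebra ℂ (Podles q a) :=
      { carrier := {f | ∀ w ∈ W, π.sph f w ∈ W}
        mul_mem' := fun {f g} hf hg w hw => by
          rw [map_mul, Module.End.mul_apply]; exact hf _ (hg _ hw)
        add_mem' := fun {f g} hf hg w hw => by
          rw [map_add, LinearMap.add_apply]; exact W.add_mem (hf _ hw) (hg _ hw)
        algebraMap_mem' := fun r w hw => by
          rw [AlgHom.commutes, Module.algebraMap_end_apply]; exact W.smul_mem _ hw }
    exact podles_induction S (lift _ fun hu h => (step hu h).1) (lift _ fun hu h => (step hu h).2.1)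
      (lift _ fun hu h => (step hu h).2.2) f
  have hWiB : ∀ w ∈ W, π.iB w ∈ W := lift _ fun hu h => by
    rw [hu]; exact W.smul_mem _ (eigW hu h)
  rcases hirr.2 W hWc hWsph hWiB with h | h
  · exact absurd ((Submodule.eq_bot_iff W).1 h ξ (eigW hξ ((memK ξ).2 hN))) hξ0
  · have hKtop : ∀ u : V, u ∈ K := by
      intro u
      obtain ⟨F, hF⟩ := exists_sum_eigenProj hadm u
      rw [← hF F subset_rfl]
      exact K.sum_mem fun n _ => (memW u).1 (h ▸ Submodule.mem_top) n
    rw [Submodule.eq_bot_iff]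
    intro x hx
    have : ∀ y : Completion V, ⟪y, x⟫_ℂ = 0 := by
      intro y
      induction y using Completion.induction_on with
      | hp => exact isClosed_eq (by fun_prop) continuous_const
      | ih u => exact (memK u).1 (hKtop u) x hx
    exact inner_self_eq_zero.1 (this x)

end UnitaryRep

theorem eq_top_of_basisVec_mem {S : Submodule ℂ L2N} (hS : IsClosed (S : Set L2N))
    (h : ∀ p, basisVec p ∈ S) : S = ⊤ := by
  rw [Submodule.eq_top_iff']
  intro x
  have hx := lp.hasSum_single (p := 2) (by norm_num) x
  refine hS.mem_of_tendsto hx (Filter.Eventually.of_forall fun F => S.sum_mem fun p _ => ?_)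
  have : lp.single 2 p (x p) = (x p) • basisVec p := by
    rw [basisVec, ← lp.single_smul, smul_eq_mul, mul_one]
  change lp.single 2 p (x p) ∈ S
  rw [this]
  exact S.smul_mem _ (h p)

/-! ### Copies of `π_±` generated by a vacuum vector -/

section Spherical
variable (q : Param) (a : ℝ)

/-- The eigenvalues of `π_±(Z_t)`. -/
def eigZ (ε : ℤˣ) (p : ℕ) : ℝ := (ε : ℤ) * (q : ℝ) ^ (2 * p - (ε : ℤ) * a + 1 : ℝ)

/-- The square of the coefficients of `π_±(X_t)`. -/
def coefSq (ε : ℤˣ) (x : ℝ) : ℝ :=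
  (1 - (q : ℝ) ^ (2 * x : ℝ)) * ((q : ℝ) ^ (-2 * (ε : ℤ) * a + 2 * x : ℝ) + 1)

variable {q a}
variable {H : Type*} [NormedAddCommGroup H] [InnerProductSpace ℂ H] [CompleteSpace H]
  {K : Type*} [NormedAddCommGroup K] [InnerProductSpace ℂ K] [CompleteSpace K]
  (ρ : PodlesRep q a H)

/-- `J` intertwines the formulas defining `π_±` with the operators of `ρ`. -/
def IsPiIsometry (ε : ℤˣ) (J : L2N →ₗᵢ[ℂ] H) : Prop :=
  ∀ p : ℕ,
    ρ (podZ q a) (J (basisVec p)) = (eigZ q a ε p : ℂ) • J (basisVec p) ∧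
    ρ (podX q a) (J (basisVec p)) = (√(coefSq q a ε p) : ℂ) • J (basisVec (p - 1)) ∧
    ρ (podY q a) (J (basisVec p)) = (√(coefSq q a ε (p + 1)) : ℂ) • J (basisVec (p + 1))

theorem star_rep_podX : star (ρ (podX q a)) = ρ (podY q a) := by rw [← map_star, star_podX]
theorem star_rep_podY : star (ρ (podY q a)) = ρ (podX q a) := by rw [← map_star, star_podY]
theorem isSelfAdjoint_rep_podZ : IsSelfAdjoint (ρ (podZ q a)) := by
  rw [isSelfAdjoint_iff, ← map_star, star_podZ]

theorem rep_inner_podX (x y : H) : ⟪x, ρ (podX q a) y⟫_ℂ = ⟪ρ (podY q a) x, y⟫_ℂ := by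
  rw [← star_rep_podX, ContinuousLinearMap.star_eq_adjoint, ContinuousLinearMap.adjoint_inner_left]

theorem rep_inner_podY (x y : H) : ⟪x, ρ (podY q a) y⟫_ℂ = ⟪ρ (podX q a) x, y⟫_ℂ := by
  rw [← star_rep_podY, ContinuousLinearMap.star_eq_adjoint, ContinuousLinearMap.adjoint_inner_left]

theorem rep_inner_podZ (x y : H) : ⟪x, ρ (podZ q a) y⟫_ℂ = ⟪ρ (podZ q a) x, y⟫_ℂ := by
  conv_rhs => rw [← (isSelfAdjoint_rep_podZ ρ).star_eq, ContinuousLinearMap.star_eq_adjoint,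
    ContinuousLinearMap.adjoint_inner_left]

theorem rep_podY_podX (v : H) : ρ (podY q a) (ρ (podX q a) v) = v -
    ((qdiff q a : ℂ) * (qc q)⁻¹) • ρ (podZ q a) v -
    ((qc q)⁻¹ ^ 2) • ρ (podZ q a) (ρ (podZ q a) v) := by
  have := congrArg (fun f => ρ f v) (podY_mul_podX (q := q) (a := a))
  simp only [map_mul, map_sub, map_smul, map_one] at this
  exact this

theorem rep_podX_podY (v : H) : ρ (podX q a) (ρ (podY q a) v) = v -
    ((qdiff q a : ℂ) * qc q) • ρ (podZ q a) v -
    (qc q ^ 2) • ρ (podZ q a) (ρ (podZ q a) v) := by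
  have := congrArg (fun f => ρ f v) (podX_mul_podY (q := q) (a := a))
  simp only [map_mul, map_sub, map_smul, map_one] at this
  exact this

theorem rep_podZ_podY (v : H) : ρ (podZ q a) (ρ (podY q a) v) =
    (qc q ^ 2) • ρ (podY q a) (ρ (podZ q a) v) := by
  have := congrArg (fun f => ρ f v) (podZ_mul_podY (q := q) (a := a))
  simp only [map_mul, map_smul] at this
  exact this

theorem rep_podX_podZ (v : H) : ρ (podX q a) (ρ (podZ q a) v) =
    (qc q ^ 2) • ρ (podZ q a) (ρ (podX q a) v) := by
  have := congrArg (fun f => ρ f v) (podX_mul_podZ (q := q) (a := a))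
  simp only [map_mul, map_smul] at this
  exact this

theorem rep_podZ_podX (v : H) : ρ (podZ q a) (ρ (podX q a) v) =
    ((qc q)⁻¹ ^ 2) • ρ (podX q a) (ρ (podZ q a) v) := by
  rw [rep_podX_podZ, smul_smul, ← mul_pow, inv_mul_cancel₀ (qc_ne_zero q), one_pow, one_smul]

/-- A submodule is invariant under `ρ` if it is invariant under the generators. -/
theorem rep_mem_of_generators {S : Submodule ℂ H} (hX : ∀ v ∈ S, ρ (podX q a) v ∈ S)
    (hY : ∀ v ∈ S, ρ (podY q a) v ∈ S) (hZ : ∀ v ∈ S, ρ (podZ q a) v ∈ S) (f : Podles q a) :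
    ∀ v ∈ S, ρ f v ∈ S := by
  let A : Subalgebra ℂ (Podles q a) :=
    { carrier := {f | ∀ v ∈ S, ρ f v ∈ S}
      mul_mem' := fun {f g} hf hg v hv => by
        rw [map_mul]; exact hf _ (hg _ hv)
      add_mem' := fun {f g} hf hg v hv => by
        rw [map_add]; exact S.add_mem (hf _ hv) (hg _ hv)
      algebraMap_mem' := fun r v hv => by
        rw [AlgHomClass.commutes]; exact S.smul_mem r hv }
  exact podles_induction A hX hY hZ f

/-- The representation is `J*ρJ`; it is multiplicative because `JJ*` is the identity on the
invariant range of `J`. -/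
theorem exists_compression {J : K →ₗᵢ[ℂ] H} (hJ : ∀ f x, ∃ y, J y = ρ f (J x)) :
    ∃ σ : PodlesRep q a K, ∀ f x, J (σ f x) = ρ f (J x) := by
  set T : K →L[ℂ] H := J.toContinuousLinearMap with hT
  have hTT : ∀ x, ContinuousLinearMap.adjoint T (J x) = x := by
    intro x
    refine ext_inner_left ℂ fun y => ?_
    rw [ContinuousLinearMap.adjoint_inner_right]
    exact J.inner_map_map y x
  have key : ∀ f x, J (ContinuousLinearMap.adjoint T (ρ f (J x))) = ρ f (J x) := by
    intro f x
    obtain ⟨y, hy⟩ := hJ f x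
    rw [← hy, hTT]
  refine ⟨
    { toFun := fun f => (ContinuousLinearMap.adjoint T).comp ((ρ f).comp T)
      map_one' := ?_, map_mul' := ?_, map_zero' := ?_, map_add' := ?_, commutes' := ?_
      map_star' := ?_ }, key⟩
  · ext x
    rw [map_one]
    exact hTT x
  · intro f g
    ext x
    rw [map_mul]
    change ContinuousLinearMap.adjoint T (ρ f (ρ g (J x))) =
      ContinuousLinearMap.adjoint T (ρ f (J (ContinuousLinearMap.adjoint T (ρ g (J x)))))
    rw [key]
  · ext x; simp
  · intro f g
    ext x
    simp
  · intro c
    ext x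
    rw [AlgHomClass.commutes]
    change ContinuousLinearMap.adjoint T (c • J x) = c • x
    rw [map_smul, hTT]
  · intro f
    rw [map_star, ContinuousLinearMap.star_eq_adjoint, ContinuousLinearMap.star_eq_adjoint,
      ContinuousLinearMap.adjoint_comp, ContinuousLinearMap.adjoint_comp,
      ContinuousLinearMap.adjoint_adjoint]
    rfl

theorem eigZ_succ (ε : ℤˣ) (p : ℕ) : eigZ q a ε (p + 1) = (q : ℝ) ^ 2 * eigZ q a ε p := by
  rw [eigZ, eigZ, ← Real.rpow_two, mul_left_comm, ← Real.rpow_add q.2.1]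
  push_cast
  ring_nf

theorem eigZ_eq (ε : ℤˣ) (p : ℕ) : eigZ q a ε p = (q : ℝ) ^ (2 * p) * eigZ q a ε 0 := by
  induction p with
  | zero => simp
  | succ p ih => rw [eigZ_succ, ih]; ring

/-- The right side is the polynomial expressing `YX` in `Z`, evaluated at `z = εq^(2x-εa+1)`; the
product defining `coefSq` is its factorization. -/
theorem coefSq_eq (ε : ℤˣ) (x : ℝ) : coefSq q a ε x =
    1 - qdiff q a * (q : ℝ)⁻¹ * ((ε : ℤ) * (q : ℝ) ^ (2 * x - (ε : ℤ) * a + 1 : ℝ)) -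
      (q : ℝ)⁻¹ ^ 2 * ((ε : ℤ) * (q : ℝ) ^ (2 * x - (ε : ℤ) * a + 1 : ℝ)) ^ 2 := by
  have h0 := q.2.1
  have hp := Real.rpow_pos_of_pos h0 a
  have hx := Real.rpow_pos_of_pos h0 x
  have e1 : (q : ℝ) ^ (2 * x) = ((q : ℝ) ^ x) ^ 2 := by
    rw [mul_comm, Real.rpow_mul h0.le, Real.rpow_two]
  have e2 : (q : ℝ) ^ (2 * a) = ((q : ℝ) ^ a) ^ 2 := by
    rw [mul_comm, Real.rpow_mul h0.le, Real.rpow_two]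
  rw [coefSq, qdiff, Real.rpow_neg h0.le]
  rcases Int.units_eq_one_or ε with rfl | rfl
  · have e3 : (q : ℝ) ^ (-2 * ((1 : ℤˣ) : ℤ) * a + 2 * x : ℝ) = ((q : ℝ) ^ x) ^ 2 / ((q : ℝ) ^ a) ^ 2 := by
      rw [← e1, ← e2, ← Real.rpow_sub h0]; congr 1; push_cast; ring
    have e4 : (q : ℝ) ^ (2 * x - ((1 : ℤˣ) : ℤ) * a + 1 : ℝ) = ((q : ℝ) ^ x) ^ 2 / (q : ℝ) ^ a * q := by
      rw [Real.rpow_add h0, Real.rpow_one, Real.rpow_sub h0, e1]; simp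
    rw [e3, e4, e1]
    simp
    field_simp
    ring
  · have e3 : (q : ℝ) ^ (-2 * ((-1 : ℤˣ) : ℤ) * a + 2 * x : ℝ) = ((q : ℝ) ^ x) ^ 2 * ((q : ℝ) ^ a) ^ 2 := by
      rw [← e1, ← e2, ← Real.rpow_add h0]; congr 1; push_cast; ring
    have e4 : (q : ℝ) ^ (2 * x - ((-1 : ℤˣ) : ℤ) * a + 1 : ℝ) = ((q : ℝ) ^ x) ^ 2 * (q : ℝ) ^ a * q := by
      rw [Real.rpow_add h0, Real.rpow_one, sub_eq_add_neg, Real.rpow_add h0, e1]; simp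
    rw [e3, e4, e1]
    simp
    field_simp
    ring

theorem coefSq_eigZ (ε : ℤˣ) (p : ℕ) : coefSq q a ε p =
    1 - qdiff q a * (q : ℝ)⁻¹ * eigZ q a ε p - (q : ℝ)⁻¹ ^ 2 * eigZ q a ε p ^ 2 := coefSq_eq ε p

/-- The substitution `z ↦ q²z` turns the polynomial for `YX` into the one for `XY`. -/
theorem coefSq_succ (ε : ℤˣ) (p : ℕ) : coefSq q a ε (p + 1) =
    1 - qdiff q a * (q : ℝ) * eigZ q a ε p - (q : ℝ) ^ 2 * eigZ q a ε p ^ 2 := by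
  have h := coefSq_eigZ (q := q) (a := a) ε (p + 1)
  rw [eigZ_succ] at h
  push_cast at h
  have h0 := q.2.1.ne'
  rw [h]
  field_simp

theorem coefSq_succ_pos (ε : ℤˣ) (p : ℕ) : 0 < coefSq q a ε (p + 1) := by
  have h0 := q.2.1
  refine mul_pos (sub_pos.2 (Real.rpow_lt_one h0.le q.2.2 (by positivity))) ?_
  have := Real.rpow_pos_of_pos h0 (-2 * (ε : ℤ) * a + 2 * ((p : ℝ) + 1) : ℝ)
  positivity

theorem coefSq_zero (ε : ℤˣ) : coefSq q a ε 0 = 0 := by simp [coefSq]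

theorem eigZ_one_pos (p : ℕ) : 0 < eigZ q a 1 p := by
  have := Real.rpow_pos_of_pos q.2.1 (2 * p - ((1 : ℤˣ) : ℤ) * a + 1 : ℝ)
  simpa [eigZ] using this

theorem eigZ_neg_one_neg (p : ℕ) : eigZ q a (-1) p < 0 := by
  have := Real.rpow_pos_of_pos q.2.1 (2 * p - ((-1 : ℤˣ) : ℤ) * a + 1 : ℝ)
  simpa [eigZ] using this

theorem units_mul_eigZ_pos (ε : ℤˣ) (p : ℕ) : 0 < ((ε : ℤ) : ℝ) * eigZ q a ε p := by
  rcases Int.units_eq_one_or ε with rfl | rfl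
  · simpa using eigZ_one_pos p
  · simpa using eigZ_neg_one_neg p

theorem eigZ_injective (ε : ℤˣ) : Function.Injective (eigZ q a ε) := by
  intro m n h
  have h0 : eigZ q a ε 0 ≠ 0 := fun h => by simpa [h] using units_mul_eigZ_pos (q := q) (a := a) ε 0
  rw [eigZ_eq ε m, eigZ_eq ε n] at h
  have := pow_right_injective₀ q.2.1 q.2.2.ne (mul_right_cancel₀ h0 h)
  omega

theorem eigZ_ne_of_ne {ε ε' : ℤˣ} (h : ε ≠ ε') (m n : ℕ) : eigZ q a ε m ≠ eigZ q a ε' n := by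
  rcases Int.units_eq_one_or ε with rfl | rfl <;> rcases Int.units_eq_one_or ε' with rfl | rfl
  · exact absurd rfl h
  · exact ((eigZ_neg_one_neg n).trans (eigZ_one_pos m)).ne'
  · exact ((eigZ_neg_one_neg m).trans (eigZ_one_pos n)).ne
  · exact absurd rfl h

variable {ρ}

theorem inner_eq_zero_of_podZ {x y : ℝ} (hxy : x ≠ y) {u v : H}
    (hu : ρ (podZ q a) u = (x : ℂ) • u) (hv : ρ (podZ q a) v = (y : ℂ) • v) : ⟪u, v⟫_ℂ = 0 := by
  have h := rep_inner_podZ ρ u v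
  rw [hu, hv, inner_smul_left, inner_smul_right, Complex.conj_ofReal, ← sub_eq_zero, ← sub_mul,
    mul_eq_zero, ← Complex.ofReal_sub, Complex.ofReal_eq_zero, sub_eq_zero] at h
  exact h.resolve_left fun h' => hxy h'.symm

/-- The orthonormal basis obtained by applying powers of `Y_t` to a vacuum vector. -/
def ladderVec (ρ : PodlesRep q a H) (ε : ℤˣ) (m : H) : ℕ → H
  | 0 => m
  | p + 1 => (√(coefSq q a ε (p + 1)) : ℂ)⁻¹ • ρ (podY q a) (ladderVec ρ ε m p)

theorem podY_ladderVec (ε : ℤˣ) (m : H) (p : ℕ) : ρ (podY q a) (ladderVec ρ ε m p) =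
    (√(coefSq q a ε (p + 1)) : ℂ) • ladderVec ρ ε m (p + 1) := by
  have : (√(coefSq q a ε (p + 1)) : ℂ) ≠ 0 := by
    exact_mod_cast (Real.sqrt_pos.2 (coefSq_succ_pos ε p)).ne'
  rw [ladderVec, smul_smul, mul_inv_cancel₀ this, one_smul]

theorem podZ_ladderVec {ε : ℤˣ} {m : H} (hZ : ρ (podZ q a) m = (eigZ q a ε 0 : ℂ) • m) (p : ℕ) :
    ρ (podZ q a) (ladderVec ρ ε m p) = (eigZ q a ε p : ℂ) • ladderVec ρ ε m p := by
  induction p with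
  | zero => exact hZ
  | succ p ih =>
    rw [ladderVec, map_smul, rep_podZ_podY, ih, map_smul, eigZ_succ, qc]
    push_cast
    module

theorem podX_podY_ladderVec {ε : ℤˣ} {m : H} (hZ : ρ (podZ q a) m = (eigZ q a ε 0 : ℂ) • m) (p : ℕ) :
    ρ (podX q a) (ρ (podY q a) (ladderVec ρ ε m p)) =
      (coefSq q a ε (p + 1) : ℂ) • ladderVec ρ ε m p := by
  rw [rep_podX_podY, podZ_ladderVec hZ, map_smul, podZ_ladderVec hZ, coefSq_succ, qc]
  push_cast
  module

theorem podX_ladderVec_succ {ε : ℤˣ} {m : H} (hZ : ρ (podZ q a) m = (eigZ q a ε 0 : ℂ) • m) (p : ℕ) :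
    ρ (podX q a) (ladderVec ρ ε m (p + 1)) =
      (√(coefSq q a ε (p + 1)) : ℂ) • ladderVec ρ ε m p := by
  have hpos := coefSq_succ_pos (q := q) (a := a) ε p
  have h : (√(coefSq q a ε (p + 1)) : ℂ) ≠ 0 := by exact_mod_cast (Real.sqrt_pos.2 hpos).ne'
  have h2 : (coefSq q a ε (p + 1) : ℂ) = √(coefSq q a ε (p + 1)) * √(coefSq q a ε (p + 1)) := by
    exact_mod_cast (Real.mul_self_sqrt hpos.le).symm
  rw [ladderVec, map_smul, podX_podY_ladderVec hZ, smul_smul, h2, inv_mul_cancel_left₀ h]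

theorem norm_ladderVec {ε : ℤˣ} {m : H} (hm : ‖m‖ = 1)
    (hZ : ρ (podZ q a) m = (eigZ q a ε 0 : ℂ) • m) (p : ℕ) : ‖ladderVec ρ ε m p‖ = 1 := by
  induction p with
  | zero => exact hm
  | succ p ih =>
    have hpos := coefSq_succ_pos (q := q) (a := a) ε p
    have h1 : ‖ρ (podY q a) (ladderVec ρ ε m p)‖ ^ 2 = coefSq q a ε (p + 1) := by
      have h := rep_inner_podX ρ (ladderVec ρ ε m p) (ρ (podY q a) (ladderVec ρ ε m p))
      rw [podX_podY_ladderVec hZ, inner_smul_right, inner_self_eq_norm_sq_to_K,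
        inner_self_eq_norm_sq_to_K, ih] at h
      simp only [Complex.coe_algebraMap, Complex.ofReal_one, one_pow, mul_one] at h
      exact_mod_cast h.symm
    have h2 : ‖ρ (podY q a) (ladderVec ρ ε m p)‖ = √(coefSq q a ε (p + 1)) := by
      rw [← h1, Real.sqrt_sq (norm_nonneg _)]
    rw [ladderVec, norm_smul, h2, norm_inv, Complex.norm_real,
      Real.norm_of_nonneg (Real.sqrt_nonneg _),
      inv_mul_cancel₀ (Real.sqrt_pos.2 hpos).ne']

/-- The vectors `Y^p m` are eigenvectors of `Z` for distinct eigenvalues, hence orthogonal; the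
relation for `XY` gives their norms. -/
theorem exists_isPiIsometry {ε : ℤˣ} {m : H} (hm : ‖m‖ = 1) (hX : ρ (podX q a) m = 0)
    (hZ : ρ (podZ q a) m = (eigZ q a ε 0 : ℂ) • m) :
    ∃ J : L2N →ₗᵢ[ℂ] H, J (basisVec 0) = m ∧ IsPiIsometry ρ ε J := by
  have hon : Orthonormal ℂ (ladderVec ρ ε m) :=
    ⟨norm_ladderVec hm hZ, fun i j hij => inner_eq_zero_of_podZ ((eigZ_injective ε).ne hij)
      (podZ_ladderVec hZ i) (podZ_ladderVec hZ j)⟩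
  have hJ : ∀ p, hon.orthogonalFamily.linearIsometry (basisVec p) = ladderVec ρ ε m p := by
    intro p
    rw [basisVec, OrthogonalFamily.linearIsometry_apply_single]
    simp
  refine ⟨hon.orthogonalFamily.linearIsometry, hJ 0, fun p => ?_⟩
  simp only [hJ]
  refine ⟨podZ_ladderVec hZ p, ?_, podY_ladderVec ε m p⟩
  cases p with
  -- Here `p - 1` truncates to `0`, harmlessly, since the coefficient vanishes.
  | zero => simpa [coefSq_zero, ladderVec] using hX
  | succ p => simpa using podX_ladderVec_succ hZ p

/-- The model `π_ε` is not constructed from its formulas: it is obtained by restricting `ρ` to the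
range of `J`. -/
theorem IsPiIsometry.exists_rep {ε : ℤˣ} {J : L2N →ₗᵢ[ℂ] H} (hJ : IsPiIsometry ρ ε J) :
    ∃ σ : PodlesRep q a L2N, IsPi ε σ ∧ ∀ f x, J (σ f x) = ρ f (J x) := by
  have hgen : ∀ f, (∀ p, ρ f (J (basisVec p)) ∈ LinearMap.range J.toLinearMap) →
      ∀ v ∈ LinearMap.range J.toLinearMap, ρ f v ∈ LinearMap.range J.toLinearMap := by
    intro f hf
    rintro v ⟨x, rfl⟩
    have hc : IsClosed ((LinearMap.range J.toLinearMap).comap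
        ((ρ f).comp J.toContinuousLinearMap).toLinearMap : Set L2N) :=
      (J.isometry.isClosedEmbedding.isClosed_range).preimage
        ((ρ f).comp J.toContinuousLinearMap).continuous
    have := eq_top_of_basisVec_mem hc hf
    exact (this ▸ Submodule.mem_top : x ∈ (LinearMap.range J.toLinearMap).comap
        ((ρ f).comp J.toContinuousLinearMap).toLinearMap)
  have hinv := rep_mem_of_generators ρ (S := LinearMap.range J.toLinearMap)
    (hgen _ fun p => by rw [(hJ p).2.1]; exact Submodule.smul_mem _ _ ⟨_, rfl⟩)
    (hgen _ fun p => by rw [(hJ p).2.2]; exact Submodule.smul_mem _ _ ⟨_, rfl⟩)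
    (hgen _ fun p => by rw [(hJ p).1]; exact Submodule.smul_mem _ _ ⟨_, rfl⟩)
  obtain ⟨σ, hσ⟩ := exists_compression ρ (J := J) fun f x => hinv f _ ⟨x, rfl⟩
  refine ⟨σ, fun p => ⟨?_, ?_, ?_⟩, hσ⟩ <;> apply J.injective <;> rw [hσ, map_smul]
  · exact (hJ p).1
  · exact (hJ p).2.1
  · rw [(hJ p).2.2, coefSq]
    ring_nf

end Spherical

/-! ### Vacuum spaces and the Wold-type decomposition -/

section Vacuum
variable {q : Param} {a : ℝ}
variable {H : Type*} [NormedAddCommGroup H] [InnerProductSpace ℂ H] [CompleteSpace H]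

/-- The vectors `v` with `X_t v = 0` in the lowest eigenspace of `π_±(Z_t)`. -/
def vacuum (ρ : PodlesRep q a H) (ε : ℤˣ) : Submodule ℂ H where
  carrier := {v | ρ (podX q a) v = 0 ∧ ρ (podZ q a) v = (eigZ q a ε 0 : ℂ) • v}
  zero_mem' := by simp
  add_mem' := by
    rintro v w ⟨h1, h2⟩ ⟨h3, h4⟩
    simp [h1, h2, h3, h4]
  smul_mem' := by
    rintro c v ⟨h1, h2⟩
    simp only [Set.mem_ofPred_eq, map_smul, h1, h2, smul_zero, true_and]
    rw [smul_comm]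

variable {ρ : PodlesRep q a H}

theorem mem_vacuum {ε : ℤˣ} {v : H} : v ∈ vacuum ρ ε ↔
    ρ (podX q a) v = 0 ∧ ρ (podZ q a) v = (eigZ q a ε 0 : ℂ) • v := Iff.rfl

theorem eigZ_one_add : eigZ q a 1 0 + eigZ q a (-1) 0 = -(qdiff q a * q) := by
  have h0 := q.2.1
  simp only [eigZ, qdiff, Real.rpow_add h0, Real.rpow_sub h0]
  simp [Real.rpow_neg h0.le]
  field_simp
  ring

theorem eigZ_one_mul : eigZ q a 1 0 * eigZ q a (-1) 0 = -(q : ℝ) ^ 2 := by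
  have h0 := q.2.1
  have := Real.rpow_pos_of_pos h0 a
  simp only [eigZ, Real.rpow_add h0, Real.rpow_sub h0]
  simp [Real.rpow_neg h0.le]
  field_simp

/-- On `ker X`, which `Z` preserves, `YX = 0` reads `Z² + tqZ - q² = 0`. By `eigZ_one_add` and
`eigZ_one_mul` its two distinct roots are the vacuum eigenvalues, so `ker X` splits into
eigenspaces. -/
theorem exists_vacuum_add {v : H} (hv : ρ (podX q a) v = 0) :
    ∃ v₁ ∈ vacuum ρ 1, ∃ v₂ ∈ vacuum ρ (-1), v = v₁ + v₂ := by
  have hq := qc_ne_zero q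
  set z₁ : ℂ := (eigZ q a 1 0 : ℂ) with hz₁
  set z₂ : ℂ := (eigZ q a (-1) 0 : ℂ) with hz₂
  have hne : z₁ - z₂ ≠ 0 := by
    rw [hz₁, hz₂, sub_ne_zero]
    exact_mod_cast (eigZ_ne_of_ne (by decide) 0 0)
  have hadd : z₁ + z₂ = -((qdiff q a : ℂ) * qc q) := by
    rw [hz₁, hz₂, qc]; exact_mod_cast eigZ_one_add
  have hmul : z₁ * z₂ = -qc q ^ 2 := by
    rw [hz₁, hz₂, qc]; exact_mod_cast eigZ_one_mul
  have hZZ : ρ (podZ q a) (ρ (podZ q a) v) = (z₁ + z₂) • ρ (podZ q a) v - (z₁ * z₂) • v := by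
    have h := rep_podY_podX ρ v
    rw [hv, map_zero] at h
    have h2 := congrArg (qc q ^ 2 • ·) h
    simp only [smul_zero, smul_sub, smul_smul] at h2
    rw [← mul_pow, mul_inv_cancel₀ hq, one_pow, one_smul] at h2
    have h3 : ρ (podZ q a) (ρ (podZ q a) v) = qc q ^ 2 • v -
      (qc q ^ 2 * ((qdiff q a : ℂ) * (qc q)⁻¹)) • ρ (podZ q a) v := (sub_eq_zero.1 h2.symm).symm
    rw [h3, hadd, hmul]
    match_scalars <;> field_simp
  have hXZ : ρ (podX q a) (ρ (podZ q a) v) = 0 := by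
    rw [rep_podX_podZ, hv, map_zero, smul_zero]
  refine ⟨(z₁ - z₂)⁻¹ • (ρ (podZ q a) v - z₂ • v), ?_,
    -(z₁ - z₂)⁻¹ • (ρ (podZ q a) v - z₁ • v), ?_, ?_⟩
  · rw [mem_vacuum]
    simp only [map_smul, map_sub, hXZ, hv, smul_zero, sub_zero, true_and, hZZ]
    module
  · rw [mem_vacuum]
    simp only [map_smul, map_sub, hXZ, hv, smul_zero, sub_zero, true_and, hZZ]
    module
  · match_scalars <;> field_simp <;> ring

/-- On the invariant complement of `R` the operator `X = Y*` is injective, so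
`eq_zero_of_mul_eq_smul_mul` with `c = q²` gives `Z = 0` there, against injectivity of `Z`. -/
theorem orthogonal_eq_bot {R : Submodule ℂ H} (hinv : ∀ f, ∀ v ∈ R, ρ f v ∈ R)
    (hker : ∀ v, ρ (podX q a) v = 0 → v ∈ R) (hZ : ∀ v, ρ (podZ q a) v = 0 → v = 0) : Rᗮ = ⊥ := by
  have hinv' : ∀ f, ∀ v ∈ Rᗮ, ρ f v ∈ Rᗮ := by
    intro f v hv
    rw [Submodule.mem_orthogonal] at hv ⊢
    intro u hu
    have := hv _ (hinv (star f) u hu)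
    rwa [map_star, ContinuousLinearMap.star_eq_adjoint,
      ContinuousLinearMap.adjoint_inner_left] at this
  obtain ⟨σ, hσ⟩ := exists_compression ρ (J := Rᗮ.subtypeₗᵢ) fun f x => ⟨⟨_, hinv' f x x.2⟩, rfl⟩
  have h0 : σ (podZ q a) = 0 := by
    refine eq_zero_of_mul_eq_smul_mul (Y := σ (podY q a)) (c := (q : ℝ) ^ 2) (by have := q.2.1; positivity)
      (by nlinarith [q.2.1, q.2.2]) (isSelfAdjoint_rep_podZ σ) ?_ ?_
    · ext1 x
      have := rep_podZ_podY σ x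
      rw [qc] at this
      push_cast
      exact this
    · intro v hv
      rw [star_rep_podY] at hv
      have h1 : ρ (podX q a) (v : H) = 0 := by
        have := hσ (podX q a) v
        rw [hv] at this
        simpa using this.symm
      have h2 : (v : H) ∈ R ⊓ Rᗮ := ⟨hker _ h1, v.2⟩
      rw [Submodule.inf_orthogonal_eq_bot] at h2
      exact Subtype.ext ((Submodule.mem_bot ℂ).1 h2)
  rw [Submodule.eq_bot_iff]
  intro v hv
  apply hZ
  have := hσ (podZ q a) ⟨v, hv⟩
  rw [h0] at this
  simpa using this.symm

theorem vacuum_ne_bot [Nontrivial H] (hZ : ∀ v, ρ (podZ q a) v = 0 → v = 0) {ε : ℤˣ}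
    (h : vacuum ρ (-ε) = ⊥) : vacuum ρ ε ≠ ⊥ := by
  intro h'
  have h1 : vacuum ρ 1 = ⊥ ∧ vacuum ρ (-1) = ⊥ := by
    rcases Int.units_eq_one_or ε with rfl | rfl
    · exact ⟨h', h⟩
    · exact ⟨by simpa using h, h'⟩
  have := orthogonal_eq_bot (ρ := ρ) (R := ⊥) (fun f v hv => by
    rw [Submodule.mem_bot] at hv ⊢; rw [hv, map_zero]) (fun v hv => by
      obtain ⟨v₁, h1', v₂, h2', rfl⟩ := exists_vacuum_add hv
      rw [h1.1] at h1'
      rw [h1.2] at h2'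
      exact Submodule.add_mem _ h1' h2') hZ
  rw [Submodule.bot_orthogonal_eq_top] at this
  exact top_ne_bot this

theorem exists_unit_mem_vacuum {ε : ℤˣ} (h : vacuum ρ ε ≠ ⊥) : ∃ m ∈ vacuum ρ ε, ‖m‖ = 1 := by
  obtain ⟨v, hv, hv0⟩ := (Submodule.ne_bot_iff _).1 h
  exact ⟨(‖v‖⁻¹ : ℂ) • v, Submodule.smul_mem _ _ hv, by
    rw [norm_smul]; simp [norm_ne_zero_iff.2 hv0]⟩

theorem surjective_of_orthogonal_range_eq_bot {K : Type*} [NormedAddCommGroup K]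
    [InnerProductSpace ℂ K] [CompleteSpace K] {J : K →ₗᵢ[ℂ] H}
    (h : (LinearMap.range J.toLinearMap)ᗮ = ⊥) : Function.Surjective J := by
  have h1 : IsClosed (LinearMap.range J.toLinearMap : Set H) := J.isometry.isClosedEmbedding.isClosed_range
  have h2 := Submodule.topologicalClosure_eq_top_iff.2 h
  rw [h1.submodule_topologicalClosure_eq] at h2
  exact LinearMap.range_eq_top.1 h2

theorem exists_uequiv_isPi [Nontrivial H] (hZ : ∀ v, ρ (podZ q a) v = 0 → v = 0) {ε : ℤˣ}
    (h : vacuum ρ (-ε) = ⊥)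
    (h1 : ∀ m ∈ vacuum ρ ε, m ≠ 0 → ∀ v ∈ vacuum ρ ε, ∃ c : ℂ, v = c • m) :
    ∃ σ : PodlesRep q a L2N, IsPi ε σ ∧ UEquiv ρ σ := by
  obtain ⟨m, hm, hm1⟩ := exists_unit_mem_vacuum (vacuum_ne_bot hZ h)
  obtain ⟨J, hJ0, hJ⟩ := exists_isPiIsometry hm1 hm.1 hm.2
  obtain ⟨σ, hσ, hσJ⟩ := hJ.exists_rep
  have hsurj : Function.Surjective J := by
    refine surjective_of_orthogonal_range_eq_bot (orthogonal_eq_bot (ρ := ρ) ?_ ?_ hZ)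
    · rintro f _ ⟨x, rfl⟩
      exact ⟨σ f x, hσJ f x⟩
    · intro v hv
      have hv' : v ∈ vacuum ρ ε := by
        obtain ⟨v₁, h1', v₂, h2', rfl⟩ := exists_vacuum_add hv
        rcases Int.units_eq_one_or ε with rfl | rfl
        · rw [h, Submodule.mem_bot] at h2'
          simpa [h2'] using h1'
        · rw [neg_neg] at h
          rw [h, Submodule.mem_bot] at h1'
          simpa [h1'] using h2'
      obtain ⟨c, rfl⟩ := h1 m hm (by rintro rfl; simp at hm1) v hv'
      exact ⟨c • basisVec 0, by simp [hJ0]⟩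
  refine ⟨σ, hσ, (LinearIsometryEquiv.ofSurjective J hsurj).symm, fun f v => ?_⟩
  rw [LinearIsometryEquiv.symm_apply_eq]
  change ρ f v = J (σ f _)
  rw [hσJ]
  congr 1
  exact ((LinearIsometryEquiv.ofSurjective J hsurj).apply_symm_apply v).symm

/-- `επ_ε(Z)` is diagonal with positive entries. This sign rules out a single summand in the
two-sided case. -/
theorem IsPi.inner_podZ_nonneg {ε : ℤˣ} {σ : PodlesRep q a L2N} (h : IsPi ε σ) (x : L2N) :
    0 ≤ ((ε : ℤ) : ℝ) * (⟪x, σ (podZ q a) x⟫_ℂ).re := by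
  have hc : ∀ p, (σ (podZ q a) x : ℕ → ℂ) p = (eigZ q a ε p : ℂ) * (x : ℕ → ℂ) p := by
    intro p
    have h1 := rep_inner_podZ σ (basisVec p) x
    rw [(h p).1, inner_smul_left, Complex.conj_ofReal, basisVec, lp.inner_single_left,
      lp.inner_single_left] at h1
    simpa [eigZ] using h1
  have hs := lp.hasSum_inner (𝕜 := ℂ) (G := fun _ : ℕ => ℂ) x (σ (podZ q a) x)
  have hs' := (Complex.hasSum_re hs).mul_left ((ε : ℤ) : ℝ)
  refine HasSum.nonneg (fun p => ?_) hs'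
  change 0 ≤ ((ε : ℤ) : ℝ) * (⟪(x : ℕ → ℂ) p, (σ (podZ q a) x : ℕ → ℂ) p⟫_ℂ).re
  rw [hc, RCLike.inner_apply]
  have : (eigZ q a ε p : ℂ) * (x : ℕ → ℂ) p * (starRingEnd ℂ) ((x : ℕ → ℂ) p) =
      ((eigZ q a ε p * ‖(x : ℕ → ℂ) p‖ ^ 2 : ℝ) : ℂ) := by
    rw [mul_assoc, Complex.mul_conj, Complex.normSq_eq_norm_sq]; push_cast; rfl
  rw [this, Complex.ofReal_re, ← mul_assoc]
  exact mul_nonneg (units_mul_eigZ_pos ε p).le (sq_nonneg _)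

theorem UEquiv.inner_podZ_nonneg {ε : ℤˣ} {σ : PodlesRep q a L2N} (h : IsPi ε σ) (hρ : UEquiv ρ σ)
    (v : H) : 0 ≤ ((ε : ℤ) : ℝ) * (⟪v, ρ (podZ q a) v⟫_ℂ).re := by
  obtain ⟨T, hT⟩ := hρ
  rw [← T.inner_map_map, hT]
  exact h.inner_podZ_nonneg _

/-- The two copies are orthogonal because `Z` has positive eigenvalues on one and negative ones on
the other; together they contain `ker X`. -/
theorem exists_uequivSum_isPi (hZ : ∀ v, ρ (podZ q a) v = 0 → v = 0)
    (h : ∀ ε, vacuum ρ ε ≠ ⊥)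
    (h1 : ∀ ε, ∀ m ∈ vacuum ρ ε, m ≠ 0 → ∀ v ∈ vacuum ρ ε, ∃ c : ℂ, v = c • m) :
    ∃ σ₁ σ₂ : PodlesRep q a L2N, IsPi 1 σ₁ ∧ IsPi (-1) σ₂ ∧ UEquivSum ρ σ₁ σ₂ := by
  obtain ⟨m₁, hm₁, hn₁⟩ := exists_unit_mem_vacuum (h 1)
  obtain ⟨J₁, hJ₁0, hJ₁⟩ := exists_isPiIsometry hn₁ hm₁.1 hm₁.2
  obtain ⟨σ₁, hσ₁, hσJ₁⟩ := hJ₁.exists_rep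
  obtain ⟨m₂, hm₂, hn₂⟩ := exists_unit_mem_vacuum (h (-1))
  obtain ⟨J₂, hJ₂0, hJ₂⟩ := exists_isPiIsometry hn₂ hm₂.1 hm₂.2
  obtain ⟨σ₂, hσ₂, hσJ₂⟩ := hJ₂.exists_rep
  have horth : ∀ x y, ⟪J₁ x, J₂ y⟫_ℂ = 0 := by
    have hb : ∀ m n, ⟪J₁ (basisVec m), J₂ (basisVec n)⟫_ℂ = 0 := fun m n =>
      inner_eq_zero_of_podZ (eigZ_ne_of_ne (by decide) m n) (hJ₁ m).1 (hJ₂ n).1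
    have h1 : ∀ n x, ⟪J₂ (basisVec n), J₁ x⟫_ℂ = 0 := by
      intro n x
      have := eq_top_of_basisVec_mem (S := (ℂ ∙ J₂ (basisVec n))ᗮ.comap J₁.toLinearMap)
        ((Submodule.isClosed_orthogonal _).preimage J₁.continuous)
        (fun m => Submodule.mem_orthogonal_singleton_iff_inner_right.2 (inner_eq_zero_symm.1 (hb m n)))
      exact Submodule.mem_orthogonal_singleton_iff_inner_right.1
        (this ▸ Submodule.mem_top : x ∈ (ℂ ∙ J₂ (basisVec n))ᗮ.comap J₁.toLinearMap)
    intro x y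
    have := eq_top_of_basisVec_mem (S := (ℂ ∙ J₁ x)ᗮ.comap J₂.toLinearMap)
        ((Submodule.isClosed_orthogonal _).preimage J₂.continuous)
        (fun m => Submodule.mem_orthogonal_singleton_iff_inner_right.2 (inner_eq_zero_symm.1 (h1 m x)))
    exact Submodule.mem_orthogonal_singleton_iff_inner_right.1
        (this ▸ Submodule.mem_top : y ∈ (ℂ ∙ J₁ x)ᗮ.comap J₂.toLinearMap)
  let J : WithLp 2 (L2N × L2N) →ₗᵢ[ℂ] H :=
    { toFun := fun x => J₁ x.fst + J₂ x.snd
      map_add' := fun x y => by simp only [WithLp.add_fst, WithLp.add_snd, map_add]; abel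
      map_smul' := fun c x => by simp [smul_add]
      norm_map' := fun x => by
        change ‖J₁ x.fst + J₂ x.snd‖ = ‖x‖
        refine (sq_eq_sq₀ (norm_nonneg _) (norm_nonneg _)).1 ?_
        rw [WithLp.prod_norm_sq_eq_of_L2, sq,
          norm_add_sq_eq_norm_sq_add_norm_sq_of_inner_eq_zero _ _ (horth _ _),
          J₁.norm_map, J₂.norm_map, sq, sq] }
  have hJ : ∀ x, J x = J₁ x.fst + J₂ x.snd := fun x => rfl
  have hint : ∀ f x, ρ f (J x) = J (WithLp.toLp 2 (σ₁ f x.fst, σ₂ f x.snd)) := by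
    intro f x
    rw [hJ, hJ, map_add, ← hσJ₁, ← hσJ₂]
    rfl
  have hsurj : Function.Surjective J := by
    refine surjective_of_orthogonal_range_eq_bot (orthogonal_eq_bot (ρ := ρ) ?_ ?_ hZ)
    · rintro f _ ⟨x, rfl⟩
      exact ⟨_, (hint f x).symm⟩
    · intro v hv
      obtain ⟨v₁, h1', v₂, h2', rfl⟩ := exists_vacuum_add hv
      obtain ⟨c₁, rfl⟩ := h1 _ m₁ hm₁ (by rintro rfl; simp at hn₁) v₁ h1'
      obtain ⟨c₂, rfl⟩ := h1 _ m₂ hm₂ (by rintro rfl; simp at hn₂) v₂ h2'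
      exact ⟨WithLp.toLp 2 (c₁ • basisVec 0, c₂ • basisVec 0), by
        change J _ = _
        simp [hJ, hJ₁0, hJ₂0]⟩
  refine ⟨σ₁, σ₂, hσ₁, hσ₂, (LinearIsometryEquiv.ofSurjective J hsurj).symm, fun f v => ?_⟩
  have h2 : (LinearIsometryEquiv.ofSurjective J hsurj).symm (ρ f v) = WithLp.toLp 2
      (σ₁ f ((LinearIsometryEquiv.ofSurjective J hsurj).symm v).fst,
        σ₂ f ((LinearIsometryEquiv.ofSurjective J hsurj).symm v).snd) := by
    rw [LinearIsometryEquiv.symm_apply_eq]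
    change _ = J _
    rw [← hint]
    congr 1
    exact ((LinearIsometryEquiv.ofSurjective J hsurj).apply_symm_apply v).symm
  rw [h2]
  exact ⟨rfl, rfl⟩

end Vacuum

/-! ### Coefficients at an extremal weight -/

section Numbers
variable (q : Param) (a : ℝ)

theorem eigZ_zero (ε : ℤˣ) : eigZ q a ε 0 = (ε : ℤ) * (q : ℝ) ^ (1 - (ε : ℤ) * a) := by
  rw [eigZ]; push_cast; ring_nf

/-- When `u₂ = 0`, eliminating `u₁` gives `-iYξ = gξ + q^(-c-1)Zξ`, and `g` is computed here. For
these `c` and `λ` the numerator of `diagZ` contains the factor `⟨c - 1⟩`, whence the simple value.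
-/
theorem diagY_sub_diagZ_lowest {ε : ℤˣ} {m c lam : ℝ} (hc : c = m - (ε : ℤ) * a)
    (hlam : lam = -(ε : ℤ) * qsum q (m - 1)) :
    diagY q a lam c - (q : ℝ) ^ (-c - 1) * diagZ q a lam c = -(ε : ℤ) * (q : ℝ) ^ (-m) := by
  have h0 := q.2.1
  have h1 := Real.rpow_pos_of_pos h0 a
  have h2 := Real.rpow_pos_of_pos h0 m
  have hs := qsum_pos q (c + 1)
  have hs' := qsum_pos q (c - 1)
  have hs1 := qsum_pos q 1
  have key : qsum q (c + 1) * diagZ q a lam c = -(ε : ℤ) * qdiff q m := by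
    rw [diagZ, mul_div_assoc', mul_div_mul_left _ _ hs.ne', div_eq_iff hs'.ne']
    subst hc hlam
    simp only [qsum, qdiff, neg_sub, Real.rpow_sub h0, Real.rpow_neg h0.le, Real.rpow_one]
    rcases Int.units_eq_one_or ε with rfl | rfl
    · simp
      field_simp
      ring
    · simp [Real.rpow_neg h0.le]
      field_simp
      ring
  have key2 : (q : ℝ) * qsum q 1 * (diagY q a lam c - (q : ℝ) ^ (-c - 1) * diagZ q a lam c) =
      q * lam - qsum q (c + 1) * diagZ q a lam c := by
    rw [diagY]
    field_simp
    have h3 := Real.rpow_pos_of_pos h0 c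
    simp only [qsum, qdiff, neg_add, Real.rpow_add h0, Real.rpow_sub h0, Real.rpow_neg h0.le,
      Real.rpow_one]
    field_simp
    ring
  have hne : (q : ℝ) * qsum q 1 ≠ 0 := by positivity
  refine mul_left_cancel₀ hne ?_
  rw [key2, key, hlam]
  simp only [qsum, qdiff, neg_sub, Real.rpow_sub h0, Real.rpow_neg h0.le, Real.rpow_one]
  field_simp
  ring

/-- The mirror case `u₁ = 0`, where the factor `⟨c + 1⟩` cancels. -/
theorem diagY_add_diagZ_highest {ε : ℤˣ} {m c lam : ℝ} (hc : c = (ε : ℤ) * a - m)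
    (hlam : lam = (ε : ℤ) * qsum q (m - 1)) :
    diagY q a lam c + (q : ℝ) ^ (c - 1) * diagZ q a lam c = (ε : ℤ) * (q : ℝ) ^ (-m) := by
  have h0 := q.2.1
  have h1 := Real.rpow_pos_of_pos h0 a
  have h2 := Real.rpow_pos_of_pos h0 m
  have hs := qsum_pos q (c + 1)
  have hs' := qsum_pos q (c - 1)
  have hs1 := qsum_pos q 1
  have key : qsum q (c - 1) * diagZ q a lam c = -(ε : ℤ) * qdiff q m := by
    rw [diagZ, mul_div_assoc', mul_comm (qsum q (c + 1)), mul_div_mul_left _ _ hs'.ne',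
      div_eq_iff hs.ne']
    subst hc hlam
    simp only [qsum, qdiff, neg_sub, neg_add, Real.rpow_add h0, Real.rpow_sub h0,
      Real.rpow_neg h0.le, Real.rpow_one]
    rcases Int.units_eq_one_or ε with rfl | rfl
    · simp
      field_simp
      ring
    · simp [Real.rpow_neg h0.le]
      field_simp
      ring
  have key2 : (q : ℝ) * qsum q 1 * (diagY q a lam c + (q : ℝ) ^ (c - 1) * diagZ q a lam c) =
      q * lam + qsum q (c - 1) * diagZ q a lam c := by
    rw [diagY]
    field_simp
    have h3 := Real.rpow_pos_of_pos h0 c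
    simp only [qsum, qdiff, neg_sub, Real.rpow_sub h0, Real.rpow_neg h0.le, Real.rpow_one]
    field_simp
    ring
  have hne : (q : ℝ) * qsum q 1 ≠ 0 := by positivity
  refine mul_left_cancel₀ hne ?_
  rw [key2, key, hlam]
  simp only [qsum, qdiff, neg_sub, Real.rpow_sub h0, Real.rpow_neg h0.le, Real.rpow_one]
  field_simp
  ring

end Numbers

/-! ### Representations with a lowest or highest weight -/

namespace UnitaryRep
open UniformSpace (Completion)
variable {q : Param} {a : ℝ} {V : Type*} [NormedAddCommGroup V] [InnerProductSpace ℂ V]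
  {π : UnitaryRep q a V}

theorem nontrivial_completion (hirr : π.IsIrreducible) : Nontrivial (Completion V) :=
  have := hirr.1
  (Completion.coe_injective V).nontrivial

theorem vacuum_eq_zero (hadm : π.IsAdmissible) (hirr : π.IsIrreducible) {lam : ℝ}
    (hcas : π.Casimir = (lam : ℂ) • 1) {ξ : V} (hξ0 : ξ ≠ 0) {c : ℝ}
    (hξ : π.iB ξ = (qnum q c : ℂ) • ξ) {ε : ℤˣ} {v : Completion V} (hv : v ∈ vacuum π.compl ε)
    (h : ⟪(ξ : Completion V), v⟫_ℂ = 0) : v = 0 := by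
  have := eq_bot_of_eigenvector_orthogonal hadm hirr hcas (N := ℂ ∙ v) ?_ ?_ hξ0 hξ ?_
  · exact Submodule.span_singleton_eq_bot.1 this
  · intro x hx
    obtain ⟨s, rfl⟩ := Submodule.mem_span_singleton.1 hx
    rw [map_smul, hv.1, smul_zero]
    exact Submodule.zero_mem _
  · intro x hx
    obtain ⟨s, rfl⟩ := Submodule.mem_span_singleton.1 hx
    rw [map_smul, hv.2]
    exact Submodule.smul_mem _ _ (Submodule.smul_mem _ _ (Submodule.mem_span_singleton_self v))
  · intro x hx
    obtain ⟨s, rfl⟩ := Submodule.mem_span_singleton.1 hx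
    rw [inner_smul_right, h, mul_zero]

/-- Pairing with `ξ` is a linear functional on the vacuum space, injective by `vacuum_eq_zero`. -/
theorem vacuum_unique (hadm : π.IsAdmissible) (hirr : π.IsIrreducible) {lam : ℝ}
    (hcas : π.Casimir = (lam : ℂ) • 1) {ξ : V} (hξ0 : ξ ≠ 0) {c : ℝ}
    (hξ : π.iB ξ = (qnum q c : ℂ) • ξ) (ε : ℤˣ) :
    ∀ m ∈ vacuum π.compl ε, m ≠ 0 → ∀ v ∈ vacuum π.compl ε, ∃ s : ℂ, v = s • m := by
  intro m hm hm0 v hv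
  have hne : ⟪(ξ : Completion V), m⟫_ℂ ≠ 0 := fun h => hm0 (vacuum_eq_zero hadm hirr hcas hξ0 hξ hm h)
  refine ⟨⟪(ξ : Completion V), v⟫_ℂ / ⟪(ξ : Completion V), m⟫_ℂ, sub_eq_zero.1 ?_⟩
  refine vacuum_eq_zero hadm hirr hcas hξ0 hξ (Submodule.sub_mem _ hv (Submodule.smul_mem _ _ hm)) ?_
  rw [inner_sub_right, inner_smul_right, div_mul_cancel₀ _ hne, sub_self]

theorem norm_podX_of_podZ_eq_zero {H : Type*} [NormedAddCommGroup H] [InnerProductSpace ℂ H]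
    [CompleteSpace H] {ρ : PodlesRep q a H} {v : H} (hv : ρ (podZ q a) v = 0) :
    ‖ρ (podX q a) v‖ = ‖v‖ := by
  have h := rep_inner_podY ρ v (ρ (podX q a) v)
  rw [rep_podY_podX, hv, map_zero, smul_zero, smul_zero, sub_zero, sub_zero] at h
  rw [@norm_eq_sqrt_re_inner ℂ _ _ _ _ v, h, ← @norm_eq_sqrt_re_inner ℂ]

theorem podZ_podX_eq_zero {H : Type*} [NormedAddCommGroup H] [InnerProductSpace ℂ H]
    [CompleteSpace H] {ρ : PodlesRep q a H} {v : H} (hv : ρ (podZ q a) v = 0) :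
    ρ (podZ q a) (ρ (podX q a) v) = 0 := by
  rw [rep_podZ_podX, hv, map_zero, smul_zero]

theorem podZ_podY_eq_zero {H : Type*} [NormedAddCommGroup H] [InnerProductSpace ℂ H]
    [CompleteSpace H] {ρ : PodlesRep q a H} {v : H} (hv : ρ (podZ q a) v = 0) :
    ρ (podZ q a) (ρ (podY q a) v) = 0 := by
  rw [rep_podZ_podY, hv, map_zero, smul_zero]

/-- By `hY`, `⟪ξ, Xv⟫ = -i(g⟪ξ, v⟫ + η⟪ξ, Zv⟫)`. On `ker Z`, where `X` acts isometrically, iteration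
multiplies `⟪ξ, v⟫` by `-ig` each time; as `|g| > 1` it must vanish, and so does `ker Z`. On the
vacuum of sign `-ε` the left side is zero while `g + ηz ≠ 0`, since `hz` singles out the other root;
that vacuum vanishes too. -/
theorem exists_uequiv_of_extremal (hadm : π.IsAdmissible) (hirr : π.IsIrreducible) {lam : ℝ}
    (hcas : π.Casimir = (lam : ℂ) • 1) {ξ : V} (hξ0 : ξ ≠ 0) {c : ℝ}
    (hξ : π.iB ξ = (qnum q c : ℂ) • ξ) {g η : ℝ}
    (hY : π.sph (podY q a) ξ = Complex.I • ((g : ℂ) • ξ + (η : ℂ) • π.sph (podZ q a) ξ))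
    (hg : 1 < |g|) {ε : ℤˣ} (hz : g + η * eigZ q a ε 0 = 0) :
    ∃ σ : PodlesRep q a L2N, IsPi ε σ ∧ UEquiv π.compl σ := by
  have hinner : ∀ v, ⟪(ξ : Completion V), π.compl (podX q a) v⟫_ℂ =
      -Complex.I * (g * ⟪(ξ : Completion V), v⟫_ℂ +
        η * ⟪(ξ : Completion V), π.compl (podZ q a) v⟫_ℂ) := by
    intro v
    rw [← compl_inner_podX, compl_coe, hY, Completion.coe_smul, Completion.coe_add,
      Completion.coe_smul, Completion.coe_smul, inner_smul_left, inner_add_left, inner_smul_left,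
      inner_smul_left, ← compl_coe, compl_inner_podZ]
    simp
  have hker : ∀ v, π.compl (podZ q a) v = 0 → v = 0 := by
    have hb : ∀ n : ℕ, ∀ v, π.compl (podZ q a) v = 0 →
        |g| ^ n * ‖⟪(ξ : Completion V), v⟫_ℂ‖ ≤ ‖(ξ : Completion V)‖ * ‖v‖ := by
      intro n
      induction n with
      | zero => intro v _; simpa using norm_inner_le_norm (𝕜 := ℂ) (ξ : Completion V) v
      | succ n ih =>
        intro v hv
        have h := ih _ (podZ_podX_eq_zero hv)
        rw [norm_podX_of_podZ_eq_zero hv, hinner, hv, inner_zero_right, mul_zero, add_zero,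
          norm_mul, norm_mul, norm_neg, Complex.norm_I, one_mul, Complex.norm_real,
          Real.norm_eq_abs, ← mul_assoc] at h
        rwa [pow_succ]
    have hN := eq_bot_of_eigenvector_orthogonal hadm hirr hcas
      (N := LinearMap.ker (π.compl (podZ q a)).toLinearMap)
      (fun x hx => podZ_podX_eq_zero hx) (fun x hx => by
        have : π.compl (podZ q a) x = 0 := hx
        rw [this]; exact Submodule.zero_mem _) hξ0 hξ (fun x hx => by
          by_contra hne
          have hpos := norm_pos_iff.2 hne
          obtain ⟨n, hn⟩ := pow_unbounded_of_one_lt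
            (‖(ξ : Completion V)‖ * ‖x‖ / ‖⟪(ξ : Completion V), x⟫_ℂ‖) hg
          rw [div_lt_iff₀ hpos] at hn
          exact absurd (hb n x hx) (not_le.2 hn))
    intro v hv
    exact (Submodule.eq_bot_iff _).1 hN v hv
  have hg0 : g ≠ 0 := by rintro rfl; norm_num at hg
  have hη : η ≠ 0 := by rintro rfl; exact hg0 (by simpa using hz)
  have hvac : vacuum π.compl (-ε) = ⊥ := by
    rw [Submodule.eq_bot_iff]
    intro v hv
    refine vacuum_eq_zero hadm hirr hcas hξ0 hξ hv ?_
    have h := hinner v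
    rw [hv.1, hv.2, inner_zero_right, inner_smul_right, ← mul_assoc, ← add_mul] at h
    have hne : ((g : ℂ) + η * (eigZ q a (-ε) 0 : ℂ)) ≠ 0 := by
      norm_cast
      intro h'
      have h2 : η * (eigZ q a (-ε) 0 - eigZ q a ε 0) = 0 := by linear_combination h' - hz
      rcases mul_eq_zero.1 h2 with h3 | h3
      · exact hη h3
      · exact eigZ_ne_of_ne (by rcases Int.units_eq_one_or ε with rfl | rfl <;> decide) 0 0 (sub_eq_zero.1 h3)
    have h3 := (mul_eq_zero.1 h.symm).resolve_left (neg_ne_zero.2 Complex.I_ne_zero)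
    exact (mul_eq_zero.1 h3).resolve_left hne
  have := nontrivial_completion hirr
  exact exists_uequiv_isPi hker hvac (vacuum_unique hadm hirr hcas hξ0 hξ ε)

theorem abs_units_mul_rpow_neg {m : ℝ} (hm : 0 < m) (ε : ℤˣ) :
    1 < |((ε : ℤ) : ℝ) * (q : ℝ) ^ (-m)| := by
  have h : 1 < (q : ℝ) ^ (-m) := Real.one_lt_rpow_of_pos_of_lt_one_of_neg q.2.1 q.2.2 (by linarith)
  rcases Int.units_eq_one_or ε with rfl | rfl
  · simpa [abs_of_pos (zero_lt_one.trans h)] using h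
  · simpa [abs_of_pos (zero_lt_one.trans h)] using h

theorem exists_uequiv_of_lowest (hadm : π.IsAdmissible) (hirr : π.IsIrreducible) {ε : ℤˣ}
    {m c lam : ℝ} (hm : 0 < m) (hc : c = m - (ε : ℤ) * a) (hlam : lam = -(ε : ℤ) * qsum q (m - 1))
    (hcas : π.Casimir = (lam : ℂ) • 1) {ξ : V} (hξ0 : ξ ≠ 0)
    (hξ : π.iB ξ = (qnum q c : ℂ) • ξ)
    (hlow : ∀ u, π.iB u = (qnum q (c - 2) : ℂ) • u → u = 0) :
    ∃ σ : PodlesRep q a L2N, IsPi ε σ ∧ UEquiv π.compl σ := by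
  obtain ⟨u₁, u₂, h1, h2, h3, h4, h5⟩ := π.exists_ladder hcas hξ
  obtain rfl := hlow u₂ h2
  have hg := diagY_sub_diagZ_lowest q a hc hlam
  refine exists_uequiv_of_extremal hadm hirr hcas hξ0 hξ (g := -(ε : ℤ) * (q : ℝ) ^ (-m))
    (η := (q : ℝ) ^ (-c - 1)) ?_ ?_ ?_
  · rw [h4, ← hg, h3]
    push_cast
    module
  · rw [neg_mul, abs_neg]
    exact abs_units_mul_rpow_neg hm ε
  · rw [eigZ_zero, mul_left_comm, ← Real.rpow_add q.2.1, hc]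
    ring_nf

theorem exists_uequiv_of_highest (hadm : π.IsAdmissible) (hirr : π.IsIrreducible) {ε : ℤˣ}
    {m c lam : ℝ} (hm : 0 < m) (hc : c = (ε : ℤ) * a - m) (hlam : lam = (ε : ℤ) * qsum q (m - 1))
    (hcas : π.Casimir = (lam : ℂ) • 1) {ξ : V} (hξ0 : ξ ≠ 0)
    (hξ : π.iB ξ = (qnum q c : ℂ) • ξ)
    (hhigh : ∀ u, π.iB u = (qnum q (c + 2) : ℂ) • u → u = 0) :
    ∃ σ : PodlesRep q a L2N, IsPi ε σ ∧ UEquiv π.compl σ := by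
  obtain ⟨u₁, u₂, h1, h2, h3, h4, h5⟩ := π.exists_ladder hcas hξ
  obtain rfl := hhigh u₁ h1
  have hg := diagY_add_diagZ_highest q a hc hlam
  refine exists_uequiv_of_extremal hadm hirr hcas hξ0 hξ (g := (ε : ℤ) * (q : ℝ) ^ (-m))
    (η := -(q : ℝ) ^ (c - 1)) ?_ ?_ ?_
  · rw [h4, ← hg, h3]
    push_cast
    module
  · exact abs_units_mul_rpow_neg hm ε
  · rw [eigZ_zero, neg_mul, mul_left_comm, ← Real.rpow_add q.2.1, hc]
    ring_nf

end UnitaryRep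

/-! ### Characters, and injectivity of `Z_t` for small Casimir value -/

namespace UnitaryRep
open UniformSpace (Completion)
variable {q : Param} {a : ℝ} {V : Type*} [NormedAddCommGroup V] [InnerProductSpace ℂ V]
  {π : UnitaryRep q a V}

/-- With a single weight both ladder vectors vanish, so `X`, `Y`, `Z` and `iB_t` are scalars; every
line is invariant and `V` is one. -/
theorem exists_scalar_character (hadm : π.IsAdmissible) (hirr : π.IsIrreducible) {lam c y : ℝ}
    (hcas : π.Casimir = (lam : ℂ) • 1) (hd : diagZ q a lam c = 0) (hy : diagY q a lam c = y)
    (hspec : ∀ μ : ℂ, π.iB.HasEigenvalue μ → μ = qnum q c) :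
    ∃ χ : PodlesRep q a ℂ, IsChar (-Complex.I * y) χ ∧ UEquiv π.compl χ := by
  have hiB : ∀ u, π.iB u = (qnum q c : ℂ) • u := by
    intro u
    have hle : ⨆ n : ℤ, Module.End.eigenspace π.iB (qnum q (a + n) : ℂ) ≤
        Module.End.eigenspace π.iB (qnum q c : ℂ) := by
      refine iSup_le fun n => ?_
      by_cases h : Module.End.eigenspace π.iB (qnum q (a + n) : ℂ) = ⊥
      · rw [h]; exact bot_le
      · rw [hspec _ h]
    rw [hadm] at hle
    exact Module.End.mem_eigenspace_iff.1 (hle Submodule.mem_top)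
  have hzero : ∀ {u : V} {x : ℝ}, x ≠ c → π.iB u = (qnum q x : ℂ) • u → u = 0 := by
    intro u x hx hu
    exact inner_self_eq_zero.1 (inner_eq_zero_of_eigenvector hx hu (hiB u))
  have hact : ∀ u, π.sph (podZ q a) u = 0 ∧ π.sph (podX q a) u = (-Complex.I * y) • u ∧
      π.sph (podY q a) u = (Complex.I * y) • u := by
    intro u
    obtain ⟨u₁, u₂, h1, h2, h3, h4, h5⟩ := π.exists_ladder hcas (hiB u)
    obtain rfl := hzero (by linarith) h1
    obtain rfl := hzero (by linarith) h2
    rw [h3, h4, h5, hd, hy]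
    refine ⟨by simp, by module, by module⟩
  have := hirr.1
  obtain ⟨u, hu⟩ := exists_ne (0 : V)
  set ξ : V := (‖u‖⁻¹ : ℂ) • u with hξ
  have hξ1 : ‖ξ‖ = 1 := by rw [hξ, norm_smul]; simp [norm_ne_zero_iff.2 hu]
  have hξ0 : ξ ≠ 0 := by intro h; rw [h] at hξ1; simp at hξ1
  have hsph : ∀ f, ∀ w ∈ (ℂ ∙ ξ), π.sph f w ∈ (ℂ ∙ ξ) := by
    intro f
    let S : Subalgebra ℂ (Podles q a) :=
      { carrier := {f | ∀ w ∈ (ℂ ∙ ξ), π.sph f w ∈ (ℂ ∙ ξ)}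
        mul_mem' := fun {f g} hf hg w hw => by
          rw [map_mul, Module.End.mul_apply]; exact hf _ (hg _ hw)
        add_mem' := fun {f g} hf hg w hw => by
          rw [map_add, LinearMap.add_apply]; exact Submodule.add_mem _ (hf _ hw) (hg _ hw)
        algebraMap_mem' := fun r w hw => by
          rw [AlgHom.commutes, Module.algebraMap_end_apply]; exact Submodule.smul_mem _ _ hw }
    refine podles_induction S (fun w hw => ?_) (fun w hw => ?_) (fun w hw => ?_) f
    · rw [(hact w).2.1]; exact Submodule.smul_mem _ _ hw
    · rw [(hact w).2.2]; exact Submodule.smul_mem _ _ hw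
    · rw [(hact w).1]; exact Submodule.zero_mem _
  have htop : (ℂ ∙ ξ) = ⊤ := by
    refine (hirr.2 (ℂ ∙ ξ) (Submodule.closed_of_finiteDimensional _) hsph fun w hw => ?_).resolve_left ?_
    · rw [hiB]; exact Submodule.smul_mem _ _ hw
    · rwa [Submodule.span_singleton_eq_bot]
  let J : ℂ →ₗᵢ[ℂ] Completion V := LinearIsometry.toSpanSingleton ℂ (Completion V)
    (v := (ξ : Completion V)) (by rw [Completion.norm_coe, hξ1])
  have hJ : ∀ s, J s = s • (ξ : Completion V) := fun s => rfl
  have hsurj : Function.Surjective J := by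
    refine surjective_of_orthogonal_range_eq_bot ?_
    rw [Submodule.eq_bot_iff]
    intro x hx
    have : ∀ v : Completion V, ⟪v, x⟫_ℂ = 0 := by
      intro v
      induction v using Completion.induction_on with
      | hp => exact isClosed_eq (by fun_prop) continuous_const
      | ih w =>
        obtain ⟨s, rfl⟩ := Submodule.mem_span_singleton.1 (htop ▸ Submodule.mem_top : w ∈ (ℂ ∙ ξ))
        exact (Submodule.mem_orthogonal _ _).1 hx _ ⟨s, by
          rw [Completion.coe_smul]; rfl⟩
    exact inner_self_eq_zero.1 (this x)
  obtain ⟨χ, hχ⟩ := exists_compression π.compl (J := J) fun f x => hsurj _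
  refine ⟨χ, ⟨?_, ?_, ?_⟩, (LinearIsometryEquiv.ofSurjective J hsurj).symm, fun f v => ?_⟩
  · ext1
    apply J.injective
    rw [hχ, hJ, one_smul, compl_coe, (hact ξ).1]
    simp
  · ext1
    apply J.injective
    rw [hχ, hJ, one_smul, compl_coe, (hact ξ).2.1, Completion.coe_smul, hJ]
    simp
  · ext1
    apply J.injective
    rw [hχ, hJ, one_smul, compl_coe, (hact ξ).2.2, Completion.coe_smul, hJ]
    simp
  · rw [LinearIsometryEquiv.symm_apply_eq]
    change _ = J (χ f _)
    rw [hχ]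
    congr 1
    exact ((LinearIsometryEquiv.ofSurjective J hsurj).apply_symm_apply v).symm

/-- On `ker Z` the Casimir relation and its adjoint force `X + Y = 0`, hence `λv = i(q + q⁻¹)Xv`.
There `X` is isometric, so a nonzero `v` would give `|λ| = ⟨1⟩`. -/
theorem podZ_injective_of_abs_lt {lam : ℝ} (hcas : π.Casimir = (lam : ℂ) • 1)
    (hlam : |lam| < qsum q 1) (v : Completion V) (hv : π.compl (podZ q a) v = 0) : v = 0 := by
  have hq := qc_ne_zero q
  have hrel : ∀ v, π.compl (podZ q a) v = 0 → (lam : ℂ) • v =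
      (Complex.I * qc q) • π.compl (podX q a) v - (Complex.I * (qc q)⁻¹) • π.compl (podY q a) v := by
    intro v hv
    -- The term with `iB_t` makes sense only on `V`, so the Casimir is moved to a test vector there;
    -- it then disappears against `Zv = 0`.
    refine ext_inner_left ℂ fun x => ?_
    induction x using Completion.induction_on with
    | hp => exact isClosed_eq (by fun_prop) (by fun_prop)
    | ih u =>
      have h1 : ((lam : ℂ) • (u : Completion V)) = (Complex.I * (qc q)⁻¹) • π.compl (podX q a) u +
          (qc q - (qc q)⁻¹) • π.compl (podZ q a) (π.iB u : V) -
          (Complex.I * qc q) • π.compl (podY q a) u := by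
        have := LinearMap.congr_fun hcas u
        simp only [Casimir, Module.End.mul_apply, LinearMap.sub_apply, LinearMap.smul_apply,
          LinearMap.add_apply, Module.End.one_apply] at this
        rw [← Completion.coe_smul, ← this, Completion.coe_sub, Completion.coe_add,
          Completion.coe_smul, Completion.coe_smul, Completion.coe_smul, compl_coe, compl_coe,
            compl_coe]
      have h2 : ⟪(u : Completion V), (lam : ℂ) • v⟫_ℂ = ⟪(lam : ℂ) • (u : Completion V), v⟫_ℂ := by
        rw [inner_smul_left, inner_smul_right, Complex.conj_ofReal]
      rw [h2, h1, inner_sub_left, inner_add_left, inner_smul_left, inner_smul_left, inner_smul_left,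
        ← rep_inner_podZ, hv, inner_zero_right, ← rep_inner_podY, ← rep_inner_podX, inner_sub_right,
        inner_smul_right, inner_smul_right]
      simp only [map_mul, map_inv₀, star_qc, Complex.conj_I]
      ring
  have hXY : ∀ v, π.compl (podZ q a) v = 0 → π.compl (podX q a) v + π.compl (podY q a) v = 0 := by
    intro v hv
    set x := π.compl (podX q a) v + π.compl (podY q a) v with hx
    have hx0 : π.compl (podZ q a) x = 0 := by
      rw [hx, map_add, podZ_podX_eq_zero hv, podZ_podY_eq_zero hv, add_zero]
    have h2 : ⟪x, (lam : ℂ) • v⟫_ℂ = ⟪(lam : ℂ) • x, v⟫_ℂ := by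
      rw [inner_smul_left, inner_smul_right, Complex.conj_ofReal]
    rw [hrel v hv, hrel x hx0, inner_sub_left, inner_sub_right, inner_smul_left, inner_smul_left,
      inner_smul_right, inner_smul_right, ← rep_inner_podX, ← rep_inner_podY] at h2
    simp only [map_mul, map_inv₀, star_qc, Complex.conj_I] at h2
    -- As `λ` is real, `iqX - iq⁻¹Y` is symmetric on `ker Z`; its difference from its adjoint is
    -- `i(q - q⁻¹)(X + Y)`.
    have h3 : (Complex.I * (qc q - (qc q)⁻¹)) * ⟪x, x⟫_ℂ = 0 := by
      conv_lhs => rw [hx, inner_add_right, ← hx]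
      linear_combination h2
    exact inner_self_eq_zero.1 ((mul_eq_zero.1 h3).resolve_left
      (mul_ne_zero Complex.I_ne_zero (qc_sub_inv_ne_zero q)))
  have h1 : (lam : ℂ) • v = (Complex.I * (qsum q 1 : ℂ)) • π.compl (podX q a) v := by
    rw [hrel v hv, eq_neg_of_add_eq_zero_right (hXY v hv), qsum, Real.rpow_one, Real.rpow_neg_one,
      qc]
    push_cast
    module
  have h2 := congrArg norm h1
  rw [norm_smul, norm_smul, norm_podX_of_podZ_eq_zero hv, Complex.norm_real, norm_mul,
    Complex.norm_I,
    one_mul, Complex.norm_real, Real.norm_eq_abs, Real.norm_of_nonneg (qsum_pos q 1).le] at h2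
  by_contra hne
  exact hlam.ne (mul_right_cancel₀ (norm_ne_zero_iff.2 hne) h2)

end UnitaryRep

/-! ### Indefiniteness of `Z_t` on a two-sided ladder -/

section Asymptotics
variable (q : Param)

theorem exists_rpow_lt (c : ℝ) {δ : ℝ} (hδ : 0 < δ) : ∃ k : ℕ, (q : ℝ) ^ (c + 2 * k) < δ := by
  have h0 := q.2.1
  have hc := Real.rpow_pos_of_pos h0 c
  obtain ⟨n, hn⟩ := exists_pow_lt_of_lt_one (div_pos hδ hc) (show (q : ℝ) ^ 2 < 1 by nlinarith [q.2.2])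
  refine ⟨n, ?_⟩
  rw [lt_div_iff₀ hc] at hn
  have : (q : ℝ) ^ (c + 2 * n) = ((q : ℝ) ^ 2) ^ n * (q : ℝ) ^ c := by
    rw [Real.rpow_add h0, mul_comm, ← pow_mul, ← Real.rpow_natCast]
    push_cast
    rfl
  rwa [this]

theorem exists_qdiff_lt (c M : ℝ) : ∃ k : ℕ, qdiff q (c + 2 * k) < -M := by
  obtain ⟨k, hk⟩ := exists_rpow_lt q c (δ := (|M| + 2)⁻¹) (by positivity)
  refine ⟨k, ?_⟩
  have hw := Real.rpow_pos_of_pos q.2.1 (c + 2 * k)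
  have h1 : |M| + 2 < ((q : ℝ) ^ (c + 2 * k))⁻¹ := by
    rwa [lt_inv_comm₀ (by positivity) hw]
  have h2 : (|M| + 2)⁻¹ ≤ 1 := inv_le_one_of_one_le₀ (by linarith [abs_nonneg M])
  rw [qdiff, Real.rpow_neg q.2.1.le]
  linarith [le_abs_self M]

theorem exists_mul_qdiff_lt (c M : ℝ) {s : ℝ} (hs : s ≠ 0) : ∃ k : ℤ,
  s * qdiff q (c + 2 * k) < M := by
  rcases lt_or_gt_of_ne hs with h | h
  · obtain ⟨k, hk⟩ := exists_qdiff_lt q (-c) (M / s)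
    refine ⟨-k, ?_⟩
    have : qdiff q (c + 2 * (-k : ℤ)) = -qdiff q (-c + 2 * k) := by
      rw [← qdiff_neg]; congr 1; push_cast; ring
    rw [this]
    have h2 : M / s < -qdiff q (-c + 2 * k) := by linarith
    rw [div_lt_iff_of_neg h] at h2
    linarith
  · obtain ⟨k, hk⟩ := exists_qdiff_lt q c (-M / s)
    refine ⟨k, ?_⟩
    have h2 : qdiff q (c + 2 * k) < M / s := by rw [neg_div, neg_neg] at hk; exact hk
    rw [lt_div_iff₀ h] at h2
    push_cast
    linarith

/-- For `λ = 0` the numerator does not depend on `c`, while the denominator is at least `q^(-2c)`.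
-/
theorem abs_diagZ_zero_le (a c : ℝ) :
    |diagZ q a 0 c| ≤ |qsum q 1 * qdiff q a| * ((q : ℝ) ^ c) ^ 2 := by
  have h0 := q.2.1
  have hc := Real.rpow_pos_of_pos h0 c
  have h1 : ((q : ℝ) ^ c)⁻¹ * (q : ℝ)⁻¹ ≤ qsum q (c + 1) := by
    rw [qsum, neg_add, Real.rpow_add h0 (-c), Real.rpow_neg h0.le, Real.rpow_neg_one]
    linarith [Real.rpow_pos_of_pos h0 (c + 1)]
  have h2 : ((q : ℝ) ^ c)⁻¹ * (q : ℝ) ≤ qsum q (c - 1) := by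
    rw [qsum, neg_sub, sub_eq_neg_add 1 c, Real.rpow_add h0 (-c), Real.rpow_neg h0.le,
      Real.rpow_one]
    linarith [Real.rpow_pos_of_pos h0 (c - 1)]
  have h3 : (((q : ℝ) ^ c) ^ 2)⁻¹ ≤ qsum q (c + 1) * qsum q (c - 1) := by
    calc (((q : ℝ) ^ c) ^ 2)⁻¹ = (((q : ℝ) ^ c)⁻¹ * (q : ℝ)⁻¹) * (((q : ℝ) ^ c)⁻¹ * (q : ℝ)) := by
          field_simp
      _ ≤ _ := mul_le_mul h1 h2 (by positivity) (qsum_pos q _).le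
  have hpos := mul_pos (qsum_pos q (c + 1)) (qsum_pos q (c - 1))
  rw [diagZ, mul_zero, zero_sub, abs_div, abs_neg, abs_of_pos hpos, div_eq_mul_inv]
  refine mul_le_mul_of_nonneg_left ?_ (abs_nonneg _)
  exact inv_le_of_inv_le₀ (by positivity) h3

end Asymptotics

namespace UnitaryRep
open UniformSpace (Completion)
variable {q : Param} {a : ℝ} {V : Type*} [NormedAddCommGroup V] [InnerProductSpace ℂ V]
  {π : UnitaryRep q a V}

theorem re_inner_podZ_eigenvector {lam c : ℝ} (hcas : π.Casimir = (lam : ℂ) • 1) {u : V}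
    (hu : π.iB u = (qnum q c : ℂ) • u) :
    (⟪u, π.sph (podZ q a) u⟫_ℂ).re = diagZ q a lam c * ‖u‖ ^ 2 := by
  obtain ⟨u₁, u₂, h1, h2, h3, -, -⟩ := π.exists_ladder hcas hu
  rw [h3, inner_add_right, inner_add_right, inner_smul_right,
    inner_eq_zero_of_eigenvector (by linarith) hu h1,
    inner_eq_zero_of_eigenvector (by linarith) hu h2, inner_self_eq_norm_sq_to_K]
  simp [← Complex.ofReal_pow]

/-- Cauchy–Schwarz for the semidefinite form of `sZ`, via the discriminant along `w + xu`. It bounds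
a ladder vector `w` of `Zu` by diagonal coefficients. -/
theorem norm_sq_le_of_semidefinite {s d d' : ℝ} (hs : |s| = 1)
    (hpos : ∀ v : V, 0 ≤ s * (⟪v, π.sph (podZ q a) v⟫_ℂ).re) {u w : V}
    (hd : (⟪u, π.sph (podZ q a) u⟫_ℂ).re = d)
    (hd' : (⟪w, π.sph (podZ q a) w⟫_ℂ).re = d' * ‖w‖ ^ 2)
    (hw : (⟪w, π.sph (podZ q a) u⟫_ℂ).re = ‖w‖ ^ 2) : ‖w‖ ^ 2 ≤ |d| * |d'| := by
  have hs2 : s * s = 1 := by rw [← abs_mul_abs_self, hs, one_mul]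
  have hw' : (⟪u, π.sph (podZ q a) w⟫_ℂ).re = ‖w‖ ^ 2 := by
    rw [π.inner_podZ, ← inner_conj_symm, Complex.conj_re, hw]
  have hquad : ∀ x : ℝ, 0 ≤ (s * d) * (x * x) + (2 * s * ‖w‖ ^ 2) * x + s * d' * ‖w‖ ^ 2 := by
    intro x
    have h := hpos (w + (x : ℂ) • u)
    simp only [map_add, map_smul, inner_add_left, inner_add_right, inner_smul_left,
      inner_smul_right, Complex.conj_ofReal, Complex.add_re, Complex.re_ofReal_mul, hd, hd', hw,
        hw'] at h
    linarith
  have hdisc := discrim_le_zero hquad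
  rw [discrim] at hdisc
  have h1 : ‖w‖ ^ 2 * ‖w‖ ^ 2 ≤ (d * d') * ‖w‖ ^ 2 := by nlinarith
  by_cases h0 : ‖w‖ ^ 2 = 0
  · rw [h0]; positivity
  · have h2 : 0 < ‖w‖ ^ 2 := lt_of_le_of_ne (sq_nonneg _) (Ne.symm h0)
    rw [← abs_mul]
    exact (le_of_mul_le_mul_right h1 h2).trans (le_abs_self _)

/-- Let `w = q^c` be small and `u` a unit vector of weight `c`. The diagonal coefficients are
`O(w²)`, so semidefiniteness makes `u₁`, `u₂` and `Zu` of order `w²`. Although `u₁` enters `Yu` with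
a factor of order `w⁻¹`, still `Yu = O(w)`, contradicting the identity for `‖Yu‖²`, which tends to
`‖u‖² = 1`. -/
theorem not_semidefinite_of_casimir_eq_zero {c₀ s : ℝ} (hcas : π.Casimir = ((0 : ℝ) : ℂ) • 1)
    (hev : ∀ k : ℤ, ∃ u, u ≠ 0 ∧ π.iB u = (qnum q (c₀ + 2 * k) : ℂ) • u) (hs : |s| = 1)
    (hpos : ∀ v : V, 0 ≤ s * (⟪v, π.sph (podZ q a) v⟫_ℂ).re) : False := by
  have h0 := q.2.1
  have h1 := q.2.2
  have hev1 : ∀ k : ℤ, ∃ u, ‖u‖ = 1 ∧ π.iB u = (qnum q (c₀ + 2 * k) : ℂ) • u := by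
    intro k
    obtain ⟨u, hu, huk⟩ := hev k
    exact ⟨(‖u‖⁻¹ : ℂ) • u, by rw [norm_smul]; simp [norm_ne_zero_iff.2 hu],
      by rw [map_smul, huk, smul_comm]⟩
  set κ := |qsum q 1 * qdiff q a| with hκ
  -- The summands are the coefficients of `w²` in the bounds for `‖Yu‖²`, for the term with `t`, and
  -- for `q²‖Zu‖²`. The choice of `k` makes `Cw² < 1`.
  set C := (3 * κ * (q : ℝ)⁻¹ ^ 3) ^ 2 + |qdiff q a| * κ + (3 * κ * (q : ℝ)⁻¹ ^ 3) ^ 2 with hC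
  obtain ⟨k, hk⟩ := exists_rpow_lt q c₀ (δ := (C + 1)⁻¹) (by positivity)
  obtain ⟨u, hu1, hu⟩ := hev1 k
  push_cast at hu
  set c := c₀ + 2 * (k : ℝ) with hc
  set w := (q : ℝ) ^ c with hw
  have hw0 : 0 < w := Real.rpow_pos_of_pos h0 c
  have hC0 : 0 ≤ C := by positivity
  have hCw : (C + 1) * w < 1 := by
    have := mul_lt_mul_of_pos_left hk (show 0 < C + 1 by positivity)
    rwa [mul_inv_cancel₀ (by positivity)] at this
  have hw1 : w ≤ 1 := by nlinarith
  set r := (q : ℝ)⁻¹ with hr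
  have hqr : (q : ℝ) * r = 1 := mul_inv_cancel₀ h0.ne'
  have hr1 : 1 ≤ r := (one_le_inv₀ h0).2 h1.le
  have hκ0 : 0 ≤ κ := abs_nonneg _
  have hd : |diagZ q a 0 c| ≤ κ * w ^ 2 := abs_diagZ_zero_le q a c
  have hd₁ : |diagZ q a 0 (c + 2)| ≤ κ * (w * q ^ 2) ^ 2 := by
    have := abs_diagZ_zero_le q a (c + 2)
    rwa [Real.rpow_add h0, Real.rpow_two] at this
  have hd₂ : |diagZ q a 0 (c - 2)| ≤ κ * (w * r ^ 2) ^ 2 := by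
    have := abs_diagZ_zero_le q a (c - 2)
    rwa [Real.rpow_sub h0, Real.rpow_two, div_eq_mul_inv, ← inv_pow] at this
  obtain ⟨u₁, u₂, hu₁, hu₂, hZ, hY, -⟩ := π.exists_ladder hcas hu
  have hdu : (⟪u, π.sph (podZ q a) u⟫_ℂ).re = diagZ q a 0 c := by
    rw [re_inner_podZ_eigenvector hcas hu, hu1, one_pow, mul_one]
  have hn₁ : ‖u₁‖ ≤ κ * w ^ 2 * q ^ 2 := by
    refine abs_le_of_sq_le_sq' ?_ (by positivity) |>.2
    refine (norm_sq_le_of_semidefinite hs hpos hdu (re_inner_podZ_eigenvector hcas hu₁) ?_).trans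
      ((mul_le_mul hd hd₁ (abs_nonneg _) (by positivity)).trans (le_of_eq (by ring)))
    rw [hZ, inner_add_right, inner_add_right, inner_smul_right,
      inner_eq_zero_of_eigenvector (by linarith) hu₁ hu,
      inner_eq_zero_of_eigenvector (by linarith) hu₁ hu₂, inner_self_eq_norm_sq_to_K]
    simp [← Complex.ofReal_pow]
  have hn₂ : ‖u₂‖ ≤ κ * w ^ 2 * r ^ 2 := by
    refine abs_le_of_sq_le_sq' ?_ (by positivity) |>.2
    refine (norm_sq_le_of_semidefinite hs hpos hdu (re_inner_podZ_eigenvector hcas hu₂) ?_).trans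
      ((mul_le_mul hd hd₂ (abs_nonneg _) (by positivity)).trans (le_of_eq (by ring)))
    rw [hZ, inner_add_right, inner_add_right, inner_smul_right,
      inner_eq_zero_of_eigenvector (by linarith) hu₂ hu,
      inner_eq_zero_of_eigenvector (by linarith) hu₂ hu₁, inner_self_eq_norm_sq_to_K]
    simp [← Complex.ofReal_pow]
  have he : |diagY q a 0 c| ≤ κ * w := by
    have hs1 : 1 ≤ qsum q 1 := by
      rw [qsum, Real.rpow_one, Real.rpow_neg_one]; linarith
    have hqd : |qdiff q c| ≤ w⁻¹ := by
      rw [qdiff, Real.rpow_neg h0.le, abs_le]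
      have : 1 ≤ w⁻¹ := (one_le_inv₀ hw0).2 hw1
      constructor <;> linarith
    rw [diagY, zero_sub, abs_div, abs_neg, abs_mul, abs_of_pos (qsum_pos q 1)]
    refine (div_le_self (by positivity) hs1).trans ?_
    calc |qdiff q c| * |diagZ q a 0 c| ≤ w⁻¹ * (κ * w ^ 2) :=
          mul_le_mul hqd hd (abs_nonneg _) (by positivity)
      _ = κ * w := by field_simp
  have hr3 : 1 ≤ r ^ 3 := one_le_pow₀ hr1
  have hYn : ‖π.sph (podY q a) u‖ ≤ 3 * κ * r ^ 3 * w := by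
    have e1 : (q : ℝ) ^ (-c - 1) = w⁻¹ * r := by
      rw [Real.rpow_sub h0, Real.rpow_neg h0.le, Real.rpow_one, div_eq_mul_inv]
    have e2 : (q : ℝ) ^ (c - 1) = w * r := by
      rw [Real.rpow_sub h0, Real.rpow_one, div_eq_mul_inv]
    have h2 : ‖π.sph (podY q a) u‖ ≤ w⁻¹ * r * ‖u₁‖ + w * r * ‖u₂‖ + |diagY q a 0 c| := by
      rw [hY, norm_smul, Complex.norm_I, one_mul, e1, e2]
      refine (norm_add_le _ _).trans (add_le_add ((norm_sub_le _ _).trans (add_le_add ?_ ?_)) ?_)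
      · rw [norm_smul, Complex.norm_real, Real.norm_of_nonneg (by positivity)]
      · rw [norm_smul, Complex.norm_real, Real.norm_of_nonneg (by positivity)]
      · rw [norm_smul, hu1, mul_one, Complex.norm_real, Real.norm_eq_abs]
    have h3 : w⁻¹ * r * ‖u₁‖ ≤ κ * w * r ^ 3 := by
      calc w⁻¹ * r * ‖u₁‖ ≤ w⁻¹ * r * (κ * w ^ 2 * q ^ 2) := by gcongr
        _ = κ * w * (q * (q * r)) := by field_simp
        _ ≤ κ * w * r ^ 3 := by
          rw [hqr, mul_one]; gcongr; linarith
    have h4 : w * r * ‖u₂‖ ≤ κ * w * r ^ 3 := by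
      calc w * r * ‖u₂‖ ≤ w * r * (κ * w ^ 2 * r ^ 2) := by gcongr
        _ = κ * w * r ^ 3 * w ^ 2 := by ring
        _ ≤ κ * w * r ^ 3 * 1 := by gcongr; exact pow_le_one₀ hw0.le hw1
        _ = _ := mul_one _
    have h5 : κ * w ≤ κ * w * r ^ 3 := le_mul_of_one_le_right (by positivity) hr3
    linarith
  have hZn : q * ‖π.sph (podZ q a) u‖ ≤ 3 * κ * r ^ 3 * w := by
    have h2 : ‖π.sph (podZ q a) u‖ ≤ ‖u₁‖ + |diagZ q a 0 c| + ‖u₂‖ := by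
      rw [hZ]
      refine (norm_add_le _ _).trans (add_le_add ((norm_add_le _ _).trans (add_le_add le_rfl ?_)) le_rfl)
      rw [norm_smul, hu1, mul_one, Complex.norm_real, Real.norm_eq_abs]
    have hq2 : (q : ℝ) ^ 2 ≤ 1 := pow_le_one₀ h0.le h1.le
    have hr2 : 1 ≤ r ^ 2 := one_le_pow₀ hr1
    have hr23 : r ^ 2 ≤ r ^ 3 := pow_le_pow_right₀ hr1 (by norm_num)
    have hw2 : κ * w ^ 2 ≤ κ * w := mul_le_mul_of_nonneg_left (by nlinarith) hκ0
    have h3 : ‖π.sph (podZ q a) u‖ ≤ 3 * (κ * w ^ 2) * r ^ 2 := by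
      have hk0 : 0 ≤ κ * w ^ 2 := by positivity
      nlinarith
    calc q * ‖π.sph (podZ q a) u‖ ≤ 1 * (3 * (κ * w ^ 2) * r ^ 2) := by gcongr
      _ ≤ 1 * (3 * (κ * w) * r ^ 3) := by gcongr
      _ = _ := by ring
  have hfin := π.norm_podY_sq u
  rw [hdu, hu1] at hfin
  have h6 : ‖π.sph (podY q a) u‖ ^ 2 ≤ (3 * κ * r ^ 3 * w) ^ 2 := by gcongr
  have h7 : (q * ‖π.sph (podZ q a) u‖) ^ 2 ≤ (3 * κ * r ^ 3 * w) ^ 2 := by gcongr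
  have h8 : qdiff q a * q * diagZ q a 0 c ≤ |qdiff q a| * κ * w ^ 2 := by
    refine (le_abs_self _).trans ?_
    rw [abs_mul, abs_mul, abs_of_pos h0]
    calc |qdiff q a| * q * |diagZ q a 0 c| ≤ |qdiff q a| * 1 * (κ * w ^ 2) := by gcongr
      _ = _ := by ring
  have h9 : 1 ≤ C * w ^ 2 := by
    have e1 : C * w ^ 2 = (3 * κ * r ^ 3 * w) ^ 2 + |qdiff q a| * κ * w ^ 2 +
        (3 * κ * r ^ 3 * w) ^ 2 := by rw [hC]; ring
    have e2 : (q : ℝ) ^ 2 * ‖π.sph (podZ q a) u‖ ^ 2 = (q * ‖π.sph (podZ q a) u‖) ^ 2 := by ring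
    rw [e2] at hfin
    linarith
  have h10 : C * w ^ 2 ≤ C * w :=
    mul_le_mul_of_nonneg_left (pow_le_of_le_one hw0.le hw1 two_ne_zero) hC0
  linarith

/-- For `λ ≠ 0` the numerator of `diagZ` takes both signs as the weight goes to `±∞`; only `λ = 0`
needs off-diagonal information. -/
theorem not_semidefinite {lam c₀ s : ℝ} (hcas : π.Casimir = (lam : ℂ) • 1)
    (hev : ∀ k : ℤ, ∃ u, u ≠ 0 ∧ π.iB u = (qnum q (c₀ + 2 * k) : ℂ) • u) (hs : |s| = 1)
    (hpos : ∀ v : V, 0 ≤ s * (⟪v, π.sph (podZ q a) v⟫_ℂ).re) : False := by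
  have hs0 : s ≠ 0 := by rintro rfl; simp at hs
  by_cases hlam : lam = 0
  · subst hlam
    exact not_semidefinite_of_casimir_eq_zero hcas hev hs hpos
  · obtain ⟨k, hk⟩ := exists_mul_qdiff_lt q c₀ (s * (qsum q 1 * qdiff q a)) (mul_ne_zero hs0 hlam)
    obtain ⟨u, hu0, hu⟩ := hev k
    have h := hpos u
    rw [re_inner_podZ_eigenvector hcas hu, ← mul_assoc] at h
    replace h := nonneg_of_mul_nonneg_left h (by positivity)
    rw [diagZ, mul_div_assoc'] at h
    have hneg : s * (qdiff q (c₀ + 2 * k) * lam - qsum q 1 * qdiff q a) < 0 := by linarith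
    exact absurd h (not_le.2 (div_neg_of_neg_of_pos hneg
      (mul_pos (qsum_pos q _) (qsum_pos q _))))

end UnitaryRep

/-! ### Bounds on the Casimir value and assembly of the cases -/

section QNumbers
variable (q : Param)

theorem qsum_le_qsum_one {x : ℝ} (hx : |x| ≤ 1) : qsum q x ≤ qsum q 1 := by
  have h0 := q.2.1
  have hw := Real.rpow_pos_of_pos h0 x
  obtain ⟨h1, h2⟩ := abs_le.1 hx
  have h3 : (q : ℝ) ≤ (q : ℝ) ^ x := by
    simpa using Real.rpow_le_rpow_of_exponent_ge h0 q.2.2.le h2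
  have h4 : (q : ℝ) ^ x ≤ (q : ℝ)⁻¹ := by
    rw [← Real.rpow_neg_one]
    exact Real.rpow_le_rpow_of_exponent_ge h0 q.2.2.le h1
  rw [qsum, qsum, Real.rpow_neg h0.le, Real.rpow_one, Real.rpow_neg_one]
  have h5 : ((q : ℝ) + (q : ℝ)⁻¹) - ((q : ℝ) ^ x + ((q : ℝ) ^ x)⁻¹) =
      ((q : ℝ) ^ x - q) * ((q : ℝ)⁻¹ - (q : ℝ) ^ x) * ((q : ℝ) ^ x)⁻¹ := by
    field_simp
    ring
  have h6 : 0 ≤ ((q : ℝ) ^ x - q) * ((q : ℝ)⁻¹ - (q : ℝ) ^ x) * ((q : ℝ) ^ x)⁻¹ :=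
    mul_nonneg (mul_nonneg (by linarith) (by linarith)) (by positivity)
  linarith

theorem abs_one_sub_two_mul_ceil_sub_le (x : ℝ) : |1 - 2 * ((⌈x⌉ : ℝ) - x)| ≤ 1 := by
  have h1 := Int.le_ceil x
  have h2 := Int.ceil_lt_add_one x
  rw [abs_le]
  constructor <;> linarith

end QNumbers

namespace UnitaryRep
open UniformSpace (Completion)
variable {q : Param} {a : ℝ} {V : Type*} [NormedAddCommGroup V] [InnerProductSpace ℂ V]
  {π : UnitaryRep q a V}

/-- If the vacuum of sign `ε` vanished, the representation would be `π_{-ε}` and `-εZ` would be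
positive semidefinite, which `not_semidefinite` excludes. -/
theorem exists_uequivSum_of_two_sided (hadm : π.IsAdmissible) (hirr : π.IsIrreducible) {lam c₀ : ℝ}
    (hcas : π.Casimir = (lam : ℂ) • 1) (hlam : |lam| < qsum q 1)
    (hev : ∀ k : ℤ, ∃ u, u ≠ 0 ∧ π.iB u = (qnum q (c₀ + 2 * k) : ℂ) • u) :
    ∃ σ₁ σ₂ : PodlesRep q a L2N, IsPi 1 σ₁ ∧ IsPi (-1) σ₂ ∧ UEquivSum π.compl σ₁ σ₂ := by
  have hZ := podZ_injective_of_abs_lt hcas hlam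
  obtain ⟨ξ, hξ0, hξ⟩ := hev 0
  have huniq := vacuum_unique hadm hirr hcas hξ0 hξ
  have := nontrivial_completion hirr
  refine exists_uequivSum_isPi hZ (fun ε h => ?_) huniq
  obtain ⟨σ, hσ, hρ⟩ := exists_uequiv_isPi hZ (ε := -ε) (by rwa [neg_neg]) (huniq _)
  refine not_semidefinite hcas hev (s := (((-ε : ℤˣ) : ℤ) : ℝ)) ?_ fun v => ?_
  · rcases Int.units_eq_one_or ε with rfl | rfl <;> simp
  · have := hρ.inner_podZ_nonneg hσ (v : Completion V)
    rwa [compl_coe, Completion.inner_coe] at this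

theorem IsOfType.exists_eigenvector {ℓ : IrrepType} (h : π.IsOfType ℓ) {c : ℝ}
    (hc : qnum q c ∈ ℓ.spec q a) : ∃ u, u ≠ 0 ∧ π.iB u = (qnum q c : ℂ) • u := by
  have : (qnum q c : ℂ) ∈ {μ : ℂ | π.iB.HasEigenvalue μ} := by
    rw [h.2.2]; exact ⟨_, hc, rfl⟩
  obtain ⟨u, hu⟩ := Module.End.HasEigenvalue.exists_hasEigenvector this
  exact ⟨u, hu.2, hu.apply_eq_smul⟩

theorem IsOfType.eq_zero {ℓ : IrrepType} (h : π.IsOfType ℓ) {c : ℝ}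
    (hc : qnum q c ∉ ℓ.spec q a) (u : V) (hu : π.iB u = (qnum q c : ℂ) • u) : u = 0 := by
  by_contra hne
  have : (qnum q c : ℂ) ∈ {μ : ℂ | π.iB.HasEigenvalue μ} :=
    Module.End.hasEigenvalue_of_hasEigenvector ⟨Module.End.mem_eigenspace_iff.2 hu, hne⟩
  rw [h.2.2] at this
  obtain ⟨x, hx, hxc⟩ := this
  rw [Complex.ofReal_inj.1 hxc] at hx
  exact hc hx

/-- Used with `d = 2` below a lowest weight and with `d = -2` above a highest one. -/
theorem qnum_notMem_range {c d : ℝ} {f : ℕ → ℝ} (hf : ∀ k, f k = c + d * k) (hd : d ≠ 0) :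
    qnum q (c - d) ∉ Set.range fun k : ℕ => qnum q (f k) := by
  rintro ⟨k, hk⟩
  have h := qnum_injective q hk
  rw [hf] at h
  have h2 : d * ((k : ℝ) + 1) = 0 := by linear_combination h
  have h3 : (k : ℝ) + 1 ≠ 0 := by positivity
  exact (mul_ne_zero hd h3) h2

end UnitaryRep

end QuantumSL2

end

theorem theorem4p2 (q : Set.Ioo (0 : ℝ) 1) (a : ℝ) {V : Type*} [NormedAddCommGroup V]
    [InnerProductSpace ℂ V] (π : UnitaryRep q a V) (hadm : π.IsAdmissible)
    (hirr : π.IsIrreducible) :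
    ∃ π' : PodlesRep q a (UniformSpace.Completion V),
      (∀ (f : Podles q a) (v : V),
        π' f (v : UniformSpace.Completion V) = (π.sph f v : UniformSpace.Completion V)) ∧
      (((∃ lam : ℝ, π.IsOfType (.Lplus lam) ∨ π.IsOfType (.Lminus lam)) →
        ∃ ρ₁ ρ₂ : PodlesRep q a L2N, IsPi 1 ρ₁ ∧ IsPi (-1) ρ₂ ∧ UEquivSum π' ρ₁ ρ₂) ∧
      ((∃ n : ℕ, π.IsOfType (.Dminus n) ∨ π.IsOfType (.Eplus n)) →
        ∃ ρ : PodlesRep q a L2N, IsPi 1 ρ ∧ UEquiv π' ρ) ∧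
      ((∃ n : ℕ, π.IsOfType (.Dplus n) ∨ π.IsOfType (.Eminus n)) →
        ∃ ρ : PodlesRep q a L2N, IsPi (-1) ρ ∧ UEquiv π' ρ) ∧
      (π.IsOfType .Tplus → ∃ χ : PodlesRep q a ℂ, IsChar (-Complex.I) χ ∧ UEquiv π' χ) ∧
      (π.IsOfType .Tminus → ∃ χ : PodlesRep q a ℂ, IsChar Complex.I χ ∧ UEquiv π' χ)) := by
  refine ⟨π.compl, π.compl_coe, ?_, ?_, ?_, ?_, ?_⟩
  · rintro ⟨lam, h | h⟩
    · obtain ⟨h1, h2⟩ := h.1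
      refine UnitaryRep.exists_uequivSum_of_two_sided hadm hirr h.2.1 (c₀ := a) (abs_lt.2 ⟨?_,
        h2⟩) fun k =>
        h.exists_eigenvector ⟨k, rfl⟩
      have := qsum_le_qsum_one q (abs_one_sub_two_mul_ceil_sub_le a)
      change -qsum q 1 < lam
      linarith
    · obtain ⟨h1, h2⟩ := h.1
      refine UnitaryRep.exists_uequivSum_of_two_sided hadm hirr h.2.1 (c₀ := a + 1) (abs_lt.2 ⟨?_,
        ?_⟩) fun k =>
        h.exists_eigenvector ⟨k, by simp only; ring_nf⟩
      · have := qsum_le_qsum_one q (abs_one_sub_two_mul_ceil_sub_le (a - 1 / 2))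
        change -qsum q 1 < lam
        linarith
      · exact h2.trans_le (qsum_le_qsum_one q (by simp))
  · rintro ⟨n, h | h⟩
    · obtain ⟨ξ, hξ0, hξ⟩ := h.exists_eigenvector (c := a - n) ⟨0, by simp⟩
      refine UnitaryRep.exists_uequiv_of_highest hadm hirr (m := n) (Nat.cast_pos.2 h.1) (by simp) ?_ h.2.1 hξ0 hξ
        (h.eq_zero ?_)
      · simp [IrrepType.casimir]
      · have := UnitaryRep.qnum_notMem_range (q := q) (c := a - n) (d := -2) (f := fun k => a - n - 2 * k)
          (fun k => by ring) (by norm_num)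
        rwa [sub_neg_eq_add] at this
    · obtain ⟨ξ, hξ0, hξ⟩ := h.exists_eigenvector (c := a + (⌊-2 * a⌋ : ℝ) + n) ⟨0, by simp⟩
      have hn : (1 : ℝ) ≤ n := by exact_mod_cast Nat.one_le_iff_ne_zero.2 (Nat.pos_iff_ne_zero.1 h.1)
      -- `m` is `c + εa` with `ε = 1`; it is positive because `-2a < ⌊-2a⌋ + 1` and `n ≥ 1`.
      refine UnitaryRep.exists_uequiv_of_lowest hadm hirr (m := 2 * a + (⌊-2 * a⌋ : ℝ) + n) ?_ ?_ ?_ h.2.1 hξ0 hξ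
        (h.eq_zero (UnitaryRep.qnum_notMem_range (fun k => rfl) two_ne_zero))
      · linarith [Int.lt_floor_add_one (-2 * a)]
      · push_cast; ring
      · simp [IrrepType.casimir]
  · rintro ⟨n, h | h⟩
    · obtain ⟨ξ, hξ0, hξ⟩ := h.exists_eigenvector (c := a + n) ⟨0, by simp⟩
      refine UnitaryRep.exists_uequiv_of_lowest hadm hirr (m := n) (Nat.cast_pos.2 h.1) ?_ ?_ h.2.1 hξ0 hξ
        (h.eq_zero (UnitaryRep.qnum_notMem_range (fun k => rfl) two_ne_zero))
      · push_cast; ring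
      · simp [IrrepType.casimir]
    · obtain ⟨ξ, hξ0, hξ⟩ := h.exists_eigenvector (c := a - (⌊2 * a⌋ : ℝ) - n) ⟨0, by simp⟩
      have hn : (1 : ℝ) ≤ n := by exact_mod_cast Nat.one_le_iff_ne_zero.2 (Nat.pos_iff_ne_zero.1 h.1)
      -- `m` is `εa - c` with `ε = -1`.
      refine UnitaryRep.exists_uequiv_of_highest hadm hirr (m := -2 * a + (⌊2 * a⌋ : ℝ) + n) ?_ ?_ ?_ h.2.1 hξ0 hξ
        (h.eq_zero ?_)
      · linarith [Int.lt_floor_add_one (2 * a)]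
      · push_cast; ring
      · simp [IrrepType.casimir]
      · have := UnitaryRep.qnum_notMem_range (q := q) (c := a - (⌊2 * a⌋ : ℝ) - n) (d := -2)
          (f := fun k => a - (⌊2 * a⌋ : ℝ) - n - 2 * k) (fun k => by ring) (by norm_num)
        rwa [sub_neg_eq_add] at this
  · intro h
    have hd : diagZ q a (qsum q 1) a = 0 := by rw [diagZ, mul_comm, sub_self, zero_div]
    obtain ⟨χ, hχ, hρ⟩ := UnitaryRep.exists_scalar_character hadm hirr h.2.1 hd (y := 1)
      (by
        change diagY q a (qsum q 1) a = 1
        rw [diagY, hd, mul_zero, sub_zero, div_self (qsum_pos q 1).ne'])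
      (fun μ hμ => by
        have : μ ∈ {μ : ℂ | π.iB.HasEigenvalue μ} := hμ
        rw [h.2.2] at this
        simpa [IrrepType.spec] using this)
    exact ⟨χ, by simpa using hχ, hρ⟩
  · intro h
    have hd : diagZ q a (-qsum q 1) (-a) = 0 := by
      rw [diagZ, qdiff_neg, neg_mul_neg, mul_comm, sub_self, zero_div]
    -- `y = λ/⟨1⟩` because `diagZ` vanishes; the sign of `λ` thus turns `χ_{-i}` into `χ_i`.
    obtain ⟨χ, hχ, hρ⟩ := UnitaryRep.exists_scalar_character hadm hirr h.2.1 hd (y := -1)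
      (by
        change diagY q a (-qsum q 1) (-a) = -1
        rw [diagY, hd, mul_zero, sub_zero, neg_div, div_self (qsum_pos q 1).ne'])
      (fun μ hμ => by
        have : μ ∈ {μ : ℂ | π.iB.HasEigenvalue μ} := hμ
        rw [h.2.2] at this
        simpa [IrrepType.spec] using this)
    exact ⟨χ, by simpa using hχ, hρ⟩
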